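/- Let $n\ge 2$, and let $M$ be one of the following two monoids with set of generators $\Sigma$: the monoid of positive braids on $n$ strands, with generators $\sigma_1,\dots,\sigma_{n-1}$ and relations $\sigma_i\sigma_j=\sigma_j\sigma_i$ for $|i-j|\ge2$, $\sigma_i\sigma_j\sigma_i=\sigma_j\sigma_i\sigma_j$ for $|i-j|=1$; or the monoid of dual positive braids, with generators $\sigma_{i,j}=\sigma_{j,i}$ for $1\le i<j\le n$ and relations $\sigma_{i,j}\sigma_{j,k}=\sigma_{j,k}\sigma_{k,i}=\sigma_{k,i}\sigma_{i,j}$ for $i<j<k$, and $\sigma_{i,j}\sigma_{k,\ell}=\sigma_{k,\ell}\sigma_{i,j}$ for $i<j<k<\ell$ and for $i<k<\ell<j$. Let $\mathbf e$ be the unit of $M$ and $|x|$ the length of any word representing $x\in M$. Write $x\le y$ if $y=xz$ for some $z\in M$. For $X\subseteq\Sigma$ let $\Delta_X$ be the least upper bound of $X$ for $\le$, and put $\Delta=\Delta_\Sigma$. Let $\mathcal S=\{x\in M: x\le\Delta\}$ be the finite set of simple braids, and for $x,y\in\mathcal S$ write $x\to y$ if every $\sigma\in\Sigma$ with $\sigma\le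 y$ satisfies $x\sigma\notin\mathcal S$. A generalized braid is an infinite sequence $(x_k)_{k\ge1}$ in $\mathcal S$ with $x_k\to x_{k+1}$ for all $k$; the set $\overline M$ of generalized braids carries the topology induced by the product of discrete topologies, and its Borel $\sigma$-algebra. A braid $x\in M$ is identified with its extended Garside decomposition, that is, its Garside normal form $(x_1,\dots,x_k)$ (the factorization $x=x_1\cdots x_k$ into non-unit simple braids in which each $x_j$ is the greatest lower bound of $\Delta$ and $x_jx_{j+1}\cdots x_k$) followed by infinitely many $\mathbf e$; thus $M\subseteq\overline M$. Put $\partial M=\overline M\setminus M$, and for $x\in M$ put $\Uparrow x=\overline{\{xz: z\in M\}}$ (closure in $\overline M$) and $\uparrow x=\Uparrow x\cap\partial M$. Let $$H_n(t)=\sum_{X\subseteq\Sigma}(-1)^{|X|}t^{|\Delta_X|},$$ and let $q_n$ be the radius of convergence of the growth series $G_n(t)=\sum_{x\in M}t^{|x|}$. A uniform measure of parameter $p\ge0$ is a Borel probability measure $\nu_p$ on $\overline M$ with $\nu_p(\Uparrow x)=p^{|x|}$ for all $x\in M$. Say that a set $A\subseteq\overline M$ is the support of a measure $\nu$ if $\nu(\overline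 M\setminus A)=0$ and every neighbourhood of every point of $A$ has positive $\nu$-measure. Then: A uniform measure of parameter $p$ exists if and only if $p\in[0,q_n]\cup\{1\}$, and it is then unique. Moreover: 1. $\nu_0$ is the Dirac measure at $\mathbf e$. 2. $\nu_1$ is the Dirac measure at $\Delta^\infty=(\Delta,\Delta,\dots)$. 3. For $p\in(0,q_n)$, the support of $\nu_p$ is $M$; and a Borel probability measure $\nu$ on $\overline M$ satisfies $\nu(\Uparrow x)=p^{|x|}$ for all $x\in M$ if and only if $\nu(\{x\})=H_n(p)\,p^{|x|}$ for all $x\in M$. 4. For $p=q_n$, the support of $\nu_{q_n}$ is $\partial M$; and a Borel probability measure $\nu$ on $\overline M$ is equal to $\nu_{q_n}$ if and only if $\nu(\uparrow x)=q_n^{|x|}$ for all $x\in M$. -/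

import Mathlib

open MeasureTheory

noncomputable section

namespace Braids

/-! ### The two braid monoids, by generators and relations -/

/-- Defining relations of the monoid of positive braids on `n` strands. The generators
`σ_1, …, σ_{n-1}` are indexed by `Fin (n - 1)`. -/
inductive ArtinRel (n : ℕ) : FreeMonoid (Fin (n - 1)) → FreeMonoid (Fin (n - 1)) → Prop
  | comm (i j : Fin (n - 1)) (h : (i : ℕ) + 2 ≤ j) :
      ArtinRel n (.of i * .of j) (.of j * .of i)
  | braid (i j : Fin (n - 1)) (h : (i : ℕ) + 1 = j) :
      ArtinRel n (.of i * .of j * .of i) (.of j * .of i * .of j)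

/-- The generators `σ_{i,j}`, `i < j`, of the dual braid monoid on `n` strands. -/
abbrev DualGen (n : ℕ) : Type := {ij : Fin n × Fin n // ij.1 < ij.2}

/-- The one-letter word `σ_{i,j}`. -/
def dualLetter {n : ℕ} (i j : Fin n) (h : i < j) : FreeMonoid (DualGen n) := .of ⟨(i, j), h⟩

/-- Defining relations of the monoid of dual positive braids on `n` strands. The relations
`σ_{i,j} σ_{j,k} = σ_{j,k} σ_{k,i} = σ_{k,i} σ_{i,j}` use the convention
`σ_{k,i} = σ_{i,k}` for `i < k`. -/
inductive DualRel (n : ℕ) : FreeMonoid (DualGen n) → FreeMonoid (DualGen n) → Prop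
  | triangle₁ (i j k : Fin n) (hij : i < j) (hjk : j < k) :
      DualRel n (dualLetter i j hij * dualLetter j k hjk)
        (dualLetter j k hjk * dualLetter i k (hij.trans hjk))
  | triangle₂ (i j k : Fin n) (hij : i < j) (hjk : j < k) :
      DualRel n (dualLetter j k hjk * dualLetter i k (hij.trans hjk))
        (dualLetter i k (hij.trans hjk) * dualLetter i j hij)
  | disjoint (i j k l : Fin n) (hij : i < j) (_hjk : j < k) (hkl : k < l) :
      DualRel n (dualLetter i j hij * dualLetter k l hkl)
        (dualLetter k l hkl * dualLetter i j hij)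
  | nested (i j k l : Fin n) (hik : i < k) (hkl : k < l) (hlj : l < j) :
      DualRel n (dualLetter i j ((hik.trans hkl).trans hlj) * dualLetter k l hkl)
        (dualLetter k l hkl * dualLetter i j ((hik.trans hkl).trans hlj))

/-- Which of the two braid monoids is considered. -/
inductive Kind
  | artin
  | dual

/-- The set `Σ` of generators. -/
def Gen : Kind → ℕ → Type
  | .artin, n => Fin (n - 1)
  | .dual, n => DualGen n

instance instFintypeGen : (κ : Kind) → (n : ℕ) → Fintype (Gen κ n)
  | .artin, n => inferInstanceAs (Fintype (Fin (n - 1)))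
  | .dual, n => inferInstanceAs (Fintype (DualGen n))

/-- The defining relations. -/
def Rel : (κ : Kind) → (n : ℕ) → FreeMonoid (Gen κ n) → FreeMonoid (Gen κ n) → Prop
  | .artin, n => ArtinRel n
  | .dual, n => DualRel n

/-- The braid monoid on `n` strands: positive braids or dual positive braids. -/
abbrev Braid (κ : Kind) (n : ℕ) : Type := PresentedMonoid (Rel κ n)

variable {κ : Kind} {n : ℕ}

/-- The generator, as an element of the monoid. -/
def gen (s : Gen κ n) : Braid κ n := PresentedMonoid.of (Rel κ n) s

theorem rel_homogeneous (a b : FreeMonoid (Gen κ n)) (h : Rel κ n a b) :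
    FreeMonoid.lift (fun _ : Gen κ n => Multiplicative.ofAdd (1 : ℕ)) a =
      FreeMonoid.lift (fun _ : Gen κ n => Multiplicative.ofAdd (1 : ℕ)) b := by
  cases κ
  · cases h <;> rfl
  · cases h <;> rfl

/-- The length, as a monoid morphism sending every generator to `1`. -/
def lengthHom (κ : Kind) (n : ℕ) : Braid κ n →* Multiplicative ℕ :=
  PresentedMonoid.lift (fun _ => Multiplicative.ofAdd 1) rel_homogeneous

/-- The length `|x|` of a braid: the length of any word that represents it. -/
def len (x : Braid κ n) : ℕ := (lengthHom κ n x).toAdd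

theorem len_one : len (1 : Braid κ n) = 0 := by simp [len]

theorem len_mul (x y : Braid κ n) : len (x * y) = len x + len y := by simp [len]

theorem len_gen (s : Gen κ n) : len (gen s) = 1 := rfl

/-- The length is the number of letters of any representing word. -/
theorem len_mk (w : FreeMonoid (Gen κ n)) :
    len (PresentedMonoid.mk (Rel κ n) w) = w.length := by
  induction w using FreeMonoid.inductionOn' with
  | one => simp [len_one]
  | of_mul s w ih =>
    rw [map_mul, len_mul, ih, FreeMonoid.length_mul, FreeMonoid.length_of]
    rfl

/-! ### Garside structure

In a noncommutative monoid `x ∣ y` means `∃ z, y = x * z`: it is left divisibility. -/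

/-- `d` is the least upper bound of `X ⊆ Σ` for left divisibility. -/
def IsJoin (X : Finset (Gen κ n)) (d : Braid κ n) : Prop :=
  (∀ s ∈ X, gen s ∣ d) ∧ ∀ m : Braid κ n, (∀ s ∈ X, gen s ∣ m) → d ∣ m

/-- `d` is the greatest lower bound of `x` and `y` for left divisibility. -/
def IsMeet (x y d : Braid κ n) : Prop :=
  (d ∣ x ∧ d ∣ y) ∧ ∀ m : Braid κ n, m ∣ x → m ∣ y → m ∣ d

/-- `Δ_X`, the least upper bound of `X ⊆ Σ` for left divisibility. -/
def deltaOf (X : Finset (Gen κ n)) : Braid κ n := Classical.epsilon (IsJoin X)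

/-- The Garside element `Δ = Δ_Σ`. -/
def delta (κ : Kind) (n : ℕ) : Braid κ n := deltaOf Finset.univ

/-- Simple braids: the divisors of `Δ`. -/
def Simple (κ : Kind) (n : ℕ) : Type := {x : Braid κ n // x ∣ delta κ n}

/-- The unit as a simple braid. -/
def Simple.unit : Simple κ n := ⟨1, one_dvd _⟩

/-- The Garside element as a simple braid. -/
def Simple.delta : Simple κ n := ⟨Braids.delta κ n, dvd_rfl⟩

/-- The finite set of simple braids carries the discrete topology. -/
instance : TopologicalSpace (Simple κ n) := ⊥

instance : DiscreteTopology (Simple κ n) := ⟨rfl⟩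

/-- The relation `x → y` between simple braids, that is `L(y) ⊆ R(x)`, where
`R(x) = {σ ∈ Σ : x σ is not simple}` and `L(y) = {σ ∈ Σ : σ left divides y}`. -/
def Arrow (x y : Simple κ n) : Prop :=
  {s : Gen κ n | gen s ∣ y.1} ⊆ {s : Gen κ n | ¬ x.1 * gen s ∣ delta κ n}

/-- A sequence `(x_1, …, x_k)` is normal if `x_j = Δ ∧ (x_j ⋯ x_k)` for all `j`. -/
def IsNormal : List (Braid κ n) → Prop
  | [] => True
  | x :: l => IsMeet (delta κ n) (x * l.prod) x ∧ IsNormal l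

/-- `l` is the Garside normal form of `x`, without unit factors. For `x = 1` this is the empty
list; the alternative convention `(e)` gives the same extended decomposition. -/
def IsGarsideForm (x : Braid κ n) (l : List (Braid κ n)) : Prop :=
  l.prod = x ∧ IsNormal l ∧ ∀ y ∈ l, y ≠ 1

/-! ### Generalized braids -/

/-- Generalized braids: infinite paths in the graph of simple braids. -/
def GenBraid (κ : Kind) (n : ℕ) : Type :=
  {ξ : ℕ → Simple κ n // ∀ k, Arrow (ξ k) (ξ (k + 1))}

/-- The topology induced by the product topology on sequences of simple braids. -/
instance : TopologicalSpace (GenBraid κ n) :=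
  inferInstanceAs (TopologicalSpace {ξ : ℕ → Simple κ n // ∀ k, Arrow (ξ k) (ξ (k + 1))})

instance : MeasurableSpace (GenBraid κ n) := borel _

instance : BorelSpace (GenBraid κ n) := ⟨rfl⟩

theorem arrow_unit (x : Simple κ n) : Arrow x Simple.unit := by
  rintro s ⟨z, hz⟩
  have h := congrArg len hz
  simp only [Simple.unit, len_mul, len_one, len_gen] at h
  omega

theorem delta_arrow (y : Simple κ n) : Arrow Simple.delta y := by
  rintro s - ⟨z, hz⟩
  have h := congrArg len hz
  simp only [Simple.delta, len_mul, len_gen] at h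
  omega

instance : Nonempty (GenBraid κ n) := ⟨⟨fun _ => Simple.unit, fun _ => arrow_unit _⟩⟩

/-- The infinite braid `Δ^∞`, with Garside decomposition `(Δ, Δ, …)`. -/
def deltaInf (κ : Kind) (n : ℕ) : GenBraid κ n :=
  ⟨fun _ => Simple.delta, fun _ => delta_arrow _⟩

/-- The embedding of finite braids in generalized braids: a braid is sent to its extended Garside
decomposition, that is, its Garside normal form completed with infinitely many units. -/
def ofBraid (x : Braid κ n) : GenBraid κ n :=
  Classical.epsilon fun ξ : GenBraid κ n =>
    ∃ l, IsGarsideForm x l ∧ ∀ k, (ξ.1 k).1 = l.getD k 1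

/-- The set of finite braids inside generalized braids. -/
def finiteBraids (κ : Kind) (n : ℕ) : Set (GenBraid κ n) := Set.range ofBraid

/-- The boundary: the set of infinite braids. -/
def boundary (κ : Kind) (n : ℕ) : Set (GenBraid κ n) := (finiteBraids κ n)ᶜ

/-- The full visual cylinder `⇑x`. -/
def fullCylinder (x : Braid κ n) : Set (GenBraid κ n) :=
  closure {ξ | ∃ z : Braid κ n, ξ = ofBraid (x * z)}

/-- The visual cylinder `↑x`. -/
def cylinder (x : Braid κ n) : Set (GenBraid κ n) := fullCylinder x ∩ boundary κ n

/-! ### Möbius polynomial, growth series, uniform measures -/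

/-- The Möbius polynomial `H_n(t) = ∑_{X ⊆ Σ} (-1)^|X| t^|Δ_X|`. -/
def moebius (κ : Kind) (n : ℕ) (t : ℝ) : ℝ :=
  ∑ X : Finset (Gen κ n), (-1 : ℝ) ^ X.card * t ^ len (deltaOf X)

/-- `q_n`: the radius of convergence of the growth series `G_n(t) = ∑_x t^|x|`, a power series
with nonnegative coefficients. -/
def radius (κ : Kind) (n : ℕ) : ℝ :=
  sSup {t : ℝ | 0 ≤ t ∧ Summable fun x : Braid κ n => t ^ len x}

/-- `ν` is a uniform measure of parameter `p`. -/
structure IsUniform (ν : Measure (GenBraid κ n)) (p : ℝ) : Prop where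
  isProbabilityMeasure : IsProbabilityMeasure ν
  nonneg : 0 ≤ p
  real_fullCylinder : ∀ x : Braid κ n, ν.real (fullCylinder x) = p ^ len x

/-- `A` is the support of `ν`: `ν` is concentrated on `A`, and every neighbourhood of every point
of `A` has positive measure. For closed `A` this is equality with the topological support; for a
set `A` of isolated points it says that `A` is the set of atoms and carries all the mass. -/
def HasSupport (ν : Measure (GenBraid κ n)) (A : Set (GenBraid κ n)) : Prop :=
  ν Aᶜ = 0 ∧ A ⊆ ν.support

end Braids

end

open MeasureTheory

noncomputable section

namespace Braids

/-! A uniform measure prescribes the mass of every full cylinder. Two braids have a least common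
right multiple, so full cylinders are stable under non-empty intersection, and they generate the
Borel sets: this gives uniqueness (`IsUniform.unique`). Inclusion–exclusion over joins of generators
gives the mass of the set of generalized braids above `x` but above no `x s` with `s ∈ K`: it is `p
^ |x|` times the Möbius polynomial of `K` (`IsUniform.real_gap`). Taking for `K` all generators, the
atom at `x` has mass `H(p) p ^ |x|`; smaller sets `K` give the masses of Garside prefixes.

Where the growth series `G` converges, normalizing the weights `t ^ |x|` gives a uniform measure
carried by finite braids, and its total mass yields `H G = 1`. At the radius `q` a weak limit exists
by compactness. The series diverges at `q`, hence `H(q) = 0` and finite braids have no mass. For `p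
= 1` the Dirac mass at `Δ^∞` works, since every braid divides a power of `Δ`.

The remaining point is that no parameter lies strictly between `q` and `1`. A prefix `y` whose last
factor `a` is not the unit has mass `p ^ |y|` times the Möbius polynomial of the generators that can
follow `a`, and these never are all the generators. If `0 < p < 1`, the Möbius polynomial of all
generators but one is positive at `p` (`IsUniform.mob_others_pos`), by explicit comparisons between
sets of generators. So prefixes have mass at least `c p ^ |y|` with `c > 0`; the braids with `k`
Garside factors have total `p`-weight at most `1 / c`, and the growth series converges below `p`
(`IsUniform.summable`). The same lower bound shows that the support at `q` is the whole boundary.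

The Garside theory is obtained uniformly for both monoids from an interval of the symmetric group
(`Germ`): below the longest element for the inversion length, below the long cycle for the
reflection length. The presented monoid acts on pairs formed of a simple head and a tail; this gives
left cancellation and greatest simple divisors, and the joins of pairs of generators then propagate
to all least common multiples. -/

section

/-! ### Intervals for a length function on a group -/

/-- A group with a subadditive length function and a distinguished element `top` whose
conjugation preserves the length. -/
structure LengthGroup (G : Type*) [Group G] where
  length : G → ℕ
  top : G
  length_mul_le : ∀ x y, length (x * y) ≤ length x + length y
  length_eq_zero : ∀ x, length x = 0 ↔ x = 1
  length_conj : ∀ x, length (top⁻¹ * x * top) = length x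

namespace LengthGroup

variable {G : Type*} [Group G] (Γ : LengthGroup G)

/-- The prefix order: `x` is the beginning of a geodesic from `1` to `y`. -/
def Pre (x y : G) : Prop := Γ.length x + Γ.length (x⁻¹ * y) = Γ.length y

variable {Γ} {x y z u : G}

theorem length_one : Γ.length 1 = 0 := (Γ.length_eq_zero 1).2 rfl

theorem pre_refl (x : G) : Γ.Pre x x := by simp [Pre, length_one]

theorem one_pre (x : G) : Γ.Pre 1 x := by simp [Pre, length_one]

theorem length_le_add (x y : G) : Γ.length y ≤ Γ.length x + Γ.length (x⁻¹ * y) := by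
  simpa using Γ.length_mul_le x (x⁻¹ * y)

theorem Pre.length_le (h : Γ.Pre x y) : Γ.length x ≤ Γ.length y := by
  unfold Pre at h; omega

theorem Pre.eq_of_length_le (h : Γ.Pre x y) (hl : Γ.length y ≤ Γ.length x) : x = y := by
  unfold Pre at h
  have := (Γ.length_eq_zero (x⁻¹ * y)).1 (by omega)
  exact inv_mul_eq_one.1 this

theorem Pre.antisymm (h : Γ.Pre x y) (h' : Γ.Pre y x) : x = y :=
  h.eq_of_length_le h'.length_le

theorem length_inv_mul_le (x y z : G) :
    Γ.length (x⁻¹ * z) ≤ Γ.length (x⁻¹ * y) + Γ.length (y⁻¹ * z) := by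
  have := Γ.length_mul_le (x⁻¹ * y) (y⁻¹ * z)
  rwa [show x⁻¹ * y * (y⁻¹ * z) = x⁻¹ * z by group] at this

theorem Pre.trans (h : Γ.Pre x y) (h' : Γ.Pre y z) : Γ.Pre x z := by
  have h1 := length_inv_mul_le (Γ := Γ) x y z
  have h2 := length_le_add (Γ := Γ) x z
  unfold Pre at *; omega

theorem Pre.quot (h : Γ.Pre x y) (h' : Γ.Pre y z) : Γ.Pre (x⁻¹ * y) (x⁻¹ * z) := by
  have h1 := h.trans h'
  unfold Pre at *
  rw [show (x⁻¹ * y)⁻¹ * (x⁻¹ * z) = y⁻¹ * z by group]; omega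

theorem Pre.mul (h : Γ.Pre x z) (h' : Γ.Pre u (x⁻¹ * z)) : Γ.Pre x (x * u) ∧ Γ.Pre (x * u) z := by
  have h1 := Γ.length_mul_le x u
  have h2 := length_le_add (Γ := Γ) (x * u) z
  unfold Pre at *
  rw [show u⁻¹ * (x⁻¹ * z) = (x * u)⁻¹ * z by group] at h'
  rw [show x⁻¹ * (x * u) = u by group]
  omega

/-- What remains after the complement of `x` is `top⁻¹ x top`, which is as long as `x`. Invariance
under conjugation enters the theory only here. -/
theorem Pre.compl (h : Γ.Pre x Γ.top) : Γ.Pre (x⁻¹ * Γ.top) Γ.top := by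
  unfold Pre at *
  rw [show (x⁻¹ * Γ.top)⁻¹ * Γ.top = Γ.top⁻¹ * x * Γ.top by group, Γ.length_conj]; omega

theorem Pre.right (h : Γ.Pre x y) (h' : Γ.Pre y Γ.top) : Γ.Pre (x⁻¹ * y) Γ.top :=
  (h.quot h').trans (h.trans h').compl

variable (Γ) in
/-- `l` is the join of `x` and `y` in the interval `[1, top]`. -/
def IsLub (x y l : G) : Prop :=
  Γ.Pre x l ∧ Γ.Pre y l ∧ ∀ z, Γ.Pre z Γ.top → Γ.Pre x z → Γ.Pre y z → Γ.Pre l z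

variable {ι : Type*} {atom : ι → G}

/-- If any two atoms have a join then any two bounded elements have one. -/
theorem exists_isLub (hne : ∀ s, atom s ≠ 1)
    (hex : ∀ x, Γ.Pre x Γ.top → x ≠ 1 → ∃ s, Γ.Pre (atom s) x)
    (hj : ∀ s t, ∃ j, Γ.IsLub (atom s) (atom t) j) :
    ∀ N m, Γ.Pre m Γ.top → Γ.length m ≤ N → ∀ x y, Γ.Pre x m → Γ.Pre y m →
      ∃ l, Γ.IsLub x y l := by
  intro N
  induction N with
  | zero =>
    intro m hm hN x y hx hy
    have hx1 : x = 1 := (Γ.length_eq_zero x).1 (by have := hx.length_le; omega)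
    exact ⟨y, by rw [hx1]; exact one_pre _, pre_refl _, fun z _ _ h => h⟩
  | succ N ih =>
    intro m hm hN x y hx hy
    by_cases hx1 : x = 1
    · exact ⟨y, by rw [hx1]; exact one_pre _, pre_refl _, fun z _ _ h => h⟩
    by_cases hy1 : y = 1
    · exact ⟨x, pre_refl _, by rw [hy1]; exact one_pre _, fun z _ h _ => h⟩
    obtain ⟨s, hs⟩ := hex x (hx.trans hm) hx1
    obtain ⟨t, ht⟩ := hex y (hy.trans hm) hy1
    obtain ⟨j, hsj, htj, hj⟩ := hj s t
    have hjm : Γ.Pre j m := hj m hm (hs.trans hx) (ht.trans hy)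
    -- Dividing by the atom `a` shortens `m`, so the induction hypothesis joins `a⁻¹ x` and `a⁻¹ j`;
    -- translating back by `a` gives the join of `x` and `j`, written `j k`.
    have key : ∀ a x, a ≠ 1 → Γ.Pre a x → Γ.Pre x m → Γ.Pre a j →
        ∃ k, Γ.Pre (j * k) m ∧ Γ.Pre x (j * k) ∧ Γ.Pre j (j * k) ∧
          ∀ z, Γ.Pre z Γ.top → Γ.Pre x z → Γ.Pre j z → Γ.Pre (j * k) z := by
      intro a x ha1 ha hx haj
      have hlt : Γ.length (a⁻¹ * m) ≤ N := by
        have h1 : Γ.length a ≠ 0 := fun h => ha1 ((Γ.length_eq_zero a).1 h)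
        have h2 : Γ.Pre a m := ha.trans hx
        unfold Pre at h2; omega
      obtain ⟨l, h1, h2, h3⟩ := ih (a⁻¹ * m) ((ha.trans hx).right hm) hlt (a⁻¹ * x) (a⁻¹ * j)
        (ha.quot hx) (haj.quot hjm)
      have h4 := h3 _ ((ha.trans hx).right hm) (ha.quot hx) (haj.quot hjm)
      have h5 := (ha.trans hx).mul h4
      have e : j * (j⁻¹ * (a * l)) = a * l := by group
      have lift : ∀ w, Γ.Pre a w → Γ.Pre (a⁻¹ * w) l → Γ.Pre w (a * l) := by
        intro w hw hwl
        have := (h5.1.mul (u := a⁻¹ * w) (by simpa using hwl)).2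
        simpa using this
      refine ⟨j⁻¹ * (a * l), ?_, ?_, ?_, ?_⟩
      · rw [e]; exact h5.2
      · rw [e]; exact lift x ha h1
      · rw [e]; exact lift j haj h2
      · intro z hz hxz hjz
        rw [e]
        exact ((ha.trans hxz).mul (h3 _ ((ha.trans hxz).right hz) (ha.quot hxz)
          (haj.quot hjz))).2
    obtain ⟨h, hh1, hh2, hh3, hh4⟩ := key _ x (hne s) hs hx hsj
    obtain ⟨k, hk1, hk2, hk3, hk4⟩ := key _ y (hne t) ht hy htj
    have hlt : Γ.length (j⁻¹ * m) ≤ N := by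
      have h1 : Γ.length (atom s) ≠ 0 := fun h => hne s ((Γ.length_eq_zero _).1 h)
      have h2 := hsj.length_le
      unfold Pre at hjm; omega
    have q : ∀ {k z}, Γ.Pre j (j * k) → Γ.Pre (j * k) z → Γ.Pre k (j⁻¹ * z) := by
      intro k z h1 h2
      simpa using h1.quot h2
    -- A second descent, below `j⁻¹ m`, joins the two complements of `j`.
    obtain ⟨l, hl1, hl2, hl3⟩ := ih (j⁻¹ * m) (hjm.right hm) hlt h k (q hh3 hh1) (q hk3 hk1)
    have hlm := hl3 _ (hjm.right hm) (q hh3 hh1) (q hk3 hk1)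
    have h5 := hjm.mul hlm
    have lift : ∀ w, Γ.Pre w l → Γ.Pre (j * w) (j * l) := by
      intro w hw
      exact (h5.1.mul (u := w) (by simpa using hw)).2
    refine ⟨j * l, hh2.trans (lift _ hl1), hk2.trans (lift _ hl2), ?_⟩
    intro z hz hxz hyz
    have hjz := hj z hz (hs.trans hxz) (ht.trans hyz)
    exact (hjz.mul (hl3 _ (hjz.right hz) (q hh3 (hh4 z hz hxz hjz))
      (q hk3 (hk4 z hz hyz hjz)))).2

/-- Bounded joins in a finite interval give meets. -/
theorem exists_isGlb [Finite G]
    (hl : ∀ x y m, Γ.Pre m Γ.top → Γ.Pre x m → Γ.Pre y m → ∃ l, Γ.IsLub x y l)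
    (hx : Γ.Pre x Γ.top) (hy : Γ.Pre y Γ.top) :
    ∃ d, Γ.Pre d x ∧ Γ.Pre d y ∧ ∀ z, Γ.Pre z x → Γ.Pre z y → Γ.Pre z d := by
  -- A common lower bound of maximal length absorbs every other one, since their join is again a
  -- common lower bound.
  obtain ⟨d, ⟨hd1, hd2⟩, hd⟩ := Set.exists_max_image {d | Γ.Pre d x ∧ Γ.Pre d y} Γ.length
    (Set.toFinite _) ⟨1, one_pre _, one_pre _⟩
  refine ⟨d, hd1, hd2, fun z hz1 hz2 => ?_⟩
  obtain ⟨l, h1, h2, h3⟩ := hl d z x hx hd1 hz1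
  have := hd l ⟨h3 _ hx hd1 hz1, h3 _ hy hd2 hz2⟩
  rwa [← h1.eq_of_length_le this] at h2

end LengthGroup

end

section

/-! ### The monoid of an interval -/

/-- `L` spells the beginning of a geodesic from `1` to `w`. -/
def LengthGroup.Spells {G ι : Type*} [Group G] (Γ : LengthGroup G) (atom : ι → G) :
    List ι → G → Prop
  | [], _ => True
  | s :: L, w => Γ.Pre (atom s) w ∧ LengthGroup.Spells Γ atom L ((atom s)⁻¹ * w)

/-- A presentation of the monoid attached to the interval `[1, top]` of a finite group. -/
structure Germ {ι : Type*} (rels : FreeMonoid ι → FreeMonoid ι → Prop) (G : Type*) [Group G]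
    extends LengthGroup G where
  atom : ι → G
  atom_ne_one : ∀ s, atom s ≠ 1
  atom_pre : ∀ s, toLengthGroup.Pre (atom s) top
  exists_atom : ∀ x, toLengthGroup.Pre x top → x ≠ 1 → ∃ s, toLengthGroup.Pre (atom s) x
  eq_top : ∀ w, toLengthGroup.Pre w top → (∀ s, toLengthGroup.Pre (atom s) w) → w = top
  rel_prod : ∀ a b, rels a b → FreeMonoid.lift atom a = FreeMonoid.lift atom b
  rel_spells : ∀ a b, rels a b → toLengthGroup.Spells atom a.toList top ∧
    toLengthGroup.Spells atom b.toList top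
  -- Requiring the two words to spell the beginning of every bounded `w` above both atoms makes
  -- their common value a join in the interval, and later a least common multiple in the monoid.
  join : ∀ s t, s ≠ t → ∃ u v : List ι,
    PresentedMonoid.of rels s * (u.map (PresentedMonoid.of rels)).prod =
      PresentedMonoid.of rels t * (v.map (PresentedMonoid.of rels)).prod ∧
    ∀ w, toLengthGroup.Pre w top → toLengthGroup.Pre (atom s) w → toLengthGroup.Pre (atom t) w →
      toLengthGroup.Spells atom (s :: u) w ∧ toLengthGroup.Spells atom (t :: v) w

namespace Germ

variable {ι : Type*} {rels : FreeMonoid ι → FreeMonoid ι → Prop} {G : Type*} [Group G]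
  (Γ : Germ rels G)

open LengthGroup

/-- The product in the group of the atoms of a word. -/
def eval (L : List ι) : G := (L.map Γ.atom).prod

/-- The product in the presented monoid of the letters of a word. -/
def word (_ : Germ rels G) (L : List ι) : PresentedMonoid rels :=
  (L.map (PresentedMonoid.of rels)).prod

/-- The morphism from the presented monoid to the group. -/
def toGroup : PresentedMonoid rels →* G := PresentedMonoid.lift Γ.atom Γ.rel_prod

/-- The relation `L` spells the beginning of `w`. -/
abbrev Sp (L : List ι) (w : G) : Prop := Γ.Spells Γ.atom L w

/-- Membership in the interval. -/
abbrev Mem (w : G) : Prop := Γ.Pre w Γ.top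

variable {Γ}

@[simp] theorem eval_nil : Γ.eval [] = 1 := rfl
@[simp] theorem eval_cons (s : ι) (L : List ι) : Γ.eval (s :: L) = Γ.atom s * Γ.eval L := by
  simp [eval]
theorem eval_append (L L' : List ι) : Γ.eval (L ++ L') = Γ.eval L * Γ.eval L' := by simp [eval]
@[simp] theorem word_nil : Γ.word [] = 1 := rfl
@[simp] theorem word_cons (s : ι) (L : List ι) :
    Γ.word (s :: L) = PresentedMonoid.of rels s * Γ.word L := by simp [word]
theorem word_append (L L' : List ι) : Γ.word (L ++ L') = Γ.word L * Γ.word L' := by simp [word]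

theorem word_surjective (x : PresentedMonoid rels) : ∃ L, Γ.word L = x := by
  induction x with | _ a
  induction a with
  | one => exact ⟨[], rfl⟩
  | of s => exact ⟨[s], by simp [PresentedMonoid.of]⟩
  | mul a b ha hb =>
    obtain ⟨L, hL⟩ := ha
    obtain ⟨L', hL'⟩ := hb
    exact ⟨L ++ L', by rw [word_append, hL, hL', map_mul]⟩

theorem toGroup_word (L : List ι) : Γ.toGroup (Γ.word L) = Γ.eval L := by
  induction L with
  | nil => simp
  | cons s L ih => rw [word_cons, map_mul, ih, eval_cons]; rfl

theorem Sp.pre {L : List ι} {w : G} (h : Γ.Sp L w) : Γ.Pre (Γ.eval L) w := by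
  induction L generalizing w with
  | nil => exact one_pre _
  | cons s L ih => rw [eval_cons]; exact (h.1.mul (ih h.2)).2

theorem Sp.mono {L : List ι} {w w' : G} (h : Γ.Sp L w) (h' : Γ.Pre w w') : Γ.Sp L w' := by
  induction L generalizing w w' with
  | nil => trivial
  | cons s L ih => exact ⟨h.1.trans h', ih h.2 (h.1.quot h')⟩

theorem Sp.eval {L : List ι} {w : G} (h : Γ.Sp L w) : Γ.Sp L (Γ.eval L) := by
  induction L generalizing w with
  | nil => trivial
  | cons s L ih =>
    rw [eval_cons]
    exact ⟨(h.1.mul (Sp.pre h.2)).1, by simpa using ih h.2⟩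

theorem sp_append {L L' : List ι} {w : G} :
    Γ.Sp (L ++ L') w ↔ Γ.Sp L w ∧ Γ.Sp L' ((Γ.eval L)⁻¹ * w) := by
  induction L generalizing w with
  | nil => simp [Sp, Spells]
  | cons s L ih =>
    have := ih (w := (Γ.atom s)⁻¹ * w)
    simp only [Sp, List.cons_append, Spells, eval_cons, mul_inv_rev] at this ⊢
    rw [this, and_assoc, mul_assoc]

theorem isLub_atom (s t : ι) : ∃ j, Γ.IsLub (Γ.atom s) (Γ.atom t) j := by
  by_cases h : s = t
  · subst h; exact ⟨_, pre_refl _, pre_refl _, fun z _ h _ => h⟩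
  obtain ⟨u, v, he, huv⟩ := Γ.join s t h
  have hG : Γ.eval (s :: u) = Γ.eval (t :: v) := by
    rw [← toGroup_word, ← toGroup_word, word_cons, word_cons]; exact congrArg _ he
  obtain ⟨h1, h2⟩ := huv Γ.top (pre_refl _) (Γ.atom_pre s) (Γ.atom_pre t)
  refine ⟨Γ.eval (s :: u), (Sp.eval h1).1, ?_, fun z hz hsz htz => Sp.pre (huv z hz hsz htz).1⟩
  rw [hG]; exact (Sp.eval h2).1

theorem isLub {x y m : G} (hm : Γ.Mem m) (hx : Γ.Pre x m) (hy : Γ.Pre y m) :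
    ∃ l, Γ.IsLub x y l :=
  exists_isLub Γ.atom_ne_one Γ.exists_atom isLub_atom _ m hm le_rfl x y hx hy

theorem exists_spelling : ∀ (N : ℕ) (w : G), Γ.length w ≤ N → Γ.Mem w →
    ∃ L, Γ.Sp L w ∧ Γ.eval L = w := by
  intro N
  induction N with
  | zero =>
    intro w hw _
    exact ⟨[], trivial, ((Γ.length_eq_zero w).1 (by omega)).symm⟩
  | succ N ih =>
    intro w hw hm
    by_cases h1 : w = 1
    · exact ⟨[], trivial, h1.symm⟩
    obtain ⟨s, hs⟩ := Γ.exists_atom w hm h1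
    have h2 : Γ.length (Γ.atom s) ≠ 0 := fun h => Γ.atom_ne_one s ((Γ.length_eq_zero _).1 h)
    obtain ⟨L, hL, hL'⟩ := ih ((Γ.atom s)⁻¹ * w) (by have := hs; unfold Pre at this; omega)
      (hs.right hm)
    exact ⟨s :: L, ⟨hs, hL⟩, by rw [eval_cons, hL']; simp⟩

/-- Two geodesic words with the same value are equal in the monoid. -/
theorem word_eq_of_eval_eq : ∀ (N : ℕ) (w : G), Γ.length w ≤ N → Γ.Mem w →
    ∀ L L', Γ.Sp L w → Γ.eval L = w → Γ.Sp L' w → Γ.eval L' = w → Γ.word L = Γ.word L' := by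
  intro N
  induction N with
  | zero =>
    intro w hw _ L L' hL _ hL' _
    have h0 : ∀ L, Γ.Sp L w → L = [] := by
      intro L hL
      cases L with
      | nil => rfl
      | cons s L =>
        have := hL.1.length_le
        exact absurd ((Γ.length_eq_zero _).1 (by omega)) (Γ.atom_ne_one s)
    rw [h0 L hL, h0 L' hL']
  | succ N ih =>
    intro w hw hm L L' hL eL hL' eL'
    have hsmall : ∀ s, Γ.Pre (Γ.atom s) w → Γ.length ((Γ.atom s)⁻¹ * w) ≤ N := by
      intro s hs
      have h2 : Γ.length (Γ.atom s) ≠ 0 := fun h => Γ.atom_ne_one s ((Γ.length_eq_zero _).1 h)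
      unfold Pre at hs; omega
    cases L with
    | nil =>
      cases L' with
      | nil => rfl
      | cons t L' =>
        rw [eval_nil] at eL; subst eL
        have := hL'.1.length_le
        rw [length_one] at this
        exact absurd ((Γ.length_eq_zero _).1 (by omega)) (Γ.atom_ne_one t)
    | cons s L =>
      cases L' with
      | nil =>
        rw [eval_nil] at eL'; subst eL'
        have := hL.1.length_le
        rw [length_one] at this
        exact absurd ((Γ.length_eq_zero _).1 (by omega)) (Γ.atom_ne_one s)
      | cons t L' =>
        have eL1 : Γ.eval L = (Γ.atom s)⁻¹ * w := by rw [← eL]; simp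
        have eL1' : Γ.eval L' = (Γ.atom t)⁻¹ * w := by rw [← eL']; simp
        rw [word_cons, word_cons]
        by_cases hst : s = t
        · subst hst
          rw [ih _ (hsmall s hL.1) (hL.1.right hm) L L' hL.2 eL1 hL'.2 eL1']
        obtain ⟨u, v, he, huv⟩ := Γ.join s t hst
        obtain ⟨h1, h2⟩ := huv w hm hL.1 hL'.1
        have hG : Γ.eval (s :: u) = Γ.eval (t :: v) := by
          rw [← toGroup_word, ← toGroup_word, word_cons, word_cons]; exact congrArg _ he
        -- As in Matsumoto's theorem, the two words are compared through the join of their first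
        -- letters: `s u R` and `t v R` are equal in the monoid, and induction applies after each
        -- first letter.
        obtain ⟨R, hR, eR⟩ := exists_spelling _ ((Γ.eval (s :: u))⁻¹ * w) le_rfl
          ((Sp.pre h1).right hm)
        have e1 := ih _ (hsmall s hL.1) (hL.1.right hm) L (u ++ R) hL.2 eL1
          (sp_append.2 ⟨h1.2, by simpa [mul_assoc] using hR⟩)
          (by rw [eval_append, eR, eval_cons]; group)
        have e2 := ih _ (hsmall t hL'.1) (hL'.1.right hm) L' (v ++ R) hL'.2 eL1'
          (sp_append.2 ⟨h2.2, by rw [hG] at hR; simpa [mul_assoc] using hR⟩)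
          (by rw [eval_append, eR, hG, eval_cons]; group)
        rw [e1, e2, word_append, word_append, ← mul_assoc, ← mul_assoc]
        exact congrArg (· * Γ.word R) he

/-! ### Simple elements of the monoid -/

variable (Γ) in
/-- The simple element of the monoid attached to an element of the interval. -/
def lift (w : G) : PresentedMonoid rels := Classical.epsilon fun x =>
  ∃ L, Γ.Sp L w ∧ Γ.eval L = w ∧ Γ.word L = x

theorem lift_eq_word {w : G} (hw : Γ.Mem w) {L : List ι} (hL : Γ.Sp L w) (e : Γ.eval L = w) :
    Γ.lift w = Γ.word L := by
  obtain ⟨L', h1, h2, h3⟩ := Classical.epsilon_spec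
    (p := fun x => ∃ L, Γ.Sp L w ∧ Γ.eval L = w ∧ Γ.word L = x) ⟨_, L, hL, e, rfl⟩
  exact h3.symm.trans (word_eq_of_eval_eq _ w le_rfl hw _ _ h1 h2 hL e)

theorem lift_one : Γ.lift 1 = 1 := lift_eq_word (one_pre _) (L := []) trivial rfl

theorem lift_atom (s : ι) : Γ.lift (Γ.atom s) = PresentedMonoid.of rels s :=
  (lift_eq_word (Γ.atom_pre s) (L := [s]) ⟨pre_refl _, trivial⟩ (by simp)).trans (by simp)

theorem lift_mul {x y : G} (hxy : Γ.Pre x (x * y)) (hm : Γ.Mem (x * y)) :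
    Γ.lift (x * y) = Γ.lift x * Γ.lift y := by
  obtain ⟨L, h1, h2⟩ := exists_spelling _ x le_rfl (hxy.trans hm)
  have hy : Γ.Mem y := by simpa using hxy.right hm
  obtain ⟨L', h1', h2'⟩ := exists_spelling _ y le_rfl hy
  rw [lift_eq_word (hxy.trans hm) h1 h2, lift_eq_word hy h1' h2', ← word_append]
  refine lift_eq_word hm (sp_append.2 ⟨h1.mono hxy, ?_⟩) (by rw [eval_append, h2, h2'])
  rw [h2]; simpa using h1'

theorem lift_mul_quot {x y : G} (hxy : Γ.Pre x y) (hm : Γ.Mem y) :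
    Γ.lift x * Γ.lift (x⁻¹ * y) = Γ.lift y := by
  have := lift_mul (x := x) (y := x⁻¹ * y) (by simpa using hxy) (by simpa using hm)
  simpa using this.symm

theorem word_dvd_lift {w : G} (hw : Γ.Mem w) {L : List ι} (hL : Γ.Sp L w) :
    Γ.word L ∣ Γ.lift w := by
  rw [← lift_mul_quot hL.pre hw, lift_eq_word (hL.pre.trans hw) hL.eval rfl]
  exact dvd_mul_right _ _

theorem of_dvd_lift_top (s : ι) : PresentedMonoid.of rels s ∣ Γ.lift Γ.top :=
  ⟨_, by rw [← lift_atom (Γ := Γ)]; exact (lift_mul_quot (Γ.atom_pre s) (pre_refl _)).symm⟩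

/-- Taking complements twice: with `r = s⁻¹ top`, both `top = s r` and `top = r (top⁻¹ s top)` are
geodesic factorizations, so `s` passes through the Garside element. -/
theorem of_mul_lift_top (s : ι) :
    ∃ y, PresentedMonoid.of rels s * Γ.lift Γ.top = Γ.lift Γ.top * y := by
  have h := Γ.atom_pre s
  refine ⟨Γ.lift (Γ.top⁻¹ * Γ.atom s * Γ.top), ?_⟩
  have h1 := lift_mul_quot h (pre_refl _)
  have h2 := lift_mul_quot h.compl (pre_refl _)
  rw [show ((Γ.atom s)⁻¹ * Γ.top)⁻¹ * Γ.top = Γ.top⁻¹ * Γ.atom s * Γ.top by group] at h2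
  calc PresentedMonoid.of rels s * Γ.lift Γ.top
      = Γ.lift (Γ.atom s) * Γ.lift Γ.top := by rw [lift_atom]
    _ = Γ.lift (Γ.atom s) * (Γ.lift ((Γ.atom s)⁻¹ * Γ.top) *
          Γ.lift (Γ.top⁻¹ * Γ.atom s * Γ.top)) := by rw [h2]
    _ = _ := by rw [← mul_assoc, h1]

variable (Γ) in
/-- The meet of two elements of the interval. -/
def meet (x y : G) : G := Classical.epsilon fun d =>
  Γ.Pre d x ∧ Γ.Pre d y ∧ ∀ z, Γ.Pre z x → Γ.Pre z y → Γ.Pre z d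

variable [Finite G]

theorem meet_spec {x y : G} (hx : Γ.Mem x) (hy : Γ.Mem y) :
    Γ.Pre (Γ.meet x y) x ∧ Γ.Pre (Γ.meet x y) y ∧
      ∀ z, Γ.Pre z x → Γ.Pre z y → Γ.Pre z (Γ.meet x y) :=
  Classical.epsilon_spec (exists_isGlb (fun _ _ _ hm hx hy => isLub hm hx hy) hx hy)

theorem meet_unique {x y d : G} (hx : Γ.Mem x) (hy : Γ.Mem y) (h1 : Γ.Pre d x) (h2 : Γ.Pre d y)
    (h3 : ∀ z, Γ.Pre z x → Γ.Pre z y → Γ.Pre z d) : Γ.meet x y = d :=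
  have h := meet_spec hx hy
  (h3 _ h.1 h.2.1).antisymm (h.2.2 _ h1 h2)

theorem meet_top {u : G} (hu : Γ.Mem u) : Γ.meet Γ.top u = u :=
  meet_unique (pre_refl _) hu hu (pre_refl _) fun _ _ h => h

theorem meet_one {u : G} (hu : Γ.Mem u) : Γ.meet u 1 = 1 :=
  meet_unique hu (one_pre _) (one_pre _) (pre_refl _) fun _ _ h => h

theorem mul_meet_mem {v u : G} (hv : Γ.Mem v) (hu : Γ.Mem u) :
    Γ.Pre v (v * Γ.meet (v⁻¹ * Γ.top) u) ∧ Γ.Mem (v * Γ.meet (v⁻¹ * Γ.top) u) :=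
  Pre.mul hv (meet_spec hv.compl hu).1

/-- Compatibility of the meets with left translations. -/
theorem meet_mul_meet {v t u : G} (h : Γ.Pre v (v * t)) (hm : Γ.Mem (v * t)) (hu : Γ.Mem u) :
    Γ.meet (v⁻¹ * Γ.top) (t * Γ.meet (t⁻¹ * Γ.top) u) =
      t * Γ.meet ((v * t)⁻¹ * Γ.top) u := by
  have ht : Γ.Mem t := by simpa using h.right hm
  have hv : Γ.Mem v := h.trans hm
  have htv : Γ.Pre t (v⁻¹ * Γ.top) := by simpa using h.quot hm
  have e : t⁻¹ * (v⁻¹ * Γ.top) = (v * t)⁻¹ * Γ.top := by group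
  obtain ⟨a1, a2, a3⟩ := meet_spec ht.compl hu
  obtain ⟨b1, b2, b3⟩ := meet_spec (x := (v * t)⁻¹ * Γ.top) hm.compl hu
  have hpre : Γ.Pre ((v * t)⁻¹ * Γ.top) (t⁻¹ * Γ.top) := by
    rw [← e]; exact htv.quot hv.compl
  have hb := htv.mul (u := Γ.meet ((v * t)⁻¹ * Γ.top) u) (by rw [e]; exact b1)
  have hA := ht.mul a1
  have hbA : Γ.Pre (t * Γ.meet ((v * t)⁻¹ * Γ.top) u) (t * Γ.meet (t⁻¹ * Γ.top) u) :=
    (hA.1.mul (u := Γ.meet ((v * t)⁻¹ * Γ.top) u)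
      (by simpa using a3 _ (b1.trans hpre) b2)).2
  obtain ⟨d1, d2, d3⟩ := meet_spec hv.compl hA.2
  -- In the direction left open, `t` is below the left-hand meet, and dividing by it leaves a lower
  -- bound of `(v t)⁻¹ top` and `u`.
  refine Pre.antisymm ?_ (d3 _ hb.2 hbA)
  have htd := d3 _ htv hA.1
  have hq : Γ.Pre (t⁻¹ * Γ.meet (v⁻¹ * Γ.top) (t * Γ.meet (t⁻¹ * Γ.top) u))
      (Γ.meet ((v * t)⁻¹ * Γ.top) u) := by
    refine b3 _ ?_ ?_
    · rw [← e]; exact htd.quot d1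
    · have := htd.quot d2
      rw [inv_mul_cancel_left] at this
      exact this.trans a2
  have := (hb.1.mul (u := t⁻¹ * Γ.meet (v⁻¹ * Γ.top) (t * Γ.meet (t⁻¹ * Γ.top) u))
    (by simpa using hq)).2
  simpa using this

/-! ### The action on heads and tails -/

variable (Γ) in
/-- The left multiplication by a simple element on pairs (head, tail). -/
def act (v : {v // Γ.Mem v}) (a : {u // Γ.Mem u} × PresentedMonoid rels) :
    {u // Γ.Mem u} × PresentedMonoid rels :=
  (⟨v.1 * Γ.meet (v.1⁻¹ * Γ.top) a.1.1, (mul_meet_mem v.2 a.1.2).2⟩,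
    Γ.lift ((Γ.meet (v.1⁻¹ * Γ.top) a.1.1)⁻¹ * a.1.1) * a.2)

theorem act_one : Γ.act ⟨1, one_pre _⟩ = id := by
  funext ⟨⟨u, hu⟩, m⟩
  simp [act, meet_top hu, lift_one]

/-- The new head is `v` times the largest beginning of `u` that keeps the product simple, the rest
of `u` going to the tail. By `meet_mul_meet`, transferring for `t` and then for `v` keeps the same
beginning of `u` as transferring for `v t`. -/
theorem act_act {v t : G} (h : Γ.Pre v (v * t)) (hm : Γ.Mem (v * t)) (ht : Γ.Mem t) :
    Γ.act ⟨v, h.trans hm⟩ ∘ Γ.act ⟨t, ht⟩ = Γ.act ⟨v * t, hm⟩ := by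
  funext ⟨⟨u, hu⟩, m⟩
  have hv : Γ.Mem v := h.trans hm
  have key := meet_mul_meet h hm hu
  obtain ⟨a1, a2, a3⟩ := meet_spec ht.compl hu
  obtain ⟨b1, b2, b3⟩ := meet_spec (x := (v * t)⁻¹ * Γ.top) hm.compl hu
  have hpre : Γ.Pre ((v * t)⁻¹ * Γ.top) (t⁻¹ * Γ.top) := by
    have htv : Γ.Pre t (v⁻¹ * Γ.top) := by simpa using h.quot hm
    rw [show (v * t)⁻¹ * Γ.top = t⁻¹ * (v⁻¹ * Γ.top) by group]; exact htv.quot hv.compl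
  have hba := a3 _ (b1.trans hpre) b2
  simp only [act, Function.comp_apply, key, Prod.mk.injEq, Subtype.mk.injEq]
  refine ⟨by group, ?_⟩
  rw [← mul_assoc]
  congr 1
  have e1 : (t * Γ.meet ((v * t)⁻¹ * Γ.top) u)⁻¹ * (t * Γ.meet (t⁻¹ * Γ.top) u) =
    (Γ.meet ((v * t)⁻¹ * Γ.top) u)⁻¹ * Γ.meet (t⁻¹ * Γ.top) u := by group
  rw [e1]
  have := lift_mul_quot (hba.quot a2) (b2.right hu)
  rw [← this]
  congr 2
  group

variable (Γ) in
/-- The action of a letter. -/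
def actAtom (s : ι) : Function.End ({u // Γ.Mem u} × PresentedMonoid rels) :=
  Γ.act ⟨Γ.atom s, Γ.atom_pre s⟩

theorem actAtom_list {L : List ι} {w : G} (hw : Γ.Mem w) (hL : Γ.Sp L w) :
    (L.map Γ.actAtom).prod = Γ.act ⟨Γ.eval L, hL.pre.trans hw⟩ := by
  induction L generalizing w with
  | nil => exact act_one.symm
  | cons s L ih =>
    rw [List.map_cons, List.prod_cons, ih (hL.1.right hw) hL.2]
    have h1 : Γ.Pre (Γ.atom s) (Γ.atom s * Γ.eval L) := by simpa using hL.eval.1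
    have h2 : Γ.Mem (Γ.atom s * Γ.eval L) := by simpa using hL.pre.trans hw
    exact act_act h1 h2 _

variable (Γ) in
/-- The action of the monoid on pairs (head, tail). -/
def action : PresentedMonoid rels →* Function.End ({u // Γ.Mem u} × PresentedMonoid rels) :=
  PresentedMonoid.lift Γ.actAtom (by
    intro a b h
    obtain ⟨h1, h2⟩ := Γ.rel_spells a b h
    have e := Γ.rel_prod a b h
    rw [FreeMonoid.lift_apply, FreeMonoid.lift_apply] at e ⊢
    rw [actAtom_list (pre_refl _) h1, actAtom_list (pre_refl _) h2]
    congr 2)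

theorem action_of (s : ι) : Γ.action (PresentedMonoid.of rels s) = Γ.actAtom s := rfl

/-- Each letter only moves the boundary between head and tail. Starting from the pair of units, this
factors `x` as its head times its tail. -/
theorem lift_mul_action (x : PresentedMonoid rels) (a : {u // Γ.Mem u} × PresentedMonoid rels) :
    Γ.lift (Γ.action x a).1.1 * (Γ.action x a).2 = x * (Γ.lift a.1.1 * a.2) := by
  obtain ⟨L, rfl⟩ := Γ.word_surjective x
  induction L with
  | nil =>
    rw [word_nil, map_one, one_mul]
    rfl
  | cons s L ih =>
    rw [word_cons, map_mul, mul_assoc, ← ih, action_of]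
    change Γ.lift (Γ.actAtom s (Γ.action (Γ.word L) a)).1.1 *
      (Γ.actAtom s (Γ.action (Γ.word L) a)).2 = _
    generalize Γ.action (Γ.word L) a = b
    obtain ⟨⟨u, hu⟩, m⟩ := b
    obtain ⟨h1, h2, -⟩ := meet_spec (Γ.atom_pre s).compl hu
    have h3 := Pre.mul (Γ.atom_pre s) h1
    simp only [actAtom, act]
    rw [lift_mul h3.1 h3.2, lift_atom, mul_assoc, ← mul_assoc (Γ.lift (Γ.meet _ u)),
      lift_mul_quot h2 hu]

/-! ### Heads, cancellation and divisibility -/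

variable (Γ) in
/-- The head of an element: its greatest simple divisor, as an element of the interval. -/
def head (x : PresentedMonoid rels) : G := (Γ.action x (⟨1, one_pre _⟩, 1)).1.1

variable (Γ) in
/-- The tail of an element. -/
def tail (x : PresentedMonoid rels) : PresentedMonoid rels :=
  (Γ.action x (⟨1, one_pre _⟩, 1)).2

theorem head_mem (x : PresentedMonoid rels) : Γ.Mem (Γ.head x) :=
  (Γ.action x (⟨1, one_pre _⟩, 1)).1.2

theorem lift_head_mul_tail (x : PresentedMonoid rels) : Γ.lift (Γ.head x) * Γ.tail x = x := by
  have := lift_mul_action (Γ := Γ) x (⟨1, one_pre _⟩, 1)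
  rw [lift_one, one_mul, mul_one] at this
  exact this

theorem head_of_mul (s : ι) (x : PresentedMonoid rels) :
    Γ.head (PresentedMonoid.of rels s * x) =
      Γ.atom s * Γ.meet ((Γ.atom s)⁻¹ * Γ.top) (Γ.head x) := by
  simp only [head, map_mul, action_of]
  rfl

theorem tail_of_mul (s : ι) (x : PresentedMonoid rels) :
    Γ.tail (PresentedMonoid.of rels s * x) =
      Γ.lift ((Γ.meet ((Γ.atom s)⁻¹ * Γ.top) (Γ.head x))⁻¹ * Γ.head x) * Γ.tail x := by
  simp only [tail, map_mul, action_of]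
  rfl

/-- Left multiplication by `s` can be undone on heads and tails: cancelling the atom in the group
recovers the part of the old head that was absorbed, and that part times the new tail is the
original element. -/
theorem of_mul_cancel (Γ : Germ rels G) {s : ι} {x y : PresentedMonoid rels}
    (h : PresentedMonoid.of rels s * x = PresentedMonoid.of rels s * y) : x = y := by
  have h1 := head_of_mul (Γ := Γ) s x
  have h2 := tail_of_mul (Γ := Γ) s x
  rw [h, head_of_mul] at h1
  rw [h, tail_of_mul] at h2
  have h3 := mul_left_cancel h1
  have key : ∀ z, Γ.lift (Γ.meet ((Γ.atom s)⁻¹ * Γ.top) (Γ.head z)) *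
      (Γ.lift ((Γ.meet ((Γ.atom s)⁻¹ * Γ.top) (Γ.head z))⁻¹ * Γ.head z) * Γ.tail z) = z := by
    intro z
    obtain ⟨-, h2, -⟩ := meet_spec (Γ.atom_pre s).compl (head_mem (Γ := Γ) z)
    rw [← mul_assoc, lift_mul_quot h2 (head_mem z), lift_head_mul_tail]
  rw [← key x, ← key y, ← h2, h3]

theorem mul_cancel {x y z : PresentedMonoid rels} (Γ : Germ rels G) (h : z * x = z * y) :
    x = y := by
  obtain ⟨L, rfl⟩ := Γ.word_surjective z
  induction L with
  | nil => simpa using h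
  | cons s L ih =>
    rw [word_cons, mul_assoc, mul_assoc] at h
    exact ih (Γ.of_mul_cancel h)

theorem pre_head {s : ι} {x : PresentedMonoid rels} (h : PresentedMonoid.of rels s ∣ x) :
    Γ.Pre (Γ.atom s) (Γ.head x) := by
  obtain ⟨y, rfl⟩ := h
  rw [head_of_mul]
  exact (mul_meet_mem (Γ.atom_pre s) (head_mem y)).1

theorem lift_head_dvd (x : PresentedMonoid rels) : Γ.lift (Γ.head x) ∣ x :=
  ⟨_, (lift_head_mul_tail x).symm⟩

theorem word_dvd {x : PresentedMonoid rels} {L : List ι} (h : Γ.Sp L (Γ.head x)) :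
    Γ.word L ∣ x :=
  (word_dvd_lift (head_mem x) h).trans (lift_head_dvd x)

/-- Lifting local joins to the monoid. -/
theorem word_dvd_of_dvd {s t : ι} {L : List ι}
    (hL : ∀ w, Γ.Mem w → Γ.Pre (Γ.atom s) w → Γ.Pre (Γ.atom t) w → Γ.Sp L w)
    {x : PresentedMonoid rels} (hs : PresentedMonoid.of rels s ∣ x)
    (ht : PresentedMonoid.of rels t ∣ x) : Γ.word L ∣ x :=
  word_dvd (hL _ (head_mem x) (pre_head hs) (pre_head ht))

theorem exists_join (Γ : Germ rels G) (s t : ι) : ∃ j : PresentedMonoid rels,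
    PresentedMonoid.of rels s ∣ j ∧ PresentedMonoid.of rels t ∣ j ∧
    ∀ x, PresentedMonoid.of rels s ∣ x → PresentedMonoid.of rels t ∣ x → j ∣ x := by
  by_cases h : s = t
  · subst h; exact ⟨_, dvd_rfl, dvd_rfl, fun _ h _ => h⟩
  obtain ⟨u, v, he, huv⟩ := Γ.join s t h
  refine ⟨Γ.word (s :: u), ⟨_, word_cons _ _⟩, ⟨_, (word_cons _ _).trans he⟩, ?_⟩
  exact fun x hs ht => Γ.word_dvd_of_dvd (fun w h1 h2 h3 => (huv w h1 h2 h3).1) hs ht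

theorem lift_top_dvd {x : PresentedMonoid rels} (h : ∀ s, PresentedMonoid.of rels s ∣ x) :
    Γ.lift Γ.top ∣ x := by
  have := Γ.eq_top _ (head_mem x) fun s => pre_head (h s)
  rw [← this]; exact lift_head_dvd x

/-- After cancelling `s`, the letter `t` divides the lift of `s⁻¹ top`, and the head of a lift is
the lifted element itself. This brings questions about simple products of two letters back to the
group. -/
theorem pre_of_mul_dvd {s t : ι}
    (h : PresentedMonoid.of rels s * PresentedMonoid.of rels t ∣ Γ.lift Γ.top) :
    Γ.Pre (Γ.atom t) ((Γ.atom s)⁻¹ * Γ.top) := by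
  obtain ⟨y, hy⟩ := h
  have h1 := lift_mul_quot (Γ.atom_pre s) (pre_refl _)
  rw [hy, lift_atom, mul_assoc] at h1
  have h2 := Γ.mul_cancel h1
  obtain ⟨L, hL, eL⟩ := exists_spelling _ _ le_rfl (Γ.atom_pre s).compl
  have h3 := pre_head (Γ := Γ) (Dvd.intro _ h2.symm)
  have h4 : ∀ w, Γ.Mem w → Γ.head (Γ.lift w) = w := by
    intro w hw
    obtain ⟨L, hL, eL⟩ := exists_spelling _ _ le_rfl hw
    have e := actAtom_list hw hL
    have e' : Γ.action (Γ.lift w) = Γ.act ⟨w, hw⟩ := by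
      rw [lift_eq_word hw hL eL]
      have : Γ.action (Γ.word L) = (L.map Γ.actAtom).prod := by
        rw [word, map_list_prod, List.map_map]; rfl
      rw [this, e]; congr 2
    simp only [head, e', act, meet_one hw.compl, mul_one]
  rwa [h4 _ (Γ.atom_pre s).compl] at h3

end Germ

end

section

/-! ### The symmetric group with the inversion length -/

section Inversions

open Equiv
open scoped symmDiff

variable {n : ℕ}

/-- The inversions of `w⁻¹`, as ordered pairs in both orders. -/
def inversions (w : Perm (Fin n)) : Finset (Fin n × Fin n) :=
  Finset.univ.filter fun p => p.1 ≠ p.2 ∧ (p.1 < p.2 ↔ w⁻¹ p.2 < w⁻¹ p.1)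

theorem mem_inversions {w : Perm (Fin n)} {p : Fin n × Fin n} :
    p ∈ inversions w ↔ p.1 ≠ p.2 ∧ (p.1 < p.2 ↔ w⁻¹ p.2 < w⁻¹ p.1) := by
  simp [inversions]

/-- The inversions of `y` moved by `x`. -/
def movedInversions (x y : Perm (Fin n)) : Finset (Fin n × Fin n) :=
  (inversions y).map (Equiv.prodCongr x x).toEmbedding

theorem mem_movedInversions {x y : Perm (Fin n)} {p : Fin n × Fin n} :
    p ∈ movedInversions x y ↔
      p.1 ≠ p.2 ∧ (x⁻¹ p.1 < x⁻¹ p.2 ↔ (x * y)⁻¹ p.2 < (x * y)⁻¹ p.1) := by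
  rw [movedInversions, Finset.mem_map_equiv, mem_inversions]
  simp [Perm.inv_def, Perm.mul_def]

/-- Recording each inversion in both orders lets a permutation transport the set without reordering
pairs; the resulting length is twice the usual one. -/
theorem inversions_mul (x y : Perm (Fin n)) :
    inversions (x * y) = inversions x ∆ movedInversions x y := by
  ext p
  rw [Finset.mem_symmDiff, mem_movedInversions, mem_inversions, mem_inversions]
  by_cases h : p.1 = p.2
  · simp [h]
  have h1 : x⁻¹ p.1 ≠ x⁻¹ p.2 := fun e => h (x⁻¹.injective e)
  have h2 : (x * y)⁻¹ p.1 ≠ (x * y)⁻¹ p.2 := fun e => h ((x * y)⁻¹.injective e)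
  simp only [Fin.lt_def, ne_eq, Fin.ext_iff] at *
  omega

theorem card_movedInversions (x y : Perm (Fin n)) :
    (movedInversions x y).card = (inversions y).card := Finset.card_map _

/-- Since `|A ∆ B| = |A| + |B| - 2 |A ∩ B|`, additivity of lengths means that `A` and `B` are
disjoint, that is `A ⊆ A ∆ B`. -/
theorem inversions_subset_iff (x y : Perm (Fin n)) :
    (inversions x).card + (inversions (x⁻¹ * y)).card = (inversions y).card ↔
      inversions x ⊆ inversions y := by
  have e := inversions_mul x (x⁻¹ * y)
  rw [mul_inv_cancel_left] at e
  rw [← card_movedInversions x (x⁻¹ * y), e]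
  set A := inversions x
  set B := movedInversions x (x⁻¹ * y)
  have h1 : (A ∆ B).card = (A \ B).card + (B \ A).card := by
    rw [symmDiff_def, Finset.sup_eq_union, Finset.card_union_of_disjoint disjoint_sdiff_sdiff]
  have h2 := Finset.card_inter_add_card_sdiff A B
  have h3 := Finset.card_inter_add_card_sdiff B A
  rw [Finset.inter_comm] at h3
  have h4 : (A ∩ B).card = 0 ↔ A ⊆ A ∆ B := by
    rw [Finset.card_eq_zero, ← Finset.disjoint_iff_inter_eq_empty, Finset.disjoint_left]
    constructor
    · intro h a ha
      exact Finset.mem_symmDiff.2 (Or.inl ⟨ha, h ha⟩)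
    · intro h a ha hb
      rcases Finset.mem_symmDiff.1 (h ha) with h | h
      · exact h.2 hb
      · exact h.2 ha
  rw [← h4]; omega

theorem eq_one_of_strictMono {w : Perm (Fin n)} (h : StrictMono w) : w = 1 := by
  have := Subsingleton.elim (h.orderIsoOfSurjective w w.surjective) (OrderIso.refl _)
  ext i
  exact congrArg (fun f : Fin n ≃o Fin n => (f i : ℕ)) this

/-- The symmetric group with the number of inversions and its longest element. -/
def inversionGroup (n : ℕ) : LengthGroup (Perm (Fin n)) where
  length w := (inversions w).card
  top := Fin.revPerm
  length_mul_le x y := by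
    rw [inversions_mul, ← card_movedInversions x y]
    exact (Finset.card_le_card (fun a ha => by
      rcases Finset.mem_symmDiff.1 ha with h | h
      · exact Finset.mem_union_left _ h.1
      · exact Finset.mem_union_right _ h.1)).trans (Finset.card_union_le _ _)
  length_eq_zero w := by
    rw [Finset.card_eq_zero]
    constructor
    · intro h
      rw [← inv_eq_one]
      apply eq_one_of_strictMono
      intro i j hij
      by_contra hc
      have hne : w⁻¹ i ≠ w⁻¹ j := fun e => hij.ne (w⁻¹.injective e)
      have : (i, j) ∈ inversions w :=
        mem_inversions.2 ⟨hij.ne, iff_of_true hij (lt_of_le_of_ne (not_lt.1 hc) hne.symm)⟩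
      simp [h] at this
    · rintro rfl
      ext p
      simp only [mem_inversions, inv_one, Perm.one_apply, Finset.notMem_empty, iff_false]
      rintro ⟨h1, h2⟩
      rcases lt_or_gt_of_ne h1 with h | h
      · exact (h2.1 h).not_gt h
      · exact (h2.2 h).not_gt h
  length_conj x := by
    refine Finset.card_bij (fun p _ => (p.1.rev, p.2.rev)) ?_ ?_ ?_
    · intro p hp
      rw [mem_inversions] at hp ⊢
      obtain ⟨h1, h2⟩ := hp
      refine ⟨fun e => h1 (Fin.rev_injective e), ?_⟩
      simp only [mul_inv_rev, inv_inv, Perm.mul_apply, Fin.revPerm_apply] at h2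
      have e : ∀ i, (Fin.revPerm : Perm (Fin n))⁻¹ i = i.rev := fun i => rfl
      rw [e, e, Fin.rev_lt_rev] at h2
      rw [Fin.rev_lt_rev]
      have h3 : x⁻¹ p.1.rev ≠ x⁻¹ p.2.rev := fun e => h1 (Fin.rev_injective (x⁻¹.injective e))
      simp only [Fin.lt_def, ne_eq, Fin.ext_iff] at h1 h2 h3 ⊢
      omega
    · rintro p - q - h
      simpa [Prod.ext_iff] using h
    · intro p hp
      refine ⟨(p.1.rev, p.2.rev), ?_, by simp⟩
      rw [mem_inversions] at hp ⊢
      obtain ⟨h1, h2⟩ := hp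
      refine ⟨fun e => h1 (Fin.rev_injective e), ?_⟩
      have e : ∀ i, (Fin.revPerm : Perm (Fin n))⁻¹ i = i.rev := fun i => rfl
      simp only [mul_inv_rev, inv_inv, Perm.mul_apply, Fin.revPerm_apply, e, Fin.rev_rev,
        Fin.rev_lt_rev]
      have h3 : x⁻¹ p.1 ≠ x⁻¹ p.2 := fun e => h1 (x⁻¹.injective e)
      simp only [Fin.lt_def, ne_eq, Fin.ext_iff] at h1 h2 h3 ⊢
      omega

theorem inversionGroup_pre_iff {x y : Perm (Fin n)} :
    (inversionGroup n).Pre x y ↔ inversions x ⊆ inversions y := inversions_subset_iff x y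

theorem inversionGroup_pre_top (x : Perm (Fin n)) :
    (inversionGroup n).Pre x (inversionGroup n).top := by
  rw [inversionGroup_pre_iff]
  intro p hp
  rw [mem_inversions] at hp ⊢
  refine ⟨hp.1, ?_⟩
  change _ ↔ p.2.rev < p.1.rev
  rw [Fin.rev_lt_rev]

/-! ### Adjacent transpositions and the germ of positive braids -/

/-- The lower index of the `i`-th adjacent transposition. -/
def lo (i : Fin (n - 1)) : Fin n := ⟨i, by omega⟩

/-- The upper index of the `i`-th adjacent transposition. -/
def hi (i : Fin (n - 1)) : Fin n := ⟨i + 1, by omega⟩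

/-- The adjacent transpositions. -/
def adjSwap (i : Fin (n - 1)) : Perm (Fin n) := swap (lo i) (hi i)

theorem adjSwap_inv (i : Fin (n - 1)) : (adjSwap i)⁻¹ = adjSwap i := swap_inv _ _

theorem lo_lt_hi (i : Fin (n - 1)) : lo i < hi i := by simp [lo, hi, Fin.lt_def]

theorem adjSwap_apply_val (i : Fin (n - 1)) (k : Fin n) : (adjSwap i k : ℕ) =
    if (k : ℕ) = i then (i : ℕ) + 1 else if (k : ℕ) = i + 1 then (i : ℕ) else k := by
  simp only [adjSwap, swap_apply_def, lo, hi, Fin.ext_iff]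
  split_ifs <;> simp

/-- An adjacent transposition has a single inversion up to order, so containment of inversion sets
is a test on one pair. -/
theorem adjSwap_pre_iff {i : Fin (n - 1)} {w : Perm (Fin n)} :
    (inversionGroup n).Pre (adjSwap i) w ↔ w⁻¹ (hi i) < w⁻¹ (lo i) := by
  rw [inversionGroup_pre_iff]
  constructor
  · intro h
    have : (lo i, hi i) ∈ inversions (adjSwap i) := by
      rw [mem_inversions, adjSwap_inv]
      simp [adjSwap, (lo_lt_hi i).ne, lo_lt_hi i]
    have := (mem_inversions.1 (h this)).2
    exact this.1 (lo_lt_hi i)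
  · intro h p hp
    rw [mem_inversions, adjSwap_inv, Fin.lt_def, Fin.lt_def, adjSwap_apply_val,
      adjSwap_apply_val] at hp
    rw [mem_inversions]
    obtain ⟨h1, h2⟩ := hp
    have h1' : (p.1 : ℕ) ≠ p.2 := fun e => h1 (Fin.ext e)
    have : (p.1 = lo i ∧ p.2 = hi i) ∨ (p.1 = hi i ∧ p.2 = lo i) := by
      simp only [Fin.ext_iff, lo, hi]
      split_ifs at h2 <;> omega
    refine ⟨h1, ?_⟩
    rcases this with ⟨e1, e2⟩ | ⟨e1, e2⟩ <;> rw [e1, e2]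
    · exact iff_of_true (lo_lt_hi i) h
    · exact iff_of_false (lo_lt_hi i).not_gt h.not_gt

theorem strictMono_of_lo_hi {f : Fin n → Fin n} (h : ∀ i : Fin (n - 1), f (lo i) < f (hi i)) :
    StrictMono f := by
  cases n with
  | zero => intro i; exact i.elim0
  | succ m =>
    rw [Fin.strictMono_iff_lt_succ]
    intro i
    exact h i

theorem spells_comm {i j : Fin (n - 1)} (hij : (i : ℕ) + 2 ≤ j ∨ (j : ℕ) + 2 ≤ i)
    {w : Perm (Fin n)} (h1 : (inversionGroup n).Pre (adjSwap i) w)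
    (h2 : (inversionGroup n).Pre (adjSwap j) w) :
    (inversionGroup n).Spells adjSwap [i, j] w := by
  refine ⟨h1, ?_, trivial⟩
  rw [adjSwap_pre_iff] at h2 ⊢
  have e1 : adjSwap i (hi j) = hi j := by
    ext; rw [adjSwap_apply_val]; simp only [hi]; grind
  have e2 : adjSwap i (lo j) = lo j := by
    ext; rw [adjSwap_apply_val]; simp only [lo]; grind
  simpa [e1, e2] using h2

/-- If both adjacent pairs among three consecutive indices are inverted, so is the outer pair; the
three letters remove these three inversions one at a time. -/
theorem spells_braid {i j : Fin (n - 1)} (hij : (i : ℕ) + 1 = j ∨ (j : ℕ) + 1 = i)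
    {w : Perm (Fin n)} (h1 : (inversionGroup n).Pre (adjSwap i) w)
    (h2 : (inversionGroup n).Pre (adjSwap j) w) :
    (inversionGroup n).Spells adjSwap [i, j, i] w := by
  refine ⟨h1, ?_, ?_, trivial⟩
  · rw [adjSwap_pre_iff] at h1 h2 ⊢
    simp only [mul_inv_rev, inv_inv, Perm.mul_apply]
    rcases hij with hij | hij
    · rw [show adjSwap i (hi j) = hi j by
        ext; rw [adjSwap_apply_val]; simp only [hi]; grind,
        show adjSwap i (lo j) = lo i by
        ext; rw [adjSwap_apply_val]; simp only [lo]; grind]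
      rw [show lo j = hi i by ext; simp only [lo, hi]; omega] at h2
      exact h2.trans h1
    · rw [show adjSwap i (hi j) = hi i by
        ext; rw [adjSwap_apply_val]; simp only [hi]; grind,
        show adjSwap i (lo j) = lo j by
        ext; rw [adjSwap_apply_val]; simp only [lo]; grind]
      rw [show hi j = lo i by ext; simp only [lo, hi]; omega] at h2
      exact h1.trans h2
  · rw [adjSwap_pre_iff] at h2 ⊢
    simp only [mul_inv_rev, inv_inv, Perm.mul_apply]
    rcases hij with hij | hij
    · rw [show adjSwap i (adjSwap j (hi i)) = hi j by
        ext; rw [adjSwap_apply_val, adjSwap_apply_val]; simp only [hi]; grind,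
        show adjSwap i (adjSwap j (lo i)) = lo j by
        ext; rw [adjSwap_apply_val, adjSwap_apply_val]; simp only [lo]; grind]
      exact h2
    · rw [show adjSwap i (adjSwap j (hi i)) = hi j by
        ext; rw [adjSwap_apply_val, adjSwap_apply_val]; simp only [hi]; grind,
        show adjSwap i (adjSwap j (lo i)) = lo j by
        ext; rw [adjSwap_apply_val, adjSwap_apply_val]; simp only [lo]; grind]
      exact h2

theorem adjSwap_comm {i j : Fin (n - 1)} (h : (i : ℕ) + 2 ≤ j) :
    adjSwap i * adjSwap j = adjSwap j * adjSwap i := by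
  ext k
  have h1 := adjSwap_apply_val i k
  have h2 := adjSwap_apply_val j k
  have h3 := adjSwap_apply_val i (adjSwap j k)
  have h4 := adjSwap_apply_val j (adjSwap i k)
  rw [Perm.mul_apply, Perm.mul_apply]
  grind

theorem adjSwap_braid {i j : Fin (n - 1)} (h : (i : ℕ) + 1 = j) :
    adjSwap i * adjSwap j * adjSwap i = adjSwap j * adjSwap i * adjSwap j := by
  ext k
  have h1 := adjSwap_apply_val i k
  have h2 := adjSwap_apply_val j k
  have h3 := adjSwap_apply_val i (adjSwap j k)
  have h4 := adjSwap_apply_val j (adjSwap i k)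
  have h5 := adjSwap_apply_val j (adjSwap i (adjSwap j k))
  have h6 := adjSwap_apply_val i (adjSwap j (adjSwap i k))
  rw [Perm.mul_apply, Perm.mul_apply, Perm.mul_apply, Perm.mul_apply]
  split_ifs at h1 h2 <;> rw [h1] at h4 <;> rw [h2] at h3 <;> split_ifs at h3 h4 <;>
    rw [h3] at h5 <;> rw [h4] at h6 <;> split_ifs at h5 h6 <;> omega

theorem artin_of_comm {i j : Fin (n - 1)} (hij : (i : ℕ) + 2 ≤ j ∨ (j : ℕ) + 2 ≤ i) :
    PresentedMonoid.of (ArtinRel n) i * PresentedMonoid.of (ArtinRel n) j =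
      PresentedMonoid.of (ArtinRel n) j * PresentedMonoid.of (ArtinRel n) i := by
  rcases hij with h | h
  · exact PresentedMonoid.mk_eq_mk_of_rel (.comm i j h)
  · exact (PresentedMonoid.mk_eq_mk_of_rel (.comm j i h)).symm

theorem artin_of_braid {i j : Fin (n - 1)} (hij : (i : ℕ) + 1 = j ∨ (j : ℕ) + 1 = i) :
    PresentedMonoid.of (ArtinRel n) i * PresentedMonoid.of (ArtinRel n) j *
      PresentedMonoid.of (ArtinRel n) i = PresentedMonoid.of (ArtinRel n) j *
      PresentedMonoid.of (ArtinRel n) i * PresentedMonoid.of (ArtinRel n) j := by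
  rcases hij with h | h
  · exact PresentedMonoid.mk_eq_mk_of_rel (.braid i j h)
  · exact (PresentedMonoid.mk_eq_mk_of_rel (.braid j i h)).symm

/-- The germ of the monoid of positive braids. -/
def artinGerm (n : ℕ) : Germ (ArtinRel n) (Perm (Fin n)) where
  toLengthGroup := inversionGroup n
  atom := adjSwap
  atom_ne_one i h := by
    have := congrArg (fun f : Perm (Fin n) => f (lo i)) h
    simp only [adjSwap, swap_apply_left, Perm.one_apply] at this
    exact (lo_lt_hi i).ne' this
  atom_pre _ := inversionGroup_pre_top _
  exists_atom x _ hx := by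
    by_contra hc
    push Not at hc
    apply hx
    rw [← inv_eq_one]
    apply eq_one_of_strictMono
    apply strictMono_of_lo_hi
    intro i
    have h1 := hc i
    rw [adjSwap_pre_iff, not_lt] at h1
    exact lt_of_le_of_ne h1 fun e => (lo_lt_hi i).ne (x⁻¹.injective e)
  eq_top w _ hw := by
    have h : StrictMono ((Fin.revPerm : Perm (Fin n)) * w⁻¹ : Perm (Fin n)) := by
      apply strictMono_of_lo_hi
      intro i
      have h1 := adjSwap_pre_iff.1 (hw i)
      simpa using h1
    have h2 := eq_one_of_strictMono h
    exact (mul_inv_eq_one.1 h2).symm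
  rel_prod a b h := by
    cases h with
    | comm i j h =>
      simp only [map_mul, FreeMonoid.lift_eval_of]
      exact adjSwap_comm h
    | braid i j h =>
      simp only [map_mul, FreeMonoid.lift_eval_of]
      exact adjSwap_braid h
  rel_spells a b h := by
    cases h with
    | comm i j h =>
      exact ⟨spells_comm (.inl h) (inversionGroup_pre_top _) (inversionGroup_pre_top _),
        spells_comm (.inr h) (inversionGroup_pre_top _) (inversionGroup_pre_top _)⟩
    | braid i j h =>
      exact ⟨spells_braid (.inl h) (inversionGroup_pre_top _) (inversionGroup_pre_top _),
        spells_braid (.inr h) (inversionGroup_pre_top _) (inversionGroup_pre_top _)⟩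
  join i j hij := by
    have hij' : (i : ℕ) ≠ j := fun e => hij (Fin.ext e)
    by_cases h : (i : ℕ) + 2 ≤ j ∨ (j : ℕ) + 2 ≤ i
    · exact ⟨[j], [i], by simpa using artin_of_comm h,
        fun w _ h1 h2 => ⟨spells_comm h h1 h2, spells_comm h.symm h2 h1⟩⟩
    · have h : (i : ℕ) + 1 = j ∨ (j : ℕ) + 1 = i := by omega
      exact ⟨[j, i], [i, j], by simpa [mul_assoc] using artin_of_braid h,
        fun w _ h1 h2 => ⟨spells_braid h h1 h2, spells_braid h.symm h2 h1⟩⟩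

end Inversions

end

section

/-! ### Cycles of permutations multiplied by a transposition -/

section Cycles

open Equiv Equiv.Perm

variable {α : Type*} [DecidableEq α] [Finite α] {i j k l : α} {w g : Perm α}

/-- Multiplying by a transposition affects only the two cycles that it meets. -/
theorem sameCycle_of_swap_mul (h : SameCycle (swap i j * g) k l) :
    SameCycle g k l ∨
      ((SameCycle g k i ∨ SameCycle g k j) ∧ (SameCycle g l i ∨ SameCycle g l j)) := by
  obtain ⟨m, rfl⟩ := h.exists_nat_pow_eq
  clear h
  induction m with
  | zero => exact Or.inl (SameCycle.refl _ _)
  | succ m ih =>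
    rw [pow_succ', mul_apply]
    set x := ((swap i j * g) ^ m) k
    have hx : SameCycle g x (g x) := sameCycle_apply_right.2 (SameCycle.refl _ _)
    rw [mul_apply]
    by_cases h1 : g x = i
    · rw [h1, swap_apply_left]
      rw [h1] at hx
      exact Or.inr ⟨ih.elim (fun h => Or.inl (h.trans hx)) fun h => h.1, Or.inr (SameCycle.refl _ _)⟩
    by_cases h2 : g x = j
    · rw [h2, swap_apply_right]
      rw [h2] at hx
      exact Or.inr ⟨ih.elim (fun h => Or.inr (h.trans hx)) fun h => h.1, Or.inl (SameCycle.refl _ _)⟩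
    rw [swap_apply_of_ne_of_ne h1 h2]
    rcases ih with h | ⟨h, h'⟩
    · exact Or.inl (h.trans hx)
    · exact Or.inr ⟨h, h'.imp hx.symm.trans hx.symm.trans⟩

theorem sameCycle_swap_mul_or (h : SameCycle w k l) : SameCycle (swap i j * w) k l ∨
    ((SameCycle (swap i j * w) k i ∨ SameCycle (swap i j * w) k j) ∧
      (SameCycle (swap i j * w) l i ∨ SameCycle (swap i j * w) l j)) := by
  apply sameCycle_of_swap_mul
  rwa [← mul_assoc, swap_mul_self, one_mul]

/-- Until the orbit of `i` first returns to `{i, j}`, the swap is not felt; at that time it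
exchanges the two possible landing points. A cycle through both points is therefore cut, and two
distinct cycles are merged. -/
theorem exists_first_return (w : Perm α) (i j : α) : ∃ m : ℕ, 0 < m ∧
    ((w ^ m) i = i ∨ (w ^ m) i = j) ∧ (∀ r, 0 < r → r < m → (w ^ r) i ≠ i ∧ (w ^ r) i ≠ j) ∧
    ((swap i j * w) ^ m) i = swap i j ((w ^ m) i) ∧
    ∀ r, r < m → ((swap i j * w) ^ r) i = (w ^ r) i := by
  classical
  have hex : ∃ m : ℕ, 0 < m ∧ ((w ^ m) i = i ∨ (w ^ m) i = j) :=
    ⟨orderOf w, orderOf_pos w, by simp [pow_orderOf_eq_one]⟩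
  obtain ⟨h0, h1⟩ := Nat.find_spec hex
  have hmin := fun r => Nat.find_min hex (m := r)
  set m := Nat.find hex
  have h2 : ∀ r, 0 < r → r < m → (w ^ r) i ≠ i ∧ (w ^ r) i ≠ j := by
    intro r hr hrm
    have := hmin r hrm
    push Not at this
    exact this hr
  have h3 : ∀ r, r < m → ((swap i j * w) ^ r) i = (w ^ r) i := by
    intro r
    induction r with
    | zero => simp
    | succ r ih =>
      intro hr
      have e : (w ^ (r + 1)) i = w ((w ^ r) i) := by rw [pow_succ', mul_apply]
      have := h2 (r + 1) (by omega) hr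
      rw [pow_succ', mul_apply, ih (by omega), mul_apply, ← e,
        swap_apply_of_ne_of_ne this.1 this.2]
  refine ⟨m, h0, h1, h2, ?_, h3⟩
  obtain ⟨r, hr⟩ : ∃ r, m = r + 1 := ⟨m - 1, by omega⟩
  rw [hr, pow_succ', mul_apply, h3 r (by omega), mul_apply, pow_succ', mul_apply]

theorem exists_lt_of_sameCycle {α : Type*} [Finite α] {i j : α} {w : Perm α} {m : ℕ}
    (hm : 0 < m) (h : (w ^ m) i = i) (hc : SameCycle w i j) :
    ∃ r < m, (w ^ r) i = j := by
  obtain ⟨r, rfl⟩ := hc.exists_nat_pow_eq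
  refine ⟨r % m, Nat.mod_lt _ hm, ?_⟩
  have h1 : ∀ q : ℕ, ((w ^ m) ^ q) i = i := by
    intro q
    induction q with
    | zero => simp
    | succ q ih => rw [pow_succ, mul_apply, h, ih]
  conv_rhs => rw [← Nat.mod_add_div r m, pow_add, mul_apply, pow_mul, h1]

theorem not_sameCycle_swap_mul (hij : i ≠ j) (h : SameCycle w i j) :
    ¬ SameCycle (swap i j * w) i j := by
  obtain ⟨m, h0, h1, h2, h3, h4⟩ := exists_first_return w i j
  have hj : (w ^ m) i = j := by
    rcases h1 with h1 | h1
    · obtain ⟨r, hr, e⟩ := exists_lt_of_sameCycle h0 h1 h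
      rcases Nat.eq_zero_or_pos r with rfl | hr0
      · exact absurd e (by simpa using hij)
      · exact absurd e (h2 r hr0 hr).2
    · exact h1
  intro hc
  rw [hj, swap_apply_right] at h3
  obtain ⟨r, hr, e⟩ := exists_lt_of_sameCycle h0 h3 hc
  rw [h4 r hr] at e
  rcases Nat.eq_zero_or_pos r with rfl | hr0
  · exact hij (by simpa using e)
  · exact (h2 r hr0 hr).2 e

theorem sameCycle_swap_mul_of_not (h : ¬ SameCycle w i j) : SameCycle (swap i j * w) i j := by
  obtain ⟨m, h0, h1, h2, h3, h4⟩ := exists_first_return w i j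
  rcases h1 with h1 | h1
  · rw [h1, swap_apply_left] at h3
    exact ⟨m, by simpa using h3⟩
  · exact absurd ⟨m, by simpa using h1⟩ h

end Cycles

/-! ### The symmetric group with the reflection length -/

section Reflections

open Equiv Equiv.Perm

variable {n : ℕ} {w : Perm (Fin n)} {i j k l : Fin n}

/-- The functions that are invariant under a permutation. -/
def fixFun (w : Perm (Fin n)) : Submodule ℚ (Fin n → ℚ) where
  carrier := {f | ∀ x, f (w x) = f x}
  add_mem' hf hg x := by simp [hf x, hg x]
  zero_mem' _ := rfl
  smul_mem' c f hf x := by simp [hf x]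

theorem apply_eq_of_sameCycle {f : Fin n → ℚ} (hf : f ∈ fixFun w) (h : SameCycle w i j) :
    f i = f j := by
  obtain ⟨m, rfl⟩ := h.exists_nat_pow_eq
  clear h
  induction m with
  | zero => simp
  | succ m ih => rw [pow_succ', mul_apply, hf, ih]

/-- The reflection length of a permutation. -/
def reflLength (w : Perm (Fin n)) : ℕ := n - Module.finrank ℚ (fixFun w)

theorem finrank_fixFun_le (w : Perm (Fin n)) : Module.finrank ℚ (fixFun w) ≤ n := by
  simpa using Submodule.finrank_le (fixFun w)

/-- The reflection length is the codimension of the invariant functions, that is `n` minus the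
number of cycles. Functions invariant under both factors are invariant under the product, and the
dimension formula for sums and intersections concludes. -/
theorem reflLength_mul_le (x y : Perm (Fin n)) :
    reflLength (x * y) ≤ reflLength x + reflLength y := by
  have h1 := Submodule.finrank_sup_add_finrank_inf_eq (fixFun x) (fixFun y)
  have h2 : Module.finrank ℚ (fixFun x ⊔ fixFun y : Submodule ℚ (Fin n → ℚ)) ≤ n := by
    simpa using Submodule.finrank_le (fixFun x ⊔ fixFun y)
  have h3 : Module.finrank ℚ (fixFun x ⊓ fixFun y : Submodule ℚ (Fin n → ℚ)) ≤
      Module.finrank ℚ (fixFun (x * y)) := by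
    apply Submodule.finrank_mono
    rintro f ⟨hx, hy⟩ a
    rw [mul_apply, hx, hy]
  have h4 := finrank_fixFun_le x
  have h5 := finrank_fixFun_le y
  unfold reflLength; omega

theorem reflLength_eq_zero (w : Perm (Fin n)) : reflLength w = 0 ↔ w = 1 := by
  have h0 := finrank_fixFun_le w
  constructor
  · intro h
    have h1 : fixFun w = ⊤ := by
      apply Submodule.eq_top_of_finrank_eq
      unfold reflLength at h
      simp only [Module.finrank_fintype_fun_eq_card, Fintype.card_fin]; omega
    ext i
    have h2 : (Pi.single i 1 : Fin n → ℚ) ∈ fixFun w := h1 ▸ Submodule.mem_top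
    have h3 := h2 i
    by_contra hc
    rw [Pi.single_eq_same, Pi.single_eq_of_ne (fun e => hc (by simp [e]))] at h3
    exact zero_ne_one h3
  · rintro rfl
    have : fixFun (1 : Perm (Fin n)) = ⊤ := by
      rw [eq_top_iff]; intro f _ x; rfl
    unfold reflLength; rw [this]; simp

theorem finrank_fixFun_conj (c x : Perm (Fin n)) :
    Module.finrank ℚ (fixFun (c⁻¹ * x * c)) = Module.finrank ℚ (fixFun x) := by
  have : fixFun (c⁻¹ * x * c) = (fixFun x).map (LinearEquiv.funCongrLeft ℚ ℚ c).toLinearMap := by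
    ext f
    rw [Submodule.mem_map]
    constructor
    · intro hf
      refine ⟨f ∘ ⇑c⁻¹, fun a => ?_, ?_⟩
      · have := hf (c⁻¹ a)
        simpa using this
      · ext a; simp [LinearEquiv.funCongrLeft, LinearMap.funLeft]
    · rintro ⟨g, hg, rfl⟩ a
      have := hg (c a)
      simpa [LinearEquiv.funCongrLeft, LinearMap.funLeft] using this
  rw [this, LinearEquiv.finrank_map_eq]

theorem reflLength_swap_le (i j : Fin n) : reflLength (swap i j) ≤ 1 := by
  let φ : (Fin n → ℚ) →ₗ[ℚ] ℚ := LinearMap.proj (R := ℚ) (φ := fun _ => ℚ) i - LinearMap.proj j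
  have h1 : LinearMap.ker φ ≤ fixFun (swap i j) := by
    intro f hf x
    have hf' : f i = f j := by simpa [φ, sub_eq_zero] using hf
    rw [swap_apply_def]
    split_ifs with h1 h2
    · rw [h1, hf']
    · rw [h2, hf']
    · rfl
  have h2 := Submodule.finrank_mono h1
  have h3 := LinearMap.finrank_range_add_finrank_ker φ
  have h4 : Module.finrank ℚ (LinearMap.range φ) ≤ 1 := by
    simpa using Submodule.finrank_le (LinearMap.range φ)
  simp only [Module.finrank_fintype_fun_eq_card, Fintype.card_fin] at h3
  unfold reflLength; omega

theorem reflLength_swap (hij : i ≠ j) : reflLength (swap i j) = 1 := by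
  have h1 := reflLength_swap_le i j
  have h2 : reflLength (swap i j) ≠ 0 := by
    rw [ne_eq, reflLength_eq_zero, swap_eq_one_iff]; exact hij
  omega

/-- The swap cuts the cycle of `i` and `j`: invariant functions stay invariant, and the indicator of
the new cycle of `i` is an additional one. -/
theorem reflLength_lt (hij : i ≠ j) (h : SameCycle w i j) :
    reflLength (swap i j * w) < reflLength w := by
  have h1 : fixFun w < fixFun (swap i j * w) := by
    refine lt_of_le_of_ne ?_ ?_
    · intro f hf x
      have := apply_eq_of_sameCycle hf h
      rw [mul_apply, swap_apply_def]
      split_ifs with h1 h2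
      · rw [← this, ← h1, hf]
      · rw [this, ← h2, hf]
      · exact hf x
    · intro e
      have hnot := not_sameCycle_swap_mul hij h
      classical
      have hf : (fun x => if SameCycle (swap i j * w) i x then (1 : ℚ) else 0) ∈
          fixFun (swap i j * w) := by
        intro x
        simp only [sameCycle_apply_right]
      rw [← e] at hf
      have := apply_eq_of_sameCycle hf h
      simp [hnot, SameCycle.refl] at this
  have h2 := Submodule.finrank_lt_finrank_of_lt h1
  have h3 := finrank_fixFun_le (swap i j * w)
  unfold reflLength; omega

/-- The symmetric group with the reflection length and the standard cycle. -/
def reflectionGroup (n : ℕ) : LengthGroup (Perm (Fin n)) where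
  length := reflLength
  top := finRotate n
  length_mul_le := reflLength_mul_le
  length_eq_zero := reflLength_eq_zero
  length_conj x := by unfold reflLength; rw [finrank_fixFun_conj]

/-- A swap inside a cycle shortens `w`, by one at most; a swap between two cycles merges them and
lengthens it. -/
theorem swap_pre_iff (hij : i ≠ j) :
    (reflectionGroup n).Pre (swap i j) w ↔ SameCycle w i j := by
  change reflLength (swap i j) + reflLength ((swap i j)⁻¹ * w) = reflLength w ↔ _
  rw [reflLength_swap hij, swap_inv]
  have e : swap i j * (swap i j * w) = w := by rw [← mul_assoc, swap_mul_self, one_mul]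
  constructor
  · intro h
    by_contra hc
    have := reflLength_lt hij (sameCycle_swap_mul_of_not hc)
    rw [e] at this; omega
  · intro h
    have h1 := reflLength_lt hij h
    have h2 := reflLength_mul_le (swap i j) (swap i j * w)
    rw [e, reflLength_swap hij] at h2; omega

theorem finRotate_apply_val (x : Fin n) :
    (finRotate n x : ℕ) = if (x : ℕ) + 1 = n then 0 else (x : ℕ) + 1 := by
  cases n with
  | zero => exact x.elim0
  | succ m =>
    split_ifs with h
    · have : x = Fin.last m := Fin.ext (by simp; omega)
      rw [this, finRotate_last]; rfl
    · rw [coe_finRotate_of_ne_last]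
      intro e; apply h; rw [e]; simp

theorem sameCycle_finRotate (i j : Fin n) : SameCycle (finRotate n) i j := by
  have key : ∀ (m : ℕ) (hm : m < n), SameCycle (finRotate n) ⟨0, by omega⟩ ⟨m, hm⟩ := by
    intro m
    induction m with
    | zero => intro _; exact SameCycle.refl _ _
    | succ m ih =>
      intro hm
      have h := ih (by omega)
      have e : finRotate n ⟨m, by omega⟩ = ⟨m + 1, hm⟩ := by
        ext; rw [finRotate_apply_val]; simp; omega
      rw [← e]; exact sameCycle_apply_right.2 h
  exact (key i i.2).symm.trans (key j j.2)

/-- The cycles of `swap i j * finRotate n` respect the interval `[i, j)`. -/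
theorem mem_Ico_iff_of_sameCycle (hij : i < j)
    (h : SameCycle (swap i j * finRotate n) k l) : (i ≤ k ∧ k < j) ↔ (i ≤ l ∧ l < j) := by
  obtain ⟨m, rfl⟩ := h.exists_nat_pow_eq
  clear h
  induction m with
  | zero => simp
  | succ m ih =>
    rw [ih, pow_succ', mul_apply]
    set x := ((swap i j * finRotate n) ^ m) k
    rw [mul_apply, swap_apply_def]
    have hx := finRotate_apply_val x
    simp only [Fin.le_def, Fin.lt_def, Fin.ext_iff] at hij ⊢
    split_ifs <;> split_ifs at hx <;> omega

/-- This is the noncrossing property of permutations below the long cycle: a transposition below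
`swap i j * w` is also below `swap i j * finRotate n`, whose cycles do not cross the cut. -/
theorem mem_Ico_iff_of_pre (hw : (reflectionGroup n).Pre w (finRotate n)) (hij : i < j)
    (h : SameCycle w i j) (h' : SameCycle (swap i j * w) k l) :
    (i ≤ k ∧ k < j) ↔ (i ≤ l ∧ l < j) := by
  by_cases hkl : k = l
  · rw [hkl]
  apply mem_Ico_iff_of_sameCycle hij
  rw [← swap_pre_iff hkl] at h' ⊢
  have h1 := (swap_pre_iff hij.ne).2 h
  have := h1.quot hw
  rw [swap_inv] at this
  exact h'.trans this

/-- The transposition attached to a generator of the dual braid monoid. -/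
def dualSwap (a : DualGen n) : Perm (Fin n) := swap a.1.1 a.1.2

theorem dualSwap_pre_iff {a : DualGen n} :
    (reflectionGroup n).Pre (dualSwap a) w ↔ SameCycle w a.1.1 a.1.2 := swap_pre_iff a.2.ne

theorem dual_rel_triangle (hij : i < j) (hjk : j < k) :
    swap i j * swap j k = swap j k * swap i k ∧ swap j k * swap i k = swap i k * swap i j := by
  have h1 := mul_swap_eq_swap_mul (swap i j) j k
  have h2 := mul_swap_eq_swap_mul (swap j k) i k
  rw [swap_apply_right, swap_apply_of_ne_of_ne (hij.trans hjk).ne' hjk.ne'] at h1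
  rw [swap_apply_right, swap_apply_of_ne_of_ne hij.ne (hij.trans hjk).ne] at h2
  exact ⟨h2.symm, h2.trans h1⟩

theorem swap_mul_swap_comm (h1 : k ≠ i) (h2 : k ≠ j) (h3 : l ≠ i) (h4 : l ≠ j) :
    swap i j * swap k l = swap k l * swap i j := by
  have := mul_swap_eq_swap_mul (swap i j) k l
  rwa [swap_apply_of_ne_of_ne h1 h2, swap_apply_of_ne_of_ne h3 h4] at this

/-- Each cut separates the inside of a half-open interval from its outside; the third point stays
with the cut point on its own side. -/
theorem sameCycle_triangle (hw : (reflectionGroup n).Pre w (finRotate n))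
    (hij : i < j) (hjk : j < k) (h1 : SameCycle w i j)
    (h2 : SameCycle w j k) : SameCycle (swap i j * w) j k ∧ SameCycle (swap j k * w) i k ∧
      SameCycle (swap i k * w) i j := by
  have h3 := h1.trans h2
  refine ⟨?_, ?_, ?_⟩
  · rcases sameCycle_swap_mul_or (i := i) (j := j) h2 with h | ⟨-, h | h⟩
    · exact h
    · have := mem_Ico_iff_of_pre hw hij h1 h
      omega
    · exact h.symm
  · rcases sameCycle_swap_mul_or (i := j) (j := k) h3 with h | ⟨h | h, -⟩
    · exact h
    · have := mem_Ico_iff_of_pre hw hjk h2 h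
      omega
    · exact h
  · rcases sameCycle_swap_mul_or (i := i) (j := k) h1 with h | ⟨-, h | h⟩
    · exact h
    · exact h.symm
    · have := mem_Ico_iff_of_pre hw (hij.trans hjk) h3 h
      omega

theorem sameCycle_of_side (hw : (reflectionGroup n).Pre w (finRotate n))
    (hij : i < j) (hs : (i ≤ k ∧ k < j) ↔ (i ≤ l ∧ l < j))
    (h1 : SameCycle w i j) (h2 : SameCycle w k l) : SameCycle (swap i j * w) k l := by
  rcases sameCycle_swap_mul_or (i := i) (j := j) h2 with h | ⟨h | h, h' | h'⟩
  · exact h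
  · exact h.trans h'.symm
  · have := mem_Ico_iff_of_pre hw hij h1 h
    have := mem_Ico_iff_of_pre hw hij h1 h'
    omega
  · have := mem_Ico_iff_of_pre hw hij h1 h
    have := mem_Ico_iff_of_pre hw hij h1 h'
    omega
  · exact h.trans h'.symm

/-- If `k` is on the side of `i` and `l` on the side of `j`, then cutting along `i, j` and then
along `i, k` leaves `j, l` together. -/
theorem sameCycle_of_not_side (hw : (reflectionGroup n).Pre w (finRotate n))
    (hij : i < j) (hk : i ≤ k ∧ k < j) (hl : ¬ (i ≤ l ∧ l < j))
    (h1 : SameCycle w i j) (h2 : SameCycle w k l) : SameCycle (swap i j * w) i k ∧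
      SameCycle (swap i k * (swap i j * w)) j l := by
  have hs : ∀ {x y}, SameCycle (swap i j * w) x y → ((i ≤ x ∧ x < j) ↔ (i ≤ y ∧ y < j)) :=
    fun h => mem_Ico_iff_of_pre hw hij h1 h
  have hji : ¬ SameCycle (swap i j * w) j i := fun h => by have := hs h; omega
  have key : SameCycle (swap i j * w) k i ∧ SameCycle (swap i j * w) l j := by
    rcases sameCycle_swap_mul_or (i := i) (j := j) h2 with h | ⟨h, h'⟩
    · have := hs h; omega
    · constructor
      · rcases h with h | h
        · exact h
        · have := hs h; omega
      · rcases h' with h | h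
        · have := hs h; omega
        · exact h
  refine ⟨key.1.symm, ?_⟩
  rcases sameCycle_swap_mul_or (i := i) (j := k) key.2.symm with h | ⟨h, -⟩
  · exact h
  · exfalso
    apply hji
    rcases h with h | h <;> rcases sameCycle_of_swap_mul h with h | ⟨h | h, -⟩
    · exact h
    · exact h
    · exact h.trans key.1
    · exact h.trans key.1
    · exact h
    · exact h.trans key.1

/-- The variant of `sameCycle_of_not_side` with the roles of the two sides exchanged. -/
theorem sameCycle_of_not_side' (hw : (reflectionGroup n).Pre w (finRotate n))
    (hij : i < j) (hk : ¬ (i ≤ k ∧ k < j)) (hl : i ≤ l ∧ l < j)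
    (h1 : SameCycle w i j) (h2 : SameCycle w k l) : SameCycle (swap i j * w) i l ∧
      SameCycle (swap i l * (swap i j * w)) k j := by
  have := sameCycle_of_not_side hw hij hl hk h1 h2.symm
  exact ⟨this.1, this.2.symm⟩

/-! ### Joins of generators and the germ of dual braids -/

/-- The generator `σ_{i,j}` of the dual braid monoid. -/
def dg (h : i < j) : DualGen n := ⟨(i, j), h⟩

/-- The generator `σ_{i,j}` as an element of the dual braid monoid. -/
def dualOf (h : i < j) : PresentedMonoid (DualRel n) := PresentedMonoid.of (DualRel n) (dg h)

theorem dualOf_triangle₁ (hij : i < j) (hjk : j < k) :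
    dualOf hij * dualOf hjk = dualOf hjk * dualOf (hij.trans hjk) :=
  PresentedMonoid.mk_eq_mk_of_rel (.triangle₁ i j k hij hjk)

theorem dualOf_triangle₂ (hij : i < j) (hjk : j < k) :
    dualOf hjk * dualOf (hij.trans hjk) = dualOf (hij.trans hjk) * dualOf hij :=
  PresentedMonoid.mk_eq_mk_of_rel (.triangle₂ i j k hij hjk)

theorem dualOf_disjoint (hij : i < j) (hjk : j < k) (hkl : k < l) :
    dualOf hij * dualOf hkl = dualOf hkl * dualOf hij :=
  PresentedMonoid.mk_eq_mk_of_rel (.disjoint i j k l hij hjk hkl)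

theorem dualOf_nested (hik : i < k) (hkl : k < l) (hlj : l < j) :
    dualOf ((hik.trans hkl).trans hlj) * dualOf hkl =
      dualOf hkl * dualOf ((hik.trans hkl).trans hlj) :=
  PresentedMonoid.mk_eq_mk_of_rel (.nested i j k l hik hkl hlj)

/-- The presentation has no relation for crossing chords; their common multiple of length three
comes from the triangle relations. -/
theorem dualOf_crossing (hik : i < k) (hkj : k < j) (hjl : j < l) :
    dualOf (hik.trans hkj) * (dualOf hik * dualOf hjl) =
      dualOf (hkj.trans hjl) * (dualOf hkj * dualOf ((hik.trans hkj).trans hjl)) := by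
  rw [← mul_assoc, ← dualOf_triangle₂ hik hkj, mul_assoc, dualOf_triangle₁ (hik.trans hkj) hjl,
    ← mul_assoc, dualOf_triangle₁ hkj hjl, dualOf_triangle₂ hkj hjl, mul_assoc]

abbrev DualPre (w : Perm (Fin n)) : Prop := (reflectionGroup n).Pre w (finRotate n)

abbrev DualSpells (L : List (DualGen n)) (w : Perm (Fin n)) : Prop :=
  (reflectionGroup n).Spells dualSwap L w

theorem dualSpells_pair {a b : DualGen n} (h1 : SameCycle w a.1.1 a.1.2)
    (h2 : SameCycle (swap a.1.1 a.1.2 * w) b.1.1 b.1.2) : DualSpells [a, b] w := by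
  refine ⟨dualSwap_pre_iff.2 h1, dualSwap_pre_iff.2 ?_, trivial⟩
  rwa [dualSwap, swap_inv]

theorem dualSpells_triple {a b d : DualGen n} (h1 : SameCycle w a.1.1 a.1.2)
    (h2 : SameCycle (swap a.1.1 a.1.2 * w) b.1.1 b.1.2)
    (h3 : SameCycle (swap b.1.1 b.1.2 * (swap a.1.1 a.1.2 * w)) d.1.1 d.1.2) :
    DualSpells [a, b, d] w := by
  refine ⟨dualSwap_pre_iff.2 h1, dualSwap_pre_iff.2 ?_, dualSwap_pre_iff.2 ?_, trivial⟩
  · rwa [dualSwap, swap_inv]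
  · rwa [dualSwap, swap_inv, dualSwap, swap_inv]

theorem dualSpells_triangle (hw : DualPre w) (hij : i < j) (hjk : j < k) (h1 : SameCycle w i j)
    (h2 : SameCycle w j k) : DualSpells [dg hij, dg hjk] w ∧
      DualSpells [dg hjk, dg (hij.trans hjk)] w ∧ DualSpells [dg (hij.trans hjk), dg hij] w := by
  obtain ⟨a, b, d⟩ := sameCycle_triangle hw hij hjk h1 h2
  exact ⟨dualSpells_pair h1 a, dualSpells_pair h2 b, dualSpells_pair (h1.trans h2) d⟩

theorem dualSpells_disjoint (hw : DualPre w) (hij : i < j) (hjk : j < k) (hkl : k < l)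
    (h1 : SameCycle w i j) (h2 : SameCycle w k l) :
    DualSpells [dg hij, dg hkl] w ∧ DualSpells [dg hkl, dg hij] w := by
  refine ⟨dualSpells_pair h1 (sameCycle_of_side (i := i) (j := j) (k := k) (l := l) hw hij ?_ h1 h2),
    dualSpells_pair h2 (sameCycle_of_side (i := k) (j := l) (k := i) (l := j) hw hkl ?_ h2 h1)⟩ <;> omega

theorem dualSpells_nested (hw : DualPre w) (hik : i < k) (hkl : k < l) (hlj : l < j)
    (h1 : SameCycle w i j) (h2 : SameCycle w k l) :
    DualSpells [dg ((hik.trans hkl).trans hlj), dg hkl] w ∧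
      DualSpells [dg hkl, dg ((hik.trans hkl).trans hlj)] w := by
  refine ⟨dualSpells_pair h1 (sameCycle_of_side (i := i) (j := j) (k := k) (l := l) hw
      ((hik.trans hkl).trans hlj) ?_ h1 h2),
    dualSpells_pair h2 (sameCycle_of_side (i := k) (j := l) (k := i) (l := j) hw hkl ?_ h2 h1)⟩ <;> omega

theorem dualSpells_crossing (hw : DualPre w) (hik : i < k) (hkj : k < j) (hjl : j < l)
    (h1 : SameCycle w i j) (h2 : SameCycle w k l) :
    DualSpells [dg (hik.trans hkj), dg hik, dg hjl] w ∧
      DualSpells [dg (hkj.trans hjl), dg hkj, dg ((hik.trans hkj).trans hjl)] w := by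
  have a := sameCycle_of_not_side hw (hik.trans hkj) (by omega) (by omega) h1 h2
  have b := sameCycle_of_not_side' hw (hkj.trans hjl) (by omega) (by omega) h2 h1
  exact ⟨dualSpells_triple h1 a.1 a.2, dualSpells_triple h2 b.1 b.2⟩

/-- The local join property of two generators of the dual braid monoid. -/
def DualJoin (a b : DualGen n) : Prop := ∃ u v : List (DualGen n),
  PresentedMonoid.of (DualRel n) a * (u.map (PresentedMonoid.of (DualRel n))).prod =
    PresentedMonoid.of (DualRel n) b * (v.map (PresentedMonoid.of (DualRel n))).prod ∧
  ∀ w, DualPre w → SameCycle w a.1.1 a.1.2 → SameCycle w b.1.1 b.1.2 →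
    DualSpells (a :: u) w ∧ DualSpells (b :: v) w

theorem DualJoin.symm {a b : DualGen n} (h : DualJoin a b) : DualJoin b a := by
  obtain ⟨u, v, e, h⟩ := h
  exact ⟨v, u, e.symm, fun w hw h1 h2 => (h w hw h2 h1).symm⟩

theorem dualJoin_triangle (hij : i < j) (hjk : j < k) : DualJoin (dg hij) (dg hjk) ∧
    DualJoin (dg hjk) (dg (hij.trans hjk)) ∧ DualJoin (dg hij) (dg (hij.trans hjk)) := by
  have e1 := dualOf_triangle₁ hij hjk
  have e2 := dualOf_triangle₂ hij hjk
  refine ⟨⟨[dg hjk], [dg (hij.trans hjk)], ?_, fun w hw h1 h2 => ?_⟩,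
    ⟨[dg (hij.trans hjk)], [dg hij], ?_, fun w hw h1 h2 => ?_⟩,
    ⟨[dg hjk], [dg hij], ?_, fun w hw h1 h2 => ?_⟩⟩
  · simpa [dualOf] using e1
  · have := dualSpells_triangle hw hij hjk h1 h2
    exact ⟨this.1, this.2.1⟩
  · simpa [dualOf] using e2
  · exact (dualSpells_triangle hw hij hjk (h2.trans h1.symm) h1).2
  · simpa [dualOf] using e1.trans e2
  · have := dualSpells_triangle hw hij hjk h1 (h1.symm.trans h2)
    exact ⟨this.1, this.2.2⟩

/-- Ordering the two chords lexicographically leaves four configurations: disjoint, sharing an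
endpoint, nested and crossing. -/
theorem dualJoin_of_ne (a b : DualGen n) (hab : a ≠ b) : DualJoin a b := by
  wlog h : a.1.1 < b.1.1 ∨ (a.1.1 = b.1.1 ∧ a.1.2 < b.1.2) generalizing a b
  · refine (this b a hab.symm ?_).symm
    by_contra hc
    apply hab
    have h1 : a.1.1 = b.1.1 := by omega
    have h2 : a.1.2 = b.1.2 := by omega
    exact Subtype.ext (Prod.ext h1 h2)
  obtain ⟨⟨i, j⟩, hij⟩ := a
  obtain ⟨⟨k, l⟩, hkl⟩ := b
  simp only at hij hkl h
  rcases h with h | ⟨rfl, h⟩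
  · rcases lt_trichotomy j k with hjk | rfl | hjk
    · exact ⟨[dg hkl], [dg hij], by simpa [dualOf, dg] using dualOf_disjoint hij hjk hkl,
        fun w hw h1 h2 => dualSpells_disjoint hw hij hjk hkl h1 h2⟩
    · exact (dualJoin_triangle hij hkl).1
    · rcases lt_trichotomy l j with hlj | rfl | hlj
      · exact ⟨[dg hkl], [dg hij], by simpa [dualOf, dg] using dualOf_nested h hkl hlj,
          fun w hw h1 h2 => dualSpells_nested hw h hkl hlj h1 h2⟩
      · exact (dualJoin_triangle h hkl).2.1.symm
      · exact ⟨[dg h, dg hlj], [dg hjk, dg (hij.trans hlj)],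
          by simpa [dualOf, dg] using dualOf_crossing h hjk hlj,
          fun w hw h1 h2 => dualSpells_crossing hw h hjk hlj h1 h2⟩
  · exact (dualJoin_triangle hij h).2.2

/-- The germ of the monoid of dual positive braids. -/
def dualGerm (n : ℕ) : Germ (DualRel n) (Perm (Fin n)) where
  toLengthGroup := reflectionGroup n
  atom := dualSwap
  atom_ne_one a h := a.2.ne (swap_eq_one_iff.1 h)
  atom_pre _ := dualSwap_pre_iff.2 (sameCycle_finRotate _ _)
  exists_atom x _ hx := by
    obtain ⟨i, hi⟩ : ∃ i, x i ≠ i := by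
      by_contra hc
      push Not at hc
      exact hx (Equiv.ext hc)
    have h : SameCycle x i (x i) := sameCycle_apply_right.2 (SameCycle.refl _ _)
    rcases lt_or_gt_of_ne hi with h' | h'
    · exact ⟨dg h', dualSwap_pre_iff.2 h.symm⟩
    · exact ⟨dg h', dualSwap_pre_iff.2 h⟩
  eq_top w hw h := by
    have hs : ∀ i j, SameCycle w i j := by
      intro i j
      rcases lt_trichotomy i j with h' | rfl | h'
      · exact dualSwap_pre_iff.1 (h (dg h'))
      · exact SameCycle.refl _ _
      · exact (dualSwap_pre_iff.1 (h (dg h'))).symm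
    -- All points lie in one cycle of `w`, so its invariant functions are constant and `w` is at
    -- least as long as the long cycle.
    have h1 : fixFun w ≤ fixFun (finRotate n) :=
      fun f hf x => apply_eq_of_sameCycle hf (hs _ _)
    have h2 := Submodule.finrank_mono h1
    apply LengthGroup.Pre.eq_of_length_le hw
    exact Nat.sub_le_sub_left h2 n
  rel_prod a b h := by
    cases h with
    | triangle₁ i j k hij hjk => exact (dual_rel_triangle hij hjk).1
    | triangle₂ i j k hij hjk => exact (dual_rel_triangle hij hjk).2
    | disjoint i j k l hij hjk hkl =>
      exact swap_mul_swap_comm (i := i) (j := j) (k := k) (l := l) (by omega) (by omega)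
        (by omega) (by omega)
    | nested i j k l hik hkl hlj =>
      exact swap_mul_swap_comm (i := i) (j := j) (k := k) (l := l) (by omega) (by omega)
        (by omega) (by omega)
  rel_spells a b h := by
    have s := sameCycle_finRotate (n := n)
    have r : DualPre (finRotate n) := LengthGroup.pre_refl _
    cases h with
    | triangle₁ i j k hij hjk =>
      have := dualSpells_triangle r hij hjk (s _ _) (s _ _)
      exact ⟨this.1, this.2.1⟩
    | triangle₂ i j k hij hjk =>
      exact (dualSpells_triangle r hij hjk (s _ _) (s _ _)).2
    | disjoint i j k l hij hjk hkl =>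
      exact dualSpells_disjoint r hij hjk hkl (s _ _) (s _ _)
    | nested i j k l hik hkl hlj =>
      exact dualSpells_nested r hik hkl hlj (s _ _) (s _ _)
  join a b hab := by
    obtain ⟨u, v, e, h⟩ := dualJoin_of_ne a b hab
    exact ⟨u, v, e, fun w hw h1 h2 =>
      h w hw (dualSwap_pre_iff.1 h1) (dualSwap_pre_iff.1 h2)⟩

end Reflections

end

section

/-! ### Divisibility in the braid monoids -/

/-- The germ of the braid monoid of either kind. -/
def germ : (κ : Kind) → (n : ℕ) → Germ (Rel κ n) (Equiv.Perm (Fin n))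
  | .artin, n => artinGerm n
  | .dual, n => dualGerm n

variable {κ : Kind} {n : ℕ} {x y z u v d : Braid κ n} {s t : Gen κ n}

instance : IsLeftCancelMul (Braid κ n) := ⟨fun _ _ _ h => (germ κ n).mul_cancel h⟩

theorem exists_gen_join (s t : Gen κ n) : ∃ j : Braid κ n, gen s ∣ j ∧ gen t ∣ j ∧
    ∀ x, gen s ∣ x → gen t ∣ x → j ∣ x := (germ κ n).exists_join s t

@[elab_as_elim]
theorem braid_induction {P : Braid κ n → Prop} (one : P 1)
    (mul : ∀ s x, P x → P (gen s * x)) (x : Braid κ n) : P x := by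
  obtain ⟨L, rfl⟩ := (germ κ n).word_surjective x
  induction L with
  | nil => exact one
  | cons s L ih => rw [Germ.word_cons]; exact mul s _ ih

theorem len_le_of_dvd (h : x ∣ y) : len x ≤ len y := by
  obtain ⟨z, rfl⟩ := h
  rw [len_mul]; omega

theorem exists_eq_gen_mul (h : x ≠ 1) : ∃ s y, x = gen s * y := by
  induction x using braid_induction with
  | one => exact absurd rfl h
  | mul s x _ => exact ⟨s, x, rfl⟩

theorem exists_gen_dvd (h : x ≠ 1) : ∃ s, gen s ∣ x := by
  obtain ⟨s, y, rfl⟩ := exists_eq_gen_mul h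
  exact ⟨s, dvd_mul_right _ _⟩

theorem len_eq_zero : len x = 0 ↔ x = 1 := by
  refine ⟨fun h => ?_, fun h => h ▸ len_one⟩
  by_contra hx
  obtain ⟨s, y, rfl⟩ := exists_eq_gen_mul hx
  rw [len_mul, len_gen] at h; omega

theorem len_pos (h : x ≠ 1) : 0 < len x := Nat.pos_of_ne_zero fun e => h (len_eq_zero.1 e)

theorem eq_of_dvd_of_len_le (h : x ∣ y) (hl : len y ≤ len x) : x = y := by
  obtain ⟨z, rfl⟩ := h
  rw [len_mul] at hl
  rw [len_eq_zero.1 (show len z = 0 by omega), mul_one]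

theorem braid_dvd_antisymm (h : x ∣ y) (h' : y ∣ x) : x = y :=
  eq_of_dvd_of_len_le h (len_le_of_dvd h')

theorem braid_mul_dvd_mul_iff : z * x ∣ z * y ↔ x ∣ y := by
  constructor
  · rintro ⟨w, hw⟩
    exact ⟨w, mul_left_cancel (a := z) (by rw [hw, mul_assoc])⟩
  · exact mul_dvd_mul_left z

theorem not_mul_gen_dvd (x : Braid κ n) (s : Gen κ n) : ¬ x * gen s ∣ x := by
  intro h
  have := len_le_of_dvd h
  rw [len_mul, len_gen] at this; omega

theorem IsJoin.unique {X : Finset (Gen κ n)} {d d' : Braid κ n} (h : IsJoin X d)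
    (h' : IsJoin X d') : d = d' :=
  braid_dvd_antisymm (h.2 _ h'.1) (h'.2 _ h.1)

theorem delta_isJoin : IsJoin Finset.univ (delta κ n) :=
  Classical.epsilon_spec ⟨(germ κ n).lift (germ κ n).top,
    fun s _ => Germ.of_dvd_lift_top s, fun _ h => Germ.lift_top_dvd fun s => h s (Finset.mem_univ s)⟩

theorem delta_eq_lift : delta κ n = (germ κ n).lift (germ κ n).top :=
  delta_isJoin.unique ⟨fun s _ => Germ.of_dvd_lift_top s,
    fun _ h => Germ.lift_top_dvd fun s => h s (Finset.mem_univ s)⟩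

theorem gen_dvd_delta (s : Gen κ n) : gen s ∣ delta κ n := delta_isJoin.1 s (Finset.mem_univ s)

theorem exists_mul_delta (x : Braid κ n) : ∃ y, x * delta κ n = delta κ n * y := by
  induction x using braid_induction with
  | one => exact ⟨1, by simp⟩
  | mul s x ih =>
    obtain ⟨y, hy⟩ := ih
    obtain ⟨z, hz⟩ : ∃ z, gen s * delta κ n = delta κ n * z := by
      rw [delta_eq_lift]; exact Germ.of_mul_lift_top s
    exact ⟨z * y, by rw [mul_assoc, hy, ← mul_assoc, hz, mul_assoc]⟩

theorem exists_mul_delta_pow (x : Braid κ n) (k : ℕ) :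
    ∃ y, x * delta κ n ^ k = delta κ n ^ k * y := by
  induction k with
  | zero => exact ⟨x, by simp⟩
  | succ k ih =>
    obtain ⟨y, hy⟩ := ih
    obtain ⟨z, hz⟩ := exists_mul_delta y
    exact ⟨z, by rw [pow_succ, ← mul_assoc, hy, mul_assoc, hz, mul_assoc]⟩

/-- A right factor of a simple braid is simple. -/
theorem dvd_delta_of_mul_dvd (h : u * v ∣ delta κ n) : v ∣ delta κ n := by
  obtain ⟨w, hw⟩ := h
  obtain ⟨u', hu'⟩ := exists_mul_delta u
  refine ⟨w * u', mul_left_cancel (a := u) ?_⟩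
  rw [hu']
  conv_lhs => rw [hw]
  simp only [mul_assoc]

/-- Write `Δ = s t`. Moving `t` through `Δ ^ |x|` leaves `s Δ ^ |x|` on the left, a multiple of `s
x` by induction. In particular, any two braids have a common multiple. -/
theorem dvd_delta_pow_len (x : Braid κ n) : x ∣ delta κ n ^ len x := by
  induction x using braid_induction with
  | one => exact one_dvd _
  | mul s x ih =>
    obtain ⟨z, hz⟩ := ih
    obtain ⟨t, ht⟩ := gen_dvd_delta s
    obtain ⟨t', ht'⟩ := exists_mul_delta_pow t (len x)
    rw [len_mul, len_gen, add_comm, pow_succ', ht, mul_assoc, ← ht, ht', hz, mul_assoc,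
      ← mul_assoc (gen s)]
    exact dvd_mul_right _ _

/-! ### Least common multiples, meets and joins -/

/-- `l` is the least common right multiple of `x` and `y`. -/
def IsLcm (x y l : Braid κ n) : Prop := x ∣ l ∧ y ∣ l ∧ ∀ z, x ∣ z → y ∣ z → l ∣ z

theorem IsLcm.mul_left {l : Braid κ n} (h : IsLcm x y l) (w : Braid κ n) :
    IsLcm (w * x) (w * y) (w * l) := by
  refine ⟨mul_dvd_mul_left w h.1, mul_dvd_mul_left w h.2.1, ?_⟩
  rintro z ⟨a, rfl⟩ hz
  rw [mul_assoc] at hz ⊢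
  rw [braid_mul_dvd_mul_iff] at hz ⊢
  exact h.2.2 _ (dvd_mul_right _ _) hz

/-- The double descent of `exists_isLub`, carried out in the monoid: joins of two generators
propagate to any pair with a common multiple `m`, by induction on `|m|`. -/
theorem exists_isLcm_of_dvd : ∀ (N : ℕ) (m : Braid κ n), len m ≤ N → ∀ x y, x ∣ m → y ∣ m →
    ∃ l, IsLcm x y l := by
  intro N
  induction N with
  | zero =>
    intro m hm x y hx hy
    have : x = 1 := len_eq_zero.1 (by have := len_le_of_dvd hx; omega)
    subst this
    exact ⟨y, one_dvd _, dvd_rfl, fun z _ h => h⟩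
  | succ N ih =>
    intro m hm x y hx hy
    by_cases hx1 : x = 1
    · subst hx1; exact ⟨y, one_dvd _, dvd_rfl, fun z _ h => h⟩
    by_cases hy1 : y = 1
    · subst hy1; exact ⟨x, dvd_rfl, one_dvd _, fun z h _ => h⟩
    obtain ⟨s, x', rfl⟩ := exists_eq_gen_mul hx1
    obtain ⟨t, y', rfl⟩ := exists_eq_gen_mul hy1
    obtain ⟨j, hsj, htj, hj⟩ := exists_gen_join s t
    have hjm : j ∣ m := hj m ((dvd_mul_right _ _).trans hx) ((dvd_mul_right _ _).trans hy)
    have key : ∀ (a : Gen κ n) (x : Braid κ n), gen a ∣ j → gen a * x ∣ m →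
        ∃ k, IsLcm (gen a * x) j (j * k) ∧ j * k ∣ m := by
      rintro a x ⟨f, rfl⟩ hx
      obtain ⟨m', rfl⟩ := (dvd_mul_right (gen a) x).trans hx
      rw [len_mul, len_gen] at hm
      rw [braid_mul_dvd_mul_iff] at hx hjm
      obtain ⟨l, hl⟩ := ih m' (by omega) x f hx hjm
      obtain ⟨k, rfl⟩ := hl.2.1
      refine ⟨k, ?_, ?_⟩
      · rw [mul_assoc]; exact hl.mul_left _
      · rw [mul_assoc, braid_mul_dvd_mul_iff]; exact hl.2.2 _ hx hjm
    obtain ⟨h, hh, hhm⟩ := key s x' hsj hx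
    obtain ⟨k, hk, hkm⟩ := key t y' htj hy
    obtain ⟨m', rfl⟩ := hjm
    rw [braid_mul_dvd_mul_iff] at hhm hkm
    have hlt : len m' ≤ N := by
      have := len_le_of_dvd hsj
      rw [len_gen] at this
      rw [len_mul] at hm; omega
    obtain ⟨l, hl⟩ := ih m' hlt h k hhm hkm
    have hl' := hl.mul_left j
    refine ⟨j * l, hh.1.trans hl'.1, hk.1.trans hl'.2.1, fun z hxz hyz => ?_⟩
    have hjz : j ∣ z := hj z ((dvd_mul_right _ _).trans hxz) ((dvd_mul_right _ _).trans hyz)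
    exact hl'.2.2 z (hh.2.2 z hxz hjz) (hk.2.2 z hyz hjz)

theorem exists_isLcm (x y : Braid κ n) : ∃ l, IsLcm x y l :=
  exists_isLcm_of_dvd _ (delta κ n ^ (len x + len y)) le_rfl x y
    ((dvd_delta_pow_len x).trans (pow_dvd_pow _ (by omega)))
    ((dvd_delta_pow_len y).trans (pow_dvd_pow _ (by omega)))

theorem exists_isMeet (x y : Braid κ n) : ∃ d, IsMeet x y d := by
  classical
  -- Minimizing the colength selects a common divisor of greatest length, which equals its least
  -- common multiple with any other common divisor.
  have hex : ∃ k, ∃ d, d ∣ x ∧ d ∣ y ∧ len x - len d = k := ⟨_, 1, one_dvd _, one_dvd _, rfl⟩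
  obtain ⟨d, hd1, hd2, hd3⟩ := Nat.find_spec hex
  refine ⟨d, ⟨hd1, hd2⟩, fun m h1 h2 => ?_⟩
  obtain ⟨l, hl⟩ := exists_isLcm d m
  have hlx := hl.2.2 x hd1 h1
  have hmin : Nat.find hex ≤ len x - len l := Nat.find_min' hex ⟨l, hlx, hl.2.2 y hd2 h2, rfl⟩
  have e : d = l := eq_of_dvd_of_len_le hl.1 (by
    have := len_le_of_dvd hlx
    have := len_le_of_dvd hd1
    omega)
  rw [e]; exact hl.2.1

theorem exists_isJoin (X : Finset (Gen κ n)) : ∃ d, IsJoin X d := by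
  classical
  induction X using Finset.induction_on with
  | empty => exact ⟨1, by simp, fun _ _ => one_dvd _⟩
  | insert s X _ ih =>
    obtain ⟨d, hd⟩ := ih
    obtain ⟨l, hl⟩ := exists_isLcm (gen s) d
    refine ⟨l, fun t ht => ?_, fun m hm => ?_⟩
    · rcases Finset.mem_insert.1 ht with rfl | ht
      · exact hl.1
      · exact (hd.1 t ht).trans hl.2.1
    · exact hl.2.2 m (hm s (Finset.mem_insert_self _ _))
        (hd.2 m fun t ht => hm t (Finset.mem_insert_of_mem ht))

theorem deltaOf_isJoin (X : Finset (Gen κ n)) : IsJoin X (deltaOf X) :=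
  Classical.epsilon_spec (exists_isJoin X)

theorem deltaOf_dvd_iff {X : Finset (Gen κ n)} : deltaOf X ∣ x ↔ ∀ s ∈ X, gen s ∣ x :=
  ⟨fun h s hs => ((deltaOf_isJoin X).1 s hs).trans h, (deltaOf_isJoin X).2 x⟩

theorem deltaOf_empty : deltaOf (∅ : Finset (Gen κ n)) = 1 :=
  (deltaOf_isJoin ∅).unique ⟨by simp, fun _ _ => one_dvd _⟩

instance : Countable (Gen κ n) := Finite.to_countable

instance : Countable (Braid κ n) :=
  have : Countable (FreeMonoid (Gen κ n)) := inferInstanceAs (Countable (List (Gen κ n)))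
  PresentedMonoid.surjective_mk.countable

theorem finite_len_eq (m : ℕ) : {x : Braid κ n | len x = m}.Finite := by
  induction m with
  | zero =>
    refine (Set.finite_singleton 1).subset fun x hx => ?_
    exact len_eq_zero.1 hx
  | succ m ih =>
    refine ((Set.finite_univ (α := Gen κ n)).image2 (fun s x => gen s * x) ih).subset ?_
    intro x hx
    have hx' : len x = m + 1 := hx
    obtain ⟨s, y, rfl⟩ := exists_eq_gen_mul (x := x)
      (fun e => by rw [e, len_one] at hx'; omega)
    rw [len_mul, len_gen] at hx'
    exact ⟨s, Set.mem_univ _, y, by simp only [Set.mem_ofPred_eq]; omega, rfl⟩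

theorem finite_len_le (m : ℕ) : {x : Braid κ n | len x ≤ m}.Finite := by
  refine (Set.Finite.biUnion (Set.finite_Iic m) fun k _ => finite_len_eq (κ := κ) (n := n) k).subset
    fun x hx => ?_
  exact Set.mem_biUnion (show len x ∈ Set.Iic m from hx) rfl

instance : Finite (Simple κ n) :=
  ((finite_len_le (len (delta κ n))).subset fun _ h => len_le_of_dvd h).to_subtype

/-! ### Normal sequences -/

/-- Products of `k` simple braids. -/
inductive ProdSimple : ℕ → Braid κ n → Prop
  | one : ProdSimple 0 1
  | mul {k : ℕ} {s x : Braid κ n} (hs : s ∣ delta κ n) (hx : ProdSimple k x) :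
      ProdSimple (k + 1) (s * x)

theorem ProdSimple.of_len (x : Braid κ n) : ProdSimple (len x) x := by
  induction x using braid_induction with
  | one => rw [len_one]; exact .one
  | mul s x ih => rw [len_mul, len_gen, add_comm]; exact .mul (gen_dvd_delta s) ih

/-- Residues of products of simple braids by a simple braid. -/
theorem ProdSimple.residue {k : ℕ} (h : ProdSimple k x) {t : Braid κ n} (ht : t ∣ delta κ n) :
    ∃ w, IsLcm t x (t * w) ∧ ProdSimple k w := by
  induction h generalizing t with
  | one => exact ⟨1, ⟨by simp, one_dvd _, fun z h _ => by simpa using h⟩, .one⟩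
  | @mul k s x hs _ ih =>
    obtain ⟨l, hl⟩ := exists_isLcm t s
    have hld := hl.2.2 _ ht hs
    obtain ⟨s', rfl⟩ := hl.1
    obtain ⟨t', hst⟩ := hl.2.1
    obtain ⟨w, hw, hw'⟩ := ih (t := t') (dvd_delta_of_mul_dvd (hst ▸ hld))
    have hw2 := hw.mul_left s
    refine ⟨s' * w, ⟨dvd_mul_right _ _, ?_, fun z hz hz' => ?_⟩,
      .mul (dvd_delta_of_mul_dvd hld) hw'⟩
    · rw [← mul_assoc, hst, mul_assoc]; exact hw2.2.1
    · rw [← mul_assoc, hst, mul_assoc]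
      refine hw2.2.2 z ?_ hz'
      rw [← hst]; exact hl.2.2 z hz ((dvd_mul_right _ _).trans hz')

/-- The product of the `k` first terms of a sequence. -/
def prefixProd (ξ : ℕ → Simple κ n) : ℕ → Braid κ n
  | 0 => 1
  | k + 1 => (ξ 0).1 * prefixProd (fun i => ξ (i + 1)) k

theorem prefixProd_succ' (ξ : ℕ → Simple κ n) (k : ℕ) :
    prefixProd ξ (k + 1) = (ξ 0).1 * prefixProd (fun i => ξ (i + 1)) k := rfl

theorem prefixProd_succ (ξ : ℕ → Simple κ n) (k : ℕ) :
    prefixProd ξ (k + 1) = prefixProd ξ k * (ξ k).1 := by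
  induction k generalizing ξ with
  | zero => simp [prefixProd]
  | succ k ih =>
    rw [prefixProd, ih, ← mul_assoc]
    rfl

theorem prefixProd_dvd (ξ : ℕ → Simple κ n) {k m : ℕ} (h : k ≤ m) :
    prefixProd ξ k ∣ prefixProd ξ m := by
  induction m, h using Nat.le_induction with
  | base => exact dvd_rfl
  | succ m _ ih => rw [prefixProd_succ]; exact ih.trans (dvd_mul_right _ _)

theorem prefixProd_congr {ξ η : ℕ → Simple κ n} {k : ℕ} (h : ∀ i < k, ξ i = η i) :
    prefixProd ξ k = prefixProd η k := by
  induction k with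
  | zero => rfl
  | succ k ih =>
    rw [prefixProd_succ, prefixProd_succ, ih fun i hi => h i (by omega), h k (by omega)]

theorem prodSimple_prefixProd (ξ : ℕ → Simple κ n) (k : ℕ) : ProdSimple k (prefixProd ξ k) := by
  induction k generalizing ξ with
  | zero => exact .one
  | succ k ih => exact .mul (ξ 0).2 (ih _)

/-- Sequences of simple braids that are paths for the relation `Arrow`. -/
def IsPath (ξ : ℕ → Simple κ n) : Prop := ∀ k, Arrow (ξ k) (ξ (k + 1))

theorem IsPath.shift {ξ : ℕ → Simple κ n} (h : IsPath ξ) : IsPath fun i => ξ (i + 1) :=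
  fun k => h (k + 1)

/-- The first term of a path is the greatest simple divisor of its products. -/
theorem IsPath.dvd_zero {ξ : ℕ → Simple κ n} (hξ : IsPath ξ) {k : ℕ} {s : Braid κ n}
    (hs : s ∣ delta κ n) (h : s ∣ prefixProd ξ k) : s ∣ (ξ 0).1 := by
  induction k generalizing ξ s with
  | zero => exact h.trans (one_dvd _)
  | succ k ih =>
    obtain ⟨l, hl⟩ := exists_isLcm (ξ 0).1 s
    have hld := hl.2.2 _ (ξ 0).2 hs
    have hlp := hl.2.2 (prefixProd ξ (k + 1)) (dvd_mul_right _ _) h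
    obtain ⟨r, rfl⟩ := hl.1
    rw [prefixProd, braid_mul_dvd_mul_iff] at hlp
    have hr := ih hξ.shift (dvd_delta_of_mul_dvd hld) hlp
    by_cases hr1 : r = 1
    · subst hr1; simpa using hl.2.1
    -- A first letter `a` of the residue divides `ξ 1`, while `ξ 0 * a` is simple: the arrow forbids
    -- this.
    · obtain ⟨a, ha⟩ := exists_gen_dvd hr1
      exact absurd ((mul_dvd_mul_left _ ha).trans hld) (hξ 0 (ha.trans hr))

/-- The product of the `k` first terms of a path is the greatest product of `k` simple braids
that divides the products of the path. -/
theorem IsPath.dvd_prefixProd {ξ : ℕ → Simple κ n} (hξ : IsPath ξ) {k m : ℕ}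
    (hx : ProdSimple k x) (h : x ∣ prefixProd ξ m) : x ∣ prefixProd ξ k := by
  induction k generalizing ξ x m with
  | zero => cases hx; exact one_dvd _
  | succ k ih =>
    cases hx with
    | @mul _ s y hs hy =>
      have h' : s * y ∣ prefixProd ξ (m + 1) := h.trans (prefixProd_dvd ξ (by omega))
      obtain ⟨t, ht⟩ := hξ.dvd_zero hs ((dvd_mul_right _ _).trans h')
      rw [prefixProd, ht, mul_assoc, braid_mul_dvd_mul_iff] at h' ⊢
      -- Here `ξ 0 = s t`. The residue of `y` by `t` is again a product of `k` simple braids, and it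
      -- divides a product of the shifted path.
      obtain ⟨w, hw, hw'⟩ := hy.residue (t := t) (dvd_delta_of_mul_dvd (ht ▸ (ξ 0).2))
      have h1 := hw.2.2 _ (dvd_mul_right _ _) h'
      rw [braid_mul_dvd_mul_iff] at h1
      exact hw.2.1.trans (mul_dvd_mul_left t (ih hξ.shift hw' h1))

/-- Residues of a simple braid along a sequence of simple braids. -/
theorem exists_residue (ξ : ℕ → Simple κ n) (k : ℕ) {t : Braid κ n} (ht : t ∣ delta κ n) :
    ∃ r, IsLcm t (prefixProd ξ (k + 1)) (prefixProd ξ (k + 1) * r) ∧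
      (ξ k).1 * r ∣ delta κ n := by
  induction k generalizing ξ t with
  | zero =>
    obtain ⟨l, hl⟩ := exists_isLcm t (ξ 0).1
    have hld := hl.2.2 _ ht (ξ 0).2
    obtain ⟨r, rfl⟩ := hl.2.1
    exact ⟨r, by simpa [prefixProd] using hl, hld⟩
  | succ k ih =>
    obtain ⟨l, hl⟩ := exists_isLcm t (ξ 0).1
    have hld := hl.2.2 _ ht (ξ 0).2
    obtain ⟨r₁, rfl⟩ := hl.2.1
    obtain ⟨r, hr, hr'⟩ := ih (fun i => ξ (i + 1)) (dvd_delta_of_mul_dvd hld)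
    refine ⟨r, ⟨?_, dvd_mul_right _ _, fun z hz hz' => ?_⟩, hr'⟩
    · rw [prefixProd, mul_assoc]
      exact hl.1.trans (mul_dvd_mul_left _ hr.1)
    · rw [prefixProd_succ'] at hz' ⊢
      rw [mul_assoc]
      exact (hr.mul_left _).2.2 z (hl.2.2 z hz ((dvd_mul_right _ _).trans hz')) hz'

/-- Beginnings of paths are characterized by divisibility. -/
theorem IsPath.prefix_eq {ξ η : ℕ → Simple κ n} (hξ : IsPath ξ) (hη : IsPath η) {k m : ℕ}
    (h : prefixProd η (k + 1) ∣ prefixProd ξ m)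
    (hs : ∀ s : Gen κ n, (η k).1 * gen s ∣ delta κ n → ∀ m,
      ¬ prefixProd η (k + 1) * gen s ∣ prefixProd ξ m) :
    ∀ i ≤ k, ξ i = η i := by
  induction k generalizing ξ η m with
  | zero =>
    have h1 : (η 0).1 ∣ (ξ 0).1 :=
      hξ.dvd_zero (η 0).2 (by simpa [prefixProd] using h)
    obtain ⟨z, hz⟩ := h1
    have hz1 : z = 1 := by
      by_contra hz1
      obtain ⟨s, hs'⟩ := exists_gen_dvd hz1
      have h2 : (η 0).1 * gen s ∣ (ξ 0).1 := hz ▸ mul_dvd_mul_left _ hs'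
      exact hs s (h2.trans (ξ 0).2) 1 (by simpa [prefixProd] using h2)
    intro i hi
    obtain rfl : i = 0 := by omega
    exact Subtype.ext (by rw [hz, hz1, mul_one])
  | succ k ih =>
    have h0 : prefixProd η (k + 1 + 1) ∣ prefixProd ξ (m + 1) :=
      h.trans (prefixProd_dvd ξ (by omega))
    obtain ⟨t, ht⟩ := hξ.dvd_zero (η 0).2 ((dvd_mul_right _ _).trans h0)
    have htd : t ∣ delta κ n := dvd_delta_of_mul_dvd (ht ▸ (ξ 0).2)
    -- Otherwise `t` is pushed along the tail of `η`. A trivial residue would make `t` divide `η 1`,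
    -- against the arrow from `η 0`; a first letter of a nontrivial residue can be appended to the
    -- last factor, against `hs`.
    have ht1 : t = 1 := by
      by_contra ht1
      obtain ⟨r, hr, hr'⟩ := exists_residue (fun i => η (i + 1)) k htd
      have hr1 : r ≠ 1 := by
        rintro rfl
        rw [mul_one] at hr
        have h3 := hη.shift.dvd_zero htd hr.1
        obtain ⟨a, ha⟩ := exists_gen_dvd ht1
        exact hη 0 (ha.trans h3) ((mul_dvd_mul_left _ ha).trans (ht ▸ (ξ 0).2))
      obtain ⟨a, ha⟩ := exists_gen_dvd hr1
      refine hs a ((mul_dvd_mul_left _ ha).trans hr') (m + 1) ?_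
      rw [prefixProd_succ' η, prefixProd_succ' ξ, ht, mul_assoc, mul_assoc, braid_mul_dvd_mul_iff]
      refine (mul_dvd_mul_left _ ha).trans (hr.2.2 _ (dvd_mul_right _ _) ?_)
      rwa [prefixProd_succ' η, prefixProd_succ' ξ, ht, mul_assoc, braid_mul_dvd_mul_iff] at h0
    have e0 : ξ 0 = η 0 := Subtype.ext (by rw [ht, ht1, mul_one])
    have h1 : prefixProd (fun i => η (i + 1)) (k + 1) ∣ prefixProd (fun i => ξ (i + 1)) m := by
      rwa [prefixProd_succ' η, prefixProd_succ' ξ, e0, braid_mul_dvd_mul_iff] at h0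
    have := ih hξ.shift hη.shift h1 (fun s hs' m hm => hs s hs' (m + 1) (by
      rw [prefixProd_succ' η, prefixProd_succ' ξ, e0, mul_assoc, braid_mul_dvd_mul_iff]; exact hm))
    intro i hi
    cases i with
    | zero => exact e0
    | succ i => exact this i (by omega)

end

section

/-! ### Generalized braids and visual cylinders -/

variable {κ : Kind} {n : ℕ} {x y z : Braid κ n} {ξ η : GenBraid κ n}

/-- The product of the `k` first terms of a generalized braid. -/
def GenBraid.take (ξ : GenBraid κ n) (k : ℕ) : Braid κ n := prefixProd ξ.1 k

theorem GenBraid.isPath (ξ : GenBraid κ n) : IsPath ξ.1 := ξ.2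

theorem GenBraid.take_succ (ξ : GenBraid κ n) (k : ℕ) :
    ξ.take (k + 1) = ξ.take k * (ξ.1 k).1 := prefixProd_succ _ _

theorem GenBraid.take_dvd (ξ : GenBraid κ n) {k m : ℕ} (h : k ≤ m) : ξ.take k ∣ ξ.take m :=
  prefixProd_dvd _ h

/-- The finite braid `x` divides the generalized braid `ξ`. -/
def Below (x : Braid κ n) (ξ : GenBraid κ n) : Prop := ∃ k, x ∣ ξ.take k

/-- The stage at which divisibility is tested depends on `x` alone and not on `ξ`; this makes the
cylinders clopen. -/
theorem below_iff {k : ℕ} (h : ProdSimple k x) : Below x ξ ↔ x ∣ ξ.take k :=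
  ⟨fun ⟨_, hm⟩ => ξ.isPath.dvd_prefixProd h hm, fun h => ⟨k, h⟩⟩

theorem below_one (ξ : GenBraid κ n) : Below 1 ξ := ⟨0, one_dvd _⟩

theorem below_take (ξ : GenBraid κ n) (k : ℕ) : Below (ξ.take k) ξ := ⟨k, dvd_rfl⟩

theorem Below.of_dvd (h : Below y ξ) (hxy : x ∣ y) : Below x ξ :=
  h.imp fun _ h => hxy.trans h

theorem Below.lcm {l : Braid κ n} (hl : IsLcm x y l) : Below l ξ ↔ Below x ξ ∧ Below y ξ := by
  refine ⟨fun h => ⟨h.of_dvd hl.1, h.of_dvd hl.2.1⟩, ?_⟩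
  rintro ⟨⟨k, hk⟩, m, hm⟩
  exact ⟨max k m, hl.2.2 _ (hk.trans (ξ.take_dvd (le_max_left _ _)))
    (hm.trans (ξ.take_dvd (le_max_right _ _)))⟩

theorem Below.join {X : Finset (Gen κ n)} :
    Below (x * deltaOf X) ξ ↔ Below x ξ ∧ ∀ s ∈ X, Below (x * gen s) ξ := by
  constructor
  · exact fun h => ⟨h.of_dvd (dvd_mul_right _ _),
      fun s hs => h.of_dvd (mul_dvd_mul_left _ ((deltaOf_isJoin X).1 s hs))⟩
  · rintro ⟨⟨k, hk⟩, h⟩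
    choose! m hm using h
    obtain ⟨N, hN⟩ : ∃ N, k ≤ N ∧ ∀ s ∈ X, m s ≤ N :=
      ⟨max k (X.sup m), le_max_left _ _, fun s hs => (Finset.le_sup hs).trans (le_max_right _ _)⟩
    refine ⟨N, ?_⟩
    obtain ⟨z, hz⟩ := hk.trans (ξ.take_dvd hN.1)
    rw [hz, braid_mul_dvd_mul_iff, deltaOf_dvd_iff]
    intro s hs
    have := (hm s hs).trans (ξ.take_dvd (hN.2 s hs))
    rwa [hz, braid_mul_dvd_mul_iff] at this

theorem GenBraid.take_injective (h : ∀ k, ξ.take k = η.take k) : ξ = η := by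
  apply Subtype.ext
  funext k
  have := h (k + 1)
  rw [GenBraid.take_succ, GenBraid.take_succ, h k] at this
  exact Subtype.ext (mul_left_cancel this)

/-- The product of the `k` first terms is the greatest product of `k` simple braids below. -/
theorem take_eq_iff {k : ℕ} : ξ.take k = y ↔
    ProdSimple k y ∧ Below y ξ ∧ ∀ z, ProdSimple k z → Below z ξ → z ∣ y := by
  constructor
  · rintro rfl
    exact ⟨prodSimple_prefixProd _ _, below_take _ _, fun z hz h => (below_iff hz).1 h⟩
  · rintro ⟨h1, h2, h3⟩
    exact braid_dvd_antisymm (h3 _ (prodSimple_prefixProd _ _) (below_take _ _))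
      ((below_iff h1).1 h2)

theorem GenBraid.ext_below (h : ∀ x, Below x ξ ↔ Below x η) : ξ = η := by
  refine GenBraid.take_injective fun k => ?_
  rw [take_eq_iff]
  refine ⟨prodSimple_prefixProd _ _, (h _).2 (below_take _ _), fun z hz hb => ?_⟩
  exact (below_iff hz).1 ((h z).1 hb)

/-! ### Finite braids among generalized braids -/

/-- The generalized braid `ξ` is the finite braid `x`. -/
def IsFin (ξ : GenBraid κ n) (x : Braid κ n) : Prop := ∃ m, ∀ k, m ≤ k → ξ.take k = x

theorem IsFin.below_iff (h : IsFin ξ x) : Below y ξ ↔ y ∣ x := by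
  obtain ⟨m, hm⟩ := h
  constructor
  · rintro ⟨k, hk⟩
    rw [← hm (max k m) (le_max_right _ _)]
    exact hk.trans (ξ.take_dvd (le_max_left _ _))
  · intro h
    exact ⟨m, by rwa [hm m le_rfl]⟩

theorem IsFin.unique (h : IsFin ξ x) (h' : IsFin η x) : ξ = η :=
  GenBraid.ext_below fun _ => by rw [h.below_iff, h'.below_iff]

theorem exists_isGarsideForm (x : Braid κ n) : ∃ l, IsGarsideForm x l := by
  induction hN : len x using Nat.strong_induction_on generalizing x with
  | _ N ih =>
    subst hN
    by_cases hx : x = 1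
    · exact ⟨[], by simp [hx], trivial, by simp⟩
    obtain ⟨d, hd⟩ := exists_isMeet (delta κ n) x
    obtain ⟨s, hs⟩ := exists_gen_dvd hx
    have hsd := hd.2 _ (gen_dvd_delta s) hs
    have hd1 : d ≠ 1 := by
      rintro rfl
      have := len_le_of_dvd hsd
      rw [len_one, len_gen] at this; omega
    obtain ⟨y, rfl⟩ := hd.1.2
    obtain ⟨l, h1, h2, h3⟩ := ih (len y) (by have := len_pos hd1; rw [len_mul]; omega) y rfl
    refine ⟨d :: l, by rw [List.prod_cons, h1], ⟨by rw [h1]; exact hd, h2⟩, ?_⟩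
    intro z hz
    rcases List.mem_cons.1 hz with rfl | hz
    · exact hd1
    · exact h3 z hz

theorem IsNormal.getD_dvd {l : List (Braid κ n)} (h : IsNormal l) (k : ℕ) :
    l.getD k 1 ∣ delta κ n := by
  induction l generalizing k with
  | nil => simp
  | cons a l ih =>
    cases k with
    | zero => exact h.1.1.1
    | succ k => exact ih h.2 k

theorem IsNormal.arrow {l : List (Braid κ n)} (h : IsNormal l) (k : ℕ) :
    Arrow (⟨l.getD k 1, h.getD_dvd k⟩ : Simple κ n) ⟨l.getD (k + 1) 1, h.getD_dvd (k + 1)⟩ := by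
  induction l generalizing k with
  | nil => exact arrow_unit _
  | cons a l ih =>
    cases k with
    | succ k => exact ih h.2 k
    | zero =>
      intro s hs hc
      cases l with
      | nil => exact arrow_unit (⟨a, h.1.1.1⟩ : Simple κ n) hs hc
      | cons b l =>
        have h1 : gen s ∣ b := hs
        refine not_mul_gen_dvd a s (h.1.2 _ hc (mul_dvd_mul_left _ ?_))
        rw [List.prod_cons]
        exact h1.trans (dvd_mul_right _ _)

theorem prefixProd_getD {l : List (Braid κ n)} {ξ : ℕ → Simple κ n}
    (h : ∀ k, (ξ k).1 = l.getD k 1) {k : ℕ} (hk : l.length ≤ k) : prefixProd ξ k = l.prod := by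
  induction l generalizing ξ k with
  | nil =>
    clear hk
    induction k with
    | zero => rfl
    | succ k ih => rw [prefixProd_succ, ih, h k]; simp
  | cons a l ih =>
    obtain ⟨m, rfl⟩ : ∃ m, k = m + 1 := ⟨k - 1, by simp at hk; omega⟩
    rw [prefixProd_succ', ih (fun k => h (k + 1)) (by simpa using hk), h 0]
    simp

theorem isFin_ofBraid (x : Braid κ n) : IsFin (ofBraid x) x := by
  obtain ⟨l, hl⟩ := exists_isGarsideForm x
  obtain ⟨l', hl', h⟩ := Classical.epsilon_spec
    (p := fun ξ : GenBraid κ n => ∃ l, IsGarsideForm x l ∧ ∀ k, (ξ.1 k).1 = l.getD k 1)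
    ⟨⟨fun k => ⟨l.getD k 1, hl.2.1.getD_dvd k⟩, hl.2.1.arrow⟩, l, hl, fun _ => rfl⟩
  exact ⟨l'.length, fun k hk => (prefixProd_getD h hk).trans hl'.1⟩

theorem below_ofBraid : Below y (ofBraid x) ↔ y ∣ x := (isFin_ofBraid x).below_iff

theorem IsFin.eq_ofBraid (h : IsFin ξ x) : ξ = ofBraid x := h.unique (isFin_ofBraid x)

theorem ofBraid_injective : Function.Injective (ofBraid : Braid κ n → GenBraid κ n) := by
  intro x y h
  exact braid_dvd_antisymm (below_ofBraid.1 (h ▸ below_ofBraid.2 dvd_rfl))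
    (below_ofBraid.1 (h ▸ below_ofBraid.2 dvd_rfl))

/-- Every generator can be appended to the unit, so no generator may divide its successor. -/
theorem simple_eq_one_of_arrow {a b : Simple κ n} (h : Arrow a b) (ha : a.1 = 1) : b.1 = 1 := by
  by_contra hb
  obtain ⟨s, hs⟩ := exists_gen_dvd hb
  exact h hs (by rw [ha, one_mul]; exact gen_dvd_delta s)

theorem GenBraid.eq_one_of_le {k m : ℕ} (hk : (ξ.1 k).1 = 1) (hm : k ≤ m) : (ξ.1 m).1 = 1 := by
  induction m, hm using Nat.le_induction with
  | base => exact hk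
  | succ m _ ih => exact simple_eq_one_of_arrow (ξ.2 m) ih

theorem isFin_of_eq_one {k : ℕ} (hk : (ξ.1 k).1 = 1) : IsFin ξ (ξ.take k) := by
  refine ⟨k, fun m hm => ?_⟩
  induction m, hm using Nat.le_induction with
  | base => rfl
  | succ m hm ih => rw [GenBraid.take_succ, GenBraid.eq_one_of_le hk hm, mul_one, ih]

theorem mem_boundary_iff : ξ ∈ boundary κ n ↔ ∀ k, (ξ.1 k).1 ≠ 1 := by
  constructor
  · intro h k hk
    exact h ⟨_, (isFin_of_eq_one hk).eq_ofBraid.symm⟩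
  · rintro h ⟨x, rfl⟩
    obtain ⟨m, hm⟩ := isFin_ofBraid x
    apply h m
    have := hm (m + 1) (by omega)
    rw [GenBraid.take_succ, hm m le_rfl] at this
    exact mul_left_cancel (a := x) (by rw [this, mul_one])

/-- The truncation of a generalized braid at its `k` first terms. -/
def GenBraid.trunc (ξ : GenBraid κ n) (k : ℕ) : GenBraid κ n :=
  ⟨fun i => if i < k then ξ.1 i else Simple.unit, fun i => by
    by_cases h : i + 1 < k
    · simp only [h, if_true, show i < k by omega]; exact ξ.2 i
    · simp only [h, if_false]; exact arrow_unit _⟩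

theorem GenBraid.trunc_eq (ξ : GenBraid κ n) (k : ℕ) : ξ.trunc k = ofBraid (ξ.take k) := by
  have h1 : ((ξ.trunc k).1 k).1 = 1 := by simp [GenBraid.trunc, Simple.unit]
  have h2 : (ξ.trunc k).take k = ξ.take k :=
    prefixProd_congr fun i hi => by simp [GenBraid.trunc, hi]
  rw [← h2]; exact (isFin_of_eq_one h1).eq_ofBraid

/-! ### Topology -/

theorem isInducing_coe : Topology.IsInducing (fun ξ : GenBraid κ n => ξ.1) := ⟨rfl⟩

theorem continuous_coord (k : ℕ) : Continuous fun ξ : GenBraid κ n => ξ.1 k :=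
  (continuous_apply k).comp isInducing_coe.continuous

theorem isClopen_take (k : ℕ) (S : Set (Braid κ n)) : IsClopen {ξ : GenBraid κ n | ξ.take k ∈ S} := by
  let : TopologicalSpace (Braid κ n) := ⊥
  have : DiscreteTopology (Braid κ n) := ⟨rfl⟩
  have : Continuous fun ξ : GenBraid κ n => ξ.take k := by
    induction k with
    | zero => exact continuous_const
    | succ k ih =>
      have h : Continuous fun p : Braid κ n × Simple κ n => p.1 * p.2.1 :=
        continuous_of_discreteTopology
      have := h.comp (ih.prodMk (continuous_coord k))
      convert this using 2 with ξ
      exact ξ.take_succ k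
  exact (isClopen_discrete S).preimage this

theorem isClopen_below (x : Braid κ n) : IsClopen {ξ : GenBraid κ n | Below x ξ} := by
  have : {ξ : GenBraid κ n | Below x ξ} = {ξ | ξ.take (len x) ∈ {y | x ∣ y}} := by
    ext ξ; exact below_iff (ProdSimple.of_len x)
  rw [this]; exact isClopen_take _ _

theorem tendsto_trunc (ξ : GenBraid κ n) :
    Filter.Tendsto (fun k => ξ.trunc k) Filter.atTop (nhds ξ) := by
  rw [isInducing_coe.tendsto_nhds_iff, tendsto_pi_nhds]
  intro i
  refine tendsto_const_nhds.congr' ?_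
  filter_upwards [Filter.eventually_gt_atTop i] with k hk
  exact (if_pos hk).symm

/-- The truncations of `ξ` are finite braids converging to `ξ`, and they are eventually multiples of
`x`. Conversely, divisibility by `x` is a closed condition. -/
theorem mem_fullCylinder : ξ ∈ fullCylinder x ↔ Below x ξ := by
  constructor
  · intro h
    refine closure_minimal ?_ (isClopen_below x).isClosed h
    rintro _ ⟨z, rfl⟩
    exact below_ofBraid.2 (dvd_mul_right _ _)
  · rintro ⟨k, hk⟩
    refine mem_closure_of_tendsto (tendsto_trunc ξ) ?_
    filter_upwards [Filter.eventually_ge_atTop k] with m hm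
    obtain ⟨z, hz⟩ := hk.trans (ξ.take_dvd hm)
    exact ⟨z, by rw [GenBraid.trunc_eq, hz]⟩

theorem isClopen_fullCylinder (x : Braid κ n) : IsClopen (fullCylinder x) := by
  have : fullCylinder x = {ξ : GenBraid κ n | Below x ξ} := Set.ext fun ξ => mem_fullCylinder
  rw [this]; exact isClopen_below x

theorem measurableSet_fullCylinder (x : Braid κ n) : MeasurableSet (fullCylinder x) :=
  (isClopen_fullCylinder x).2.measurableSet

theorem fullCylinder_inter {l : Braid κ n} (hl : IsLcm x y l) :
    fullCylinder x ∩ fullCylinder y = fullCylinder l := by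
  ext ξ
  rw [Set.mem_inter_iff, mem_fullCylinder, mem_fullCylinder, mem_fullCylinder, Below.lcm hl]

theorem fullCylinder_one : fullCylinder (1 : Braid κ n) = Set.univ :=
  Set.eq_univ_of_forall fun ξ => mem_fullCylinder.2 (below_one ξ)

theorem singleton_ofBraid_eq (x : Braid κ n) :
    {ofBraid x} = {ξ | Below x ξ ∧ ∀ s ∈ Finset.univ, ¬ Below (x * gen s) ξ} := by
  ext ξ
  constructor
  · rintro rfl
    exact ⟨below_ofBraid.2 dvd_rfl, fun s _ h => not_mul_gen_dvd x s (below_ofBraid.1 h)⟩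
  · rintro ⟨⟨m, hm⟩, h⟩
    refine IsFin.eq_ofBraid ⟨m, fun k hk => ?_⟩
    obtain ⟨z, hz⟩ := hm.trans (ξ.take_dvd hk)
    by_cases hz1 : z = 1
    · rw [hz, hz1, mul_one]
    · obtain ⟨s, hs⟩ := exists_gen_dvd hz1
      exact absurd ⟨k, hz ▸ mul_dvd_mul_left x hs⟩ (h s (Finset.mem_univ s))

/-- The set of generators that can be appended to a simple braid within the simple braids. -/
def follow (a : Braid κ n) : Finset (Gen κ n) :=
  have := Classical.decPred fun s : Gen κ n => a * gen s ∣ delta κ n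
  Finset.univ.filter fun s => a * gen s ∣ delta κ n

theorem mem_follow {a : Braid κ n} {s : Gen κ n} : s ∈ follow a ↔ a * gen s ∣ delta κ n := by
  simp [follow]

/-- Let `Δ = a z`. If every generator could follow `a`, all of them would divide `z`, so `Δ` would
divide the strictly shorter braid `z`. -/
theorem exists_notMem_follow {a : Simple κ n} (ha : a.1 ≠ 1) : ∃ s, s ∉ follow a.1 := by
  by_contra hc
  push Not at hc
  obtain ⟨z, hz⟩ := a.2
  have : delta κ n ∣ z := by
    refine delta_isJoin.2 z fun s _ => ?_
    exact braid_mul_dvd_mul_iff.1 ((mem_follow.1 (hc s)).trans hz.dvd)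
  have h1 := len_le_of_dvd this
  have h2 := congrArg len hz
  have h3 := len_pos ha
  rw [len_mul] at h2; omega

/-- Beginnings of generalized braids are differences of visual cylinders. -/
theorem take_eq_take_iff (ξ η : GenBraid κ n) (k : ℕ) : ξ.take (k + 1) = η.take (k + 1) ↔
    Below (η.take (k + 1)) ξ ∧
      ∀ s ∈ follow (η.1 k).1, ¬ Below (η.take (k + 1) * gen s) ξ := by
  constructor
  · intro h
    refine ⟨h ▸ below_take _ _, fun s hs hb => ?_⟩
    have hp : ProdSimple (k + 1) (η.take (k + 1) * gen s) := by
      have key : ∀ (k : ℕ) (ζ : ℕ → Simple κ n), (ζ k).1 * gen s ∣ delta κ n →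
          ProdSimple (k + 1) (prefixProd ζ (k + 1) * gen s) := by
        intro k
        induction k with
        | zero =>
          intro ζ hζ
          have := ProdSimple.mul hζ ProdSimple.one
          simpa [prefixProd] using this
        | succ k ih =>
          intro ζ hζ
          rw [prefixProd_succ', mul_assoc]
          exact .mul (ζ 0).2 (ih _ hζ)
      exact key k η.1 (mem_follow.1 hs)
    have := (below_iff hp).1 hb
    rw [h] at this
    exact not_mul_gen_dvd _ _ this
  · rintro ⟨⟨m, hm⟩, h⟩
    have := ξ.isPath.prefix_eq η.isPath hm fun s hs m hm' => h s (mem_follow.2 hs) ⟨m, hm'⟩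
    exact prefixProd_congr fun i hi => this i (by omega)

instance : CompactSpace (GenBraid κ n) := by
  have hc : IsClosed {ξ : ℕ → Simple κ n | ∀ k, Arrow (ξ k) (ξ (k + 1))} := by
    rw [Set.ofPred_forall]
    refine isClosed_iInter fun k => ?_
    have hcont : Continuous fun ξ : ℕ → Simple κ n => (ξ k, ξ (k + 1)) := by fun_prop
    exact (isClosed_discrete {p : Simple κ n × Simple κ n | Arrow p.1 p.2}).preimage hcont
  exact isCompact_iff_compactSpace.1 hc.isCompact

instance : T2Space (GenBraid κ n) :=
  inferInstanceAs (T2Space {ξ : ℕ → Simple κ n // ∀ k, Arrow (ξ k) (ξ (k + 1))})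

instance : SecondCountableTopology (GenBraid κ n) :=
  have : Countable (Simple κ n) := Finite.to_countable
  isInducing_coe.secondCountableTopology

/-- The cylinders form a basis of neighbourhoods. -/
theorem exists_take_subset {U : Set (GenBraid κ n)} (hU : U ∈ nhds ξ) :
    ∃ k, ∀ η : GenBraid κ n, η.take (k + 1) = ξ.take (k + 1) → η ∈ U := by
  rw [isInducing_coe.nhds_eq_comap, Filter.mem_comap] at hU
  obtain ⟨V, hV, hVU⟩ := hU
  rw [nhds_pi, Filter.mem_pi] at hV
  obtain ⟨I, hI, t, ht, htV⟩ := hV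
  obtain ⟨k, hk⟩ := hI.bddAbove
  refine ⟨k, fun η hη => hVU (htV fun i hi => ?_)⟩
  have h1 : ∀ m, m ≤ k + 1 → η.take m = ξ.take m := by
    intro m hm
    -- The product of `k + 1` factors determines the shorter ones, through the truncated sequence.
    have h1 : ∀ ζ : GenBraid κ n, ζ.take m = (ofBraid (ζ.take (k + 1))).take m := by
      intro ζ
      rw [← GenBraid.trunc_eq]
      exact prefixProd_congr fun i hi => (if_pos (by omega)).symm
    rw [h1 η, h1 ξ, hη]
  have hik : i ≤ k := hk hi
  have h2 := h1 (i + 1) (by omega)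
  rw [GenBraid.take_succ, GenBraid.take_succ, h1 i (by omega)] at h2
  have h3 : η.1 i = ξ.1 i := Subtype.ext (mul_left_cancel h2)
  change η.1 i ∈ t i
  rw [h3]
  exact mem_of_mem_nhds (ht i)

end

section

/-! ### Uniform measures: inclusion-exclusion and uniqueness -/

variable {κ : Kind} {n : ℕ} {x y z : Braid κ n} {ξ η : GenBraid κ n}
  {ν ν' : Measure (GenBraid κ n)} {p : ℝ}

/-- The Möbius polynomial of a set of generators. -/
def mob (K : Finset (Gen κ n)) (t : ℝ) : ℝ :=
  ∑ X ∈ K.powerset, (-1 : ℝ) ^ X.card * t ^ len (deltaOf X)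

theorem mob_univ (t : ℝ) : mob (Finset.univ : Finset (Gen κ n)) t = moebius κ n t := by
  simp [mob, moebius]

theorem mob_empty (t : ℝ) : mob (∅ : Finset (Gen κ n)) t = 1 := by
  simp [mob, deltaOf_empty, len_one]

/-- The generalized braids above `x` that are above `x * s` for no `s` in `K`. -/
def gap (x : Braid κ n) (K : Finset (Gen κ n)) : Set (GenBraid κ n) :=
  {ξ | Below x ξ ∧ ∀ s ∈ K, ¬ Below (x * gen s) ξ}

theorem measurableSet_below (x : Braid κ n) : MeasurableSet {ξ : GenBraid κ n | Below x ξ} :=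
  (isClopen_below x).2.measurableSet

theorem setOf_below (x : Braid κ n) : {ξ : GenBraid κ n | Below x ξ} = fullCylinder x :=
  Set.ext fun _ => mem_fullCylinder.symm

theorem measurableSet_gap (x : Braid κ n) (K : Finset (Gen κ n)) : MeasurableSet (gap x K) := by
  have : gap x K = {ξ | Below x ξ} ∩ ⋂ s ∈ K, {ξ | Below (x * gen s) ξ}ᶜ := by
    ext; simp [gap]
  rw [this]
  exact (measurableSet_below x).inter
    (Finset.measurableSet_biInter _ fun s _ => (measurableSet_below _).compl)

theorem IsUniform.real_below (h : IsUniform ν p) (x : Braid κ n) :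
    ν.real {ξ | Below x ξ} = p ^ len x := by
  rw [setOf_below]; exact h.real_fullCylinder x

/-- The set `Y` of generators forced to lie below makes the induction on `K` close: excluding one
more generator `a` subtracts the same quantity with `a` added to `Y`. -/
theorem IsUniform.real_gap_aux [DecidableEq (Gen κ n)] (h : IsUniform ν p) (x : Braid κ n)
    (K Y : Finset (Gen κ n)) :
    ν.real ({ξ | Below (x * deltaOf Y) ξ} ∩ gap x K) =
      p ^ len x * ∑ X ∈ K.powerset, (-1 : ℝ) ^ X.card * p ^ len (deltaOf (X ∪ Y)) := by
  have := h.isProbabilityMeasure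
  induction K using Finset.induction_on generalizing Y with
  | empty =>
    have e : {ξ : GenBraid κ n | Below (x * deltaOf Y) ξ} ∩ gap x ∅ =
        {ξ | Below (x * deltaOf Y) ξ} :=
      Set.inter_eq_left.2 fun ξ hξ => ⟨Below.of_dvd hξ (dvd_mul_right _ _), by simp⟩
    rw [e, h.real_below]
    simp [len_mul, pow_add]
  | insert a K ha ih =>
    have e1 : {ξ : GenBraid κ n | Below (x * deltaOf Y) ξ} ∩ gap x (insert a K) =
        ({ξ | Below (x * deltaOf Y) ξ} ∩ gap x K) \
          ({ξ | Below (x * deltaOf (insert a Y)) ξ} ∩ gap x K) := by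
      ext ξ
      simp only [gap, Set.mem_inter_iff, Set.mem_sdiff, Set.mem_ofPred_eq, Finset.forall_mem_insert,
        Below.join]
      tauto
    have e2 : {ξ : GenBraid κ n | Below (x * deltaOf (insert a Y)) ξ} ∩ gap x K ⊆
        {ξ | Below (x * deltaOf Y) ξ} ∩ gap x K := by
      refine Set.inter_subset_inter_left _ fun ξ hξ => ?_
      simp only [Set.mem_ofPred_eq, Finset.forall_mem_insert, Below.join] at hξ ⊢
      exact ⟨hξ.1, hξ.2.2⟩
    rw [e1, measureReal_sdiff e2 ((measurableSet_below _).inter (measurableSet_gap _ _)), ih, ih,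
      Finset.sum_powerset_insert ha, ← mul_sub, sub_eq_add_neg, ← Finset.sum_neg_distrib]
    congr 2
    refine Finset.sum_congr rfl fun X hX => ?_
    have haX : a ∉ X := fun h => ha (Finset.mem_powerset.1 hX h)
    rw [Finset.card_insert_of_notMem haX, Finset.insert_union, Finset.union_insert, pow_succ]
    ring

theorem IsUniform.real_gap (h : IsUniform ν p) (x : Braid κ n) (K : Finset (Gen κ n)) :
    ν.real (gap x K) = p ^ len x * mob K p := by
  classical
  have := h.real_gap_aux x K ∅
  rw [deltaOf_empty, mul_one] at this
  rw [Set.inter_eq_right.2 fun ξ hξ => hξ.1] at this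
  simpa [mob] using this

theorem IsUniform.mob_eq (h : IsUniform ν p) (K : Finset (Gen κ n)) :
    mob K p = ν.real (gap 1 K) := by
  rw [h.real_gap, len_one]; simp

theorem IsUniform.mob_nonneg (h : IsUniform ν p) (K : Finset (Gen κ n)) : 0 ≤ mob K p :=
  h.mob_eq K ▸ measureReal_nonneg

theorem IsUniform.mob_le_one (h : IsUniform ν p) (K : Finset (Gen κ n)) : mob K p ≤ 1 :=
  have := h.isProbabilityMeasure
  h.mob_eq K ▸ measureReal_le_one

/-- Comparison of Möbius polynomials when, above `x`, every generator in `K` forces some `x * s`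
with `s` in `K'`. -/
theorem IsUniform.mob_ge (h : IsUniform ν p) (x : Braid κ n) {K K' : Finset (Gen κ n)}
    (hK : ∀ k ∈ K, ∃ s ∈ K', ∀ m, x ∣ m → gen k ∣ m → x * gen s ∣ m) :
    p ^ len x * mob K' p ≤ mob K p := by
  have := h.isProbabilityMeasure
  rw [← h.real_gap, h.mob_eq]
  refine measureReal_mono fun ξ hξ => ⟨below_one ξ, fun k hk hb => ?_⟩
  obtain ⟨s, hs, hs'⟩ := hK k hk
  obtain ⟨⟨i, hi⟩, h2⟩ := hξ
  obtain ⟨j, hj⟩ := hb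
  rw [one_mul] at hj
  exact h2 s hs ⟨max i j, hs' _ (hi.trans (ξ.take_dvd (le_max_left _ _)))
    (hj.trans (ξ.take_dvd (le_max_right _ _)))⟩

theorem IsUniform.mob_antitone (h : IsUniform ν p) {K K' : Finset (Gen κ n)} (hK : K ⊆ K') :
    mob K' p ≤ mob K p := by
  have := h.mob_ge 1 (K := K) (K' := K') fun k hk => ⟨k, hK hk, fun m _ hm => by rwa [one_mul]⟩
  simpa [len_one] using this

/-- Split the braids avoiding `K` according to `e`. Those above `e` are above no `e s` with `s ∈ K`,
because `s` divides `e s`, so their mass is at most `p * mob K p`. -/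
theorem IsUniform.mob_insert_ge [DecidableEq (Gen κ n)] (h : IsUniform ν p) (e : Gen κ n)
    {K : Finset (Gen κ n)} (hK : ∀ s ∈ K, gen s ∣ gen e * gen s) :
    (1 - p) * mob K p ≤ mob (insert e K) p := by
  have := h.isProbabilityMeasure
  have e1 : gap 1 K ⊆ gap 1 (insert e K) ∪ gap (gen e) K := by
    rintro ξ ⟨h1, h2⟩
    by_cases he : Below (gen e) ξ
    · exact .inr ⟨he, fun s hs hb => h2 s hs (by rw [one_mul]; exact hb.of_dvd (hK s hs))⟩
    · refine .inl ⟨h1, fun s hs => ?_⟩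
      rcases Finset.mem_insert.1 hs with rfl | hs
      · rwa [one_mul]
      · exact h2 s hs
  have e2 := (measureReal_mono (μ := ν) e1).trans (measureReal_union_le _ _)
  rw [h.real_gap (gen e), ← h.mob_eq, ← h.mob_eq, len_gen] at e2
  linarith

theorem IsUniform.real_singleton (h : IsUniform ν p) (x : Braid κ n) :
    ν.real {ofBraid x} = moebius κ n p * p ^ len x := by
  rw [singleton_ofBraid_eq, ← mob_univ, mul_comm]; exact h.real_gap x Finset.univ

theorem IsUniform.real_take (h : IsUniform ν p) (η : GenBraid κ n) (k : ℕ) :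
    ν.real {ξ | ξ.take (k + 1) = η.take (k + 1)} =
      p ^ len (η.take (k + 1)) * mob (follow (η.1 k).1) p := by
  rw [← h.real_gap]
  congr 1
  ext ξ
  exact take_eq_take_iff ξ η k

/-! ### Uniqueness and the two Dirac measures -/

theorem isPiSystem_fullCylinder : IsPiSystem (Set.range (fullCylinder (κ := κ) (n := n))) := by
  rintro _ ⟨x, rfl⟩ _ ⟨y, rfl⟩ -
  obtain ⟨l, hl⟩ := exists_isLcm x y
  exact ⟨l, (fullCylinder_inter hl).symm⟩

/-- By `take_eq_iff`, fixing a prefix is a countable combination of divisibility conditions; an open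
set is a union of prefix sets, of which there are countably many. -/
theorem borel_eq_generateFrom_fullCylinder :
    borel (GenBraid κ n) =
      MeasurableSpace.generateFrom (Set.range (fullCylinder (κ := κ) (n := n))) := by
  apply le_antisymm
  · refine MeasurableSpace.generateFrom_le fun U hU => ?_
    let _ : MeasurableSpace (GenBraid κ n) :=
      MeasurableSpace.generateFrom (Set.range (fullCylinder (κ := κ) (n := n)))
    have hb : ∀ x : Braid κ n, MeasurableSet {ξ : GenBraid κ n | Below x ξ} := fun x => by
      rw [setOf_below]; exact MeasurableSpace.measurableSet_generateFrom ⟨x, rfl⟩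
    have ht : ∀ k (y : Braid κ n), MeasurableSet {ξ : GenBraid κ n | ξ.take k = y} := by
      intro k y
      simp only [take_eq_iff, Set.ofPred_and, Set.ofPred_forall]
      refine (MeasurableSet.const _).inter ((hb y).inter ?_)
      refine MeasurableSet.iInter fun z => MeasurableSet.iInter fun _ => ?_
      exact (hb z).imp (MeasurableSet.const _)
    have e : U = ⋃ k : ℕ, ⋃ y : Braid κ n,
        ⋃ _ : {ξ : GenBraid κ n | ξ.take (k + 1) = y} ⊆ U, {ξ | ξ.take (k + 1) = y} := by
      ext ξ
      simp only [Set.mem_iUnion, exists_prop]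
      constructor
      · intro hξ
        obtain ⟨k, hk⟩ := exists_take_subset (IsOpen.mem_nhds hU hξ)
        exact ⟨k, _, hk, rfl⟩
      · rintro ⟨k, y, h1, h2⟩
        exact h1 h2
    rw [e]
    exact MeasurableSet.iUnion fun k => MeasurableSet.iUnion fun y =>
      MeasurableSet.iUnion fun _ => ht _ _
  · refine MeasurableSpace.generateFrom_le ?_
    rintro _ ⟨x, rfl⟩
    exact measurableSet_fullCylinder x

theorem IsUniform.unique (h : IsUniform ν p) (h' : IsUniform ν' p) : ν = ν' := by
  have := h.isProbabilityMeasure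
  have := h'.isProbabilityMeasure
  refine ext_of_generate_finite _ borel_eq_generateFrom_fullCylinder isPiSystem_fullCylinder ?_
    (by simp)
  rintro _ ⟨x, rfl⟩
  exact (measureReal_eq_measureReal_iff).1
    ((h.real_fullCylinder x).trans (h'.real_fullCylinder x).symm)

theorem isUniform_dirac_one : IsUniform (Measure.dirac (ofBraid (1 : Braid κ n))) 0 := by
  refine ⟨inferInstance, le_rfl, fun x => ?_⟩
  rw [measureReal_def, Measure.dirac_apply' _ (measurableSet_fullCylinder x)]
  by_cases hx : x = 1
  · subst hx
    simp [fullCylinder_one, len_one]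
  · have : ofBraid (1 : Braid κ n) ∉ fullCylinder x := by
      rw [mem_fullCylinder, below_ofBraid]
      intro h
      have := len_le_of_dvd h
      have := len_pos hx
      rw [len_one] at *; omega
    simp [this, (len_pos hx).ne']

theorem take_deltaInf (k : ℕ) : (deltaInf κ n).take k = delta κ n ^ k := by
  induction k with
  | zero => rw [pow_zero]; rfl
  | succ k ih => rw [GenBraid.take_succ, ih, pow_succ]; rfl

theorem isUniform_dirac_deltaInf : IsUniform (Measure.dirac (deltaInf κ n)) 1 := by
  refine ⟨inferInstance, zero_le_one, fun x => ?_⟩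
  rw [measureReal_def, Measure.dirac_apply' _ (measurableSet_fullCylinder x)]
  have : deltaInf κ n ∈ fullCylinder x :=
    mem_fullCylinder.2 ⟨len x, by rw [take_deltaInf]; exact dvd_delta_pow_len x⟩
  simp [this]

end

section

/-! ### The growth series and uniform measures -/

variable {κ : Kind} {n : ℕ} {x y z : Braid κ n} {ξ η : GenBraid κ n}
  {ν ν' : Measure (GenBraid κ n)} {p t : ℝ}

/-- The uniform weight on finite braids, normalized by the value of the growth series. -/
def gibbs (κ : Kind) (n : ℕ) (t : ℝ) : Measure (GenBraid κ n) :=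
  (∑' x : Braid κ n, ENNReal.ofReal (t ^ len x))⁻¹ •
    Measure.sum fun x : Braid κ n => ENNReal.ofReal (t ^ len x) • Measure.dirac (ofBraid x)

/-- By left cancellation `z ↦ x z` is a bijection onto the multiples of `x`, so the weight of the
cylinder is `t ^ |x|` times the full sum. -/
theorem gibbs_fullCylinder (ht : 0 ≤ t) (hs : Summable fun x : Braid κ n => t ^ len x)
    (x : Braid κ n) : gibbs κ n t (fullCylinder x) = ENNReal.ofReal (t ^ len x) := by
  set G := ∑' x : Braid κ n, ENNReal.ofReal (t ^ len x) with hG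
  have hG1 : G ≠ ⊤ := hs.tsum_ofReal_ne_top
  have hG0 : G ≠ 0 := by
    intro h
    have := ENNReal.tsum_eq_zero.1 h 1
    simp [len_one] at this
  have e : ∑' y : Braid κ n, ENNReal.ofReal (t ^ len y) *
      Set.indicator (fullCylinder x) (1 : GenBraid κ n → ENNReal) (ofBraid y) =
        ENNReal.ofReal (t ^ len x) * G := by
    have hinj : Function.Injective fun z : Braid κ n => x * z := fun _ _ h => mul_left_cancel h
    rw [← hinj.tsum_eq, hG, ← ENNReal.tsum_mul_left]
    · refine tsum_congr fun z => ?_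
      have : ofBraid (x * z) ∈ fullCylinder x :=
        mem_fullCylinder.2 (below_ofBraid.2 (dvd_mul_right _ _))
      rw [Set.indicator_of_mem this, len_mul, pow_add, ENNReal.ofReal_mul (by positivity)]
      simp
    · intro y hy
      by_contra hc
      apply hy
      have : ofBraid y ∉ fullCylinder x := by
        rw [mem_fullCylinder, below_ofBraid]
        rintro ⟨z, rfl⟩
        exact hc ⟨z, rfl⟩
      simp only [Set.indicator_of_notMem this, mul_zero]
  rw [gibbs, Measure.smul_apply, Measure.sum_apply _ (measurableSet_fullCylinder x)]
  simp only [Measure.smul_apply, Measure.dirac_apply' _ (measurableSet_fullCylinder x), smul_eq_mul]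
  rw [e, mul_comm, mul_assoc, ENNReal.mul_inv_cancel hG0 hG1, mul_one]

theorem isUniform_gibbs (ht : 0 ≤ t) (hs : Summable fun x : Braid κ n => t ^ len x) :
    IsUniform (gibbs κ n t) t := by
  refine ⟨⟨?_⟩, ht, fun x => ?_⟩
  · rw [← fullCylinder_one, gibbs_fullCylinder ht hs]; simp [len_one]
  · rw [measureReal_def, gibbs_fullCylinder ht hs, ENNReal.toReal_ofReal (by positivity)]

/-! ### The mass of finite braids -/

theorem measurableSet_singleton_ofBraid (x : Braid κ n) : MeasurableSet {ofBraid x} := by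
  rw [singleton_ofBraid_eq]; exact measurableSet_gap x Finset.univ

theorem countable_finiteBraids : (finiteBraids κ n).Countable := Set.countable_range _

theorem measurableSet_finiteBraids : MeasurableSet (finiteBraids κ n) :=
  countable_finiteBraids.measurableSet

/-- The mass of a set of finite braids is the sum of the masses of its points. -/
theorem measure_inter_finiteBraids (ν : Measure (GenBraid κ n)) (A : Set (GenBraid κ n)) :
    ν (A ∩ finiteBraids κ n) = ∑' x : {x : Braid κ n // ofBraid x ∈ A}, ν {ofBraid x.1} := by
  have : A ∩ finiteBraids κ n = ⋃ x : {x : Braid κ n // ofBraid x ∈ A}, {ofBraid x.1} := by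
    ext ξ
    simp only [Set.mem_inter_iff, finiteBraids, Set.mem_range, Set.mem_iUnion,
      Set.mem_singleton_iff, Subtype.exists, exists_prop]
    constructor
    · rintro ⟨h, x, rfl⟩; exact ⟨x, h, rfl⟩
    · rintro ⟨x, h, rfl⟩; exact ⟨h, x, rfl⟩
  rw [this]
  refine measure_iUnion (fun x y hxy => ?_) fun x => measurableSet_singleton_ofBraid x.1
  simp only [Function.onFun, Set.disjoint_singleton]
  exact fun h => hxy (Subtype.ext (ofBraid_injective h))

theorem measure_finiteBraids (ν : Measure (GenBraid κ n)) :
    ν (finiteBraids κ n) = ∑' x : Braid κ n, ν {ofBraid x} := by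
  have := measure_inter_finiteBraids ν Set.univ
  rw [Set.univ_inter] at this
  rw [this]
  exact (Equiv.subtypeUnivEquiv fun x : Braid κ n => Set.mem_univ (ofBraid x)).tsum_eq
    fun x => ν {ofBraid x}

theorem ext_of_finiteBraids (h : ν (finiteBraids κ n)ᶜ = 0) (h' : ν' (finiteBraids κ n)ᶜ = 0)
    (hx : ∀ x, ν {ofBraid x} = ν' {ofBraid x}) : ν = ν' := by
  ext A _
  rw [← measure_inter_add_sdiff A measurableSet_finiteBraids,
    ← measure_inter_add_sdiff (μ := ν') A measurableSet_finiteBraids,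
    measure_mono_null (Set.sdiff_subset_compl A _) h,
    measure_mono_null (Set.sdiff_subset_compl A _) h',
    measure_inter_finiteBraids, measure_inter_finiteBraids]
  simp only [hx]

/-- The masses of the finite braids, in terms of the growth series. -/
theorem measure_finiteBraids_of_real [IsFiniteMeasure ν] {c : ℝ} (hc : 0 ≤ c)
    (h : ∀ x : Braid κ n, ν.real {ofBraid x} = c * p ^ len x) :
    ν (finiteBraids κ n) = ENNReal.ofReal c * ∑' x : Braid κ n, ENNReal.ofReal (p ^ len x) := by
  rw [measure_finiteBraids, ← ENNReal.tsum_mul_left]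
  refine tsum_congr fun x => ?_
  rw [← ENNReal.ofReal_mul hc, ← h, ofReal_measureReal]

theorem gibbs_compl_finiteBraids : gibbs κ n t (finiteBraids κ n)ᶜ = 0 := by
  rw [gibbs, Measure.smul_apply, Measure.sum_apply _ measurableSet_finiteBraids.compl]
  simp [finiteBraids]

theorem IsUniform.moebius_nonneg (h : IsUniform ν p) : 0 ≤ moebius κ n p :=
  mob_univ (κ := κ) (n := n) p ▸ h.mob_nonneg _

/-- The normalized weights are uniform, so inclusion–exclusion evaluates their atoms as `H(t) t ^
|x|`; these sum to one because the measure is carried by finite braids. -/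
theorem moebius_mul_tsum (ht : 0 ≤ t) (hs : Summable fun x : Braid κ n => t ^ len x) :
    ENNReal.ofReal (moebius κ n t) * ∑' x : Braid κ n, ENNReal.ofReal (t ^ len x) = 1 := by
  have hu := isUniform_gibbs ht hs
  have := hu.isProbabilityMeasure
  rw [← measure_finiteBraids_of_real hu.moebius_nonneg hu.real_singleton,
    ← prob_compl_eq_zero_iff measurableSet_finiteBraids]
  exact gibbs_compl_finiteBraids

/-- Otherwise the atoms `H(p) p ^ |x|` would have infinite total mass. -/
theorem IsUniform.moebius_eq_zero (h : IsUniform ν p)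
    (hs : ¬ Summable fun x : Braid κ n => p ^ len x) : moebius κ n p = 0 := by
  have := h.isProbabilityMeasure
  by_contra hc
  have hpos := lt_of_le_of_ne h.moebius_nonneg (Ne.symm hc)
  apply hs
  have h1 := measure_finiteBraids_of_real h.moebius_nonneg h.real_singleton
  have h2 : ∑' x : Braid κ n, ENNReal.ofReal (p ^ len x) ≠ ⊤ := by
    intro e
    rw [e, ENNReal.mul_top (by simpa using hpos)] at h1
    exact measure_ne_top _ _ h1
  have h3 := ENNReal.summable_toReal h2
  refine h3.congr fun x => ?_
  rw [ENNReal.toReal_ofReal (pow_nonneg h.nonneg _)]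

theorem IsUniform.le_one (h : IsUniform ν p) (s : Gen κ n) : p ≤ 1 := by
  have := h.isProbabilityMeasure
  have h1 := h.real_fullCylinder (gen s)
  rw [len_gen, pow_one] at h1
  exact h1 ▸ measureReal_le_one

/-- Weak limits of uniform measures are uniform. -/
theorem exists_isUniform_of_tendsto {u : ℕ → ℝ} (hu : Filter.Tendsto u Filter.atTop (nhds p))
    (h : ∀ k, ∃ ν : Measure (GenBraid κ n), IsUniform ν (u k)) :
    ∃ ν : Measure (GenBraid κ n), IsUniform ν p := by
  choose μ hμ using h
  let μs : ℕ → ProbabilityMeasure (GenBraid κ n) := fun k => ⟨μ k, (hμ k).isProbabilityMeasure⟩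
  -- Probability measures on a compact metrizable space form a compact space; a limit along an
  -- ultrafilter is enough, and clopen cylinders keep their masses in the limit.
  obtain ⟨μ', -, hμ'⟩ := isCompact_univ.ultrafilter_le_nhds ((Filter.hyperfilter ℕ).map μs) (by simp)
  have hlim : Filter.Tendsto μs (Filter.hyperfilter ℕ) (nhds μ') := hμ'
  have hle : (Filter.hyperfilter ℕ : Filter ℕ) ≤ Filter.atTop := by
    rw [← Nat.cofinite_eq_atTop]; exact Filter.hyperfilter_le_cofinite
  refine ⟨μ', inferInstance, ge_of_tendsto' hu fun k => (hμ k).nonneg, fun x => ?_⟩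
  have h1 := ProbabilityMeasure.tendsto_measure_of_isClopen_of_tendsto hlim
    (isClopen_fullCylinder x)
  have h2 := (NNReal.continuous_coe.tendsto _).comp h1
  refine tendsto_nhds_unique h2 (((hu.pow (len x)).mono_left hle).congr fun k => ?_)
  exact ((hμ k).real_fullCylinder x).symm

/-! ### The radius of convergence -/

theorem exists_eq_mul_of_le_len {m : ℕ} (h : m ≤ len x) : ∃ y z, len y = m ∧ x = y * z := by
  induction m generalizing x with
  | zero => exact ⟨1, x, len_one, (one_mul x).symm⟩
  | succ m ih =>
    obtain ⟨s, x', rfl⟩ := exists_eq_gen_mul (x := x) (by rintro rfl; rw [len_one] at h; omega)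
    rw [len_mul, len_gen] at h
    obtain ⟨y, z, hy, rfl⟩ := ih (x := x') (by omega)
    exact ⟨gen s * y, z, by rw [len_mul, len_gen, hy, add_comm], by rw [mul_assoc]⟩

/-- Submultiplicativity of the number of braids of given length. -/
theorem summable_of_sum_lt_one {m : ℕ} (hm : 0 < m) (ht : 0 ≤ t)
    (h : ((finite_len_eq (κ := κ) (n := n) m).toFinset.card : ℝ) * t ^ m < 1) :
    Summable fun x : Braid κ n => t ^ len x := by
  classical
  set L := (finite_len_eq (κ := κ) (n := n) m).toFinset with hL
  set c := (L.card : ℝ) * t ^ m with hc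
  let B : ℕ → Finset (Braid κ n) := fun k => (finite_len_le (k * m)).toFinset
  let S : ℕ → ℝ := fun k => ∑ x ∈ B k, t ^ len x
  let S₁ := ∑ x ∈ B 1, t ^ len x
  have hS₁ : 0 ≤ S₁ := Finset.sum_nonneg fun x _ => by positivity
  -- A braid longer than `m` factors as `y z` with `|y| = m`, and the weights of such `y` sum to `c
  -- < 1`.
  have hstep : ∀ k, S (k + 1) ≤ S₁ + c * S k := by
    intro k
    have hsub : B (k + 1) ⊆ B 1 ∪ (L ×ˢ B k).image fun yz => yz.1 * yz.2 := by
      intro x hx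
      rw [Finset.mem_union]
      by_cases hxm : len x ≤ m
      · left; simpa [B] using hxm
      · right
        obtain ⟨y, z, hy, rfl⟩ := exists_eq_mul_of_le_len (x := x) (m := m) (by omega)
        refine Finset.mem_image.2 ⟨(y, z), Finset.mem_product.2 ⟨by simpa [hL] using hy, ?_⟩, rfl⟩
        have : len (y * z) ≤ (k + 1) * m := by simpa [B] using hx
        rw [len_mul, hy, add_mul, one_mul] at this
        simpa [B] using (show len z ≤ k * m by omega)
    have himg : ∑ x ∈ (L ×ˢ B k).image (fun yz => yz.1 * yz.2), t ^ len x ≤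
        ∑ yz ∈ L ×ˢ B k, t ^ len (yz.1 * yz.2) :=
      Finset.sum_image_le_of_nonneg fun x _ => by positivity
    have hprod : ∑ yz ∈ L ×ˢ B k, t ^ len (yz.1 * yz.2) = c * S k := by
      rw [Finset.sum_product, hc, ← nsmul_eq_mul, ← Finset.sum_const, Finset.sum_mul_sum]
      refine Finset.sum_congr rfl fun y hy => Finset.sum_congr rfl fun z _ => ?_
      have : len y = m := by simpa [hL] using hy
      rw [len_mul, pow_add, this]
    calc S (k + 1) ≤ ∑ x ∈ B 1 ∪ (L ×ˢ B k).image fun yz => yz.1 * yz.2, t ^ len x :=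
          Finset.sum_le_sum_of_subset_of_nonneg hsub fun x _ _ => by positivity
      _ ≤ S₁ + ∑ x ∈ (L ×ˢ B k).image (fun yz => yz.1 * yz.2), t ^ len x := by
          rw [← Finset.sum_union_inter]
          exact le_add_of_nonneg_right (Finset.sum_nonneg fun x _ => by positivity)
      _ ≤ S₁ + c * S k := by rw [← hprod]; gcongr
  have hc0 : 0 ≤ c := by positivity
  -- The recursion has fixed point `S₁ / (1 - c)`; the added `1` covers the initial value `S 0 = 1`.
  have hbound : ∀ k, S k ≤ (S₁ + 1) / (1 - c) := by
    intro k
    induction k with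
    | zero =>
      have : S 0 = 1 := by
        have : B 0 = {1} := by ext x; simp [B, len_eq_zero]
        simp [S, this, len_one]
      rw [this, le_div_iff₀ (by linarith)]; linarith
    | succ k ih =>
      refine (hstep k).trans ?_
      rw [le_div_iff₀ (by linarith)] at ih ⊢
      nlinarith
  refine summable_of_sum_le (fun x => by positivity) (c := (S₁ + 1) / (1 - c)) fun F => ?_
  obtain ⟨N, hN⟩ : ∃ N, ∀ x ∈ F, len x ≤ N := ⟨F.sup len, fun x hx => Finset.le_sup hx⟩
  refine le_trans (Finset.sum_le_sum_of_subset_of_nonneg (fun x hx => ?_) fun x _ _ => by positivity)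
    (hbound N)
  have := hN x hx
  simpa [B] using this.trans (Nat.le_mul_of_pos_right N hm)

theorem summable_mono {t' : ℝ} (ht : 0 ≤ t) (htt : t ≤ t')
    (h : Summable fun x : Braid κ n => t' ^ len x) : Summable fun x : Braid κ n => t ^ len x :=
  Summable.of_nonneg_of_le (fun _ => by positivity) (fun _ => by gcongr) h

theorem exists_gen (hn : 2 ≤ n) : Nonempty (Gen κ n) := by
  cases κ
  · exact ⟨(⟨0, by omega⟩ : Fin (n - 1))⟩
  · exact ⟨(⟨(⟨0, by omega⟩, ⟨1, by omega⟩), by simp⟩ : DualGen n)⟩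

theorem le_one_of_summable (hn : 2 ≤ n) (ht : 0 ≤ t)
    (hs : Summable fun x : Braid κ n => t ^ len x) : t ≤ 1 :=
  have ⟨s⟩ := exists_gen (κ := κ) hn
  (isUniform_gibbs ht hs).le_one s

theorem bddAbove_summable (hn : 2 ≤ n) :
    BddAbove {t : ℝ | 0 ≤ t ∧ Summable fun x : Braid κ n => t ^ len x} :=
  ⟨1, fun _ h => le_one_of_summable hn h.1 h.2⟩

theorem summable_zero : Summable fun x : Braid κ n => (0 : ℝ) ^ len x := by
  refine summable_of_ne_finset_zero (s := {1}) fun x hx => zero_pow ?_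
  rwa [Finset.mem_singleton, ← len_eq_zero] at hx

theorem le_radius (hn : 2 ≤ n) (ht : 0 ≤ t) (hs : Summable fun x : Braid κ n => t ^ len x) :
    t ≤ radius κ n := le_csSup (bddAbove_summable hn) ⟨ht, hs⟩

theorem summable_of_lt_radius (ht : 0 ≤ t) (h : t < radius κ n) :
    Summable fun x : Braid κ n => t ^ len x := by
  have hne : {t : ℝ | 0 ≤ t ∧ Summable fun x : Braid κ n => t ^ len x}.Nonempty :=
    ⟨0, le_rfl, summable_zero⟩
  obtain ⟨t', ht', htt'⟩ := exists_lt_of_lt_csSup hne h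
  exact summable_mono ht htt'.le ht'.2

theorem radius_pos (hn : 2 ≤ n) : 0 < radius κ n := by
  set C := ((finite_len_eq (κ := κ) (n := n) 1).toFinset.card : ℝ) with hC
  have hC0 : 0 ≤ C := Nat.cast_nonneg _
  refine lt_of_lt_of_le (show 0 < (C + 1)⁻¹ by positivity) (le_radius hn (by positivity) ?_)
  refine summable_of_sum_lt_one one_pos (by positivity) ?_
  rw [pow_one, ← hC, ← div_eq_mul_inv, div_lt_one (by positivity)]
  linarith

/-- Convergence at the radius would make the total weight of some length less than one. By
continuity this persists slightly beyond the radius, where `summable_of_sum_lt_one` then gives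
convergence. -/
theorem not_summable_radius (hn : 2 ≤ n) : ¬ Summable fun x : Braid κ n => radius κ n ^ len x := by
  intro hs
  have hq := radius_pos (κ := κ) hn
  have h1 : ∀ m : ℕ, ((finite_len_eq (κ := κ) (n := n) m).toFinset.card : ℝ) * radius κ n ^ m =
      ∑ x ∈ (finite_len_eq (κ := κ) (n := n) m).toFinset, radius κ n ^ len x := by
    intro m
    rw [← nsmul_eq_mul, ← Finset.sum_const]
    refine Finset.sum_congr rfl fun x hx => ?_
    have : len x = m := by simpa using hx
    rw [this]
  obtain ⟨s, hs'⟩ := summable_iff_vanishing_norm.1 hs 1 one_pos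
  obtain ⟨N, hN⟩ : ∃ N, ∀ x ∈ s, len x ≤ N := ⟨s.sup len, fun x hx => Finset.le_sup hx⟩
  have h2 : ((finite_len_eq (κ := κ) (n := n) (N + 1)).toFinset.card : ℝ) *
      radius κ n ^ (N + 1) < 1 := by
    rw [h1]
    refine lt_of_abs_lt (hs' _ (Finset.disjoint_left.2 fun x hx hxs => ?_))
    have h3 : len x = N + 1 := by simpa using hx
    have := hN x hxs
    omega
  have hcont : Filter.Tendsto (fun t : ℝ =>
      ((finite_len_eq (κ := κ) (n := n) (N + 1)).toFinset.card : ℝ) * t ^ (N + 1))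
      (nhdsWithin (radius κ n) (Set.Ioi (radius κ n)))
      (nhds (((finite_len_eq (κ := κ) (n := n) (N + 1)).toFinset.card : ℝ) *
        radius κ n ^ (N + 1))) :=
    (Continuous.tendsto (by fun_prop) _).mono_left nhdsWithin_le_nhds
  obtain ⟨t, ht1, ht2⟩ := ((hcont.eventually_lt_const h2).and self_mem_nhdsWithin).exists
  have ht2' : radius κ n < t := ht2
  have := le_radius hn (hq.le.trans ht2'.le)
    (summable_of_sum_lt_one (Nat.succ_pos N) (hq.le.trans ht2'.le) ht1)
  linarith

theorem exists_isUniform_of_le_radius (hn : 2 ≤ n) (hp : 0 ≤ p) (h : p ≤ radius κ n) :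
    ∃ ν : Measure (GenBraid κ n), IsUniform ν p := by
  rcases h.lt_or_eq with h | rfl
  · exact ⟨_, isUniform_gibbs hp (summable_of_lt_radius hp h)⟩
  · obtain ⟨u, -, hu, hu'⟩ := exists_seq_strictMono_tendsto' (radius_pos (κ := κ) hn)
    exact exists_isUniform_of_tendsto hu' fun k =>
      ⟨_, isUniform_gibbs (hu k).1.le (summable_of_lt_radius (hu k).1.le (hu k).2)⟩

theorem moebius_pos_of_lt_radius (hp : 0 ≤ p) (h : p < radius κ n) : 0 < moebius κ n p := by
  by_contra hc
  have := moebius_mul_tsum hp (summable_of_lt_radius (κ := κ) (n := n) hp h)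
  rw [ENNReal.ofReal_of_nonpos (not_lt.1 hc), zero_mul] at this
  exact zero_ne_one this

/-- Since `H G = 1`, the prescribed atoms already have total mass one and leave nothing for the
boundary. -/
theorem isUniform_iff_real_singleton (hp : 0 ≤ p) (h : p < radius κ n) :
    IsUniform ν p ↔ IsProbabilityMeasure ν ∧
      ∀ x : Braid κ n, ν.real {ofBraid x} = moebius κ n p * p ^ len x := by
  have hs := summable_of_lt_radius (κ := κ) (n := n) hp h
  refine ⟨fun hu => ⟨hu.isProbabilityMeasure, hu.real_singleton⟩, fun ⟨h1, h2⟩ => ?_⟩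
  have hg := isUniform_gibbs hp hs
  have := hg.isProbabilityMeasure
  have e : ν = gibbs κ n p := by
    refine ext_of_finiteBraids ?_ gibbs_compl_finiteBraids fun x => ?_
    · rw [prob_compl_eq_zero_iff measurableSet_finiteBraids,
        measure_finiteBraids_of_real (moebius_pos_of_lt_radius hp h).le h2,
        moebius_mul_tsum hp hs]
    · exact (measureReal_eq_measureReal_iff).1 ((h2 x).trans (hg.real_singleton x).symm)
  rw [e]; exact hg

theorem IsUniform.hasSupport_finiteBraids (hu : IsUniform ν p) (hp : 0 < p)
    (h : p < radius κ n) : HasSupport ν (finiteBraids κ n) := by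
  have := hu.isProbabilityMeasure
  have hpos := moebius_pos_of_lt_radius (κ := κ) (n := n) hp.le h
  constructor
  · rw [hu.unique (isUniform_gibbs hp.le (summable_of_lt_radius hp.le h))]
    exact gibbs_compl_finiteBraids
  · rintro _ ⟨x, rfl⟩
    rw [Measure.mem_support_iff_forall]
    intro U hU
    have h1 : 0 < ν.real {ofBraid x} := by rw [hu.real_singleton]; positivity
    have h2 : 0 < ν {ofBraid x} := (ENNReal.toReal_pos_iff.1 h1).1
    exact h2.trans_le (measure_mono (Set.singleton_subset_iff.2 (mem_of_mem_nhds hU)))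

theorem IsUniform.finiteBraids_eq_zero (hn : 2 ≤ n) (hu : IsUniform ν (radius κ n)) :
    ν (finiteBraids κ n) = 0 := by
  have := hu.isProbabilityMeasure
  -- The growth series is infinite at the radius, and the convention `0 * ∞ = 0` gives the correct
  -- value because each atom is null.
  rw [measure_finiteBraids_of_real hu.moebius_nonneg hu.real_singleton,
    hu.moebius_eq_zero (not_summable_radius hn)]
  simp

theorem real_cylinder_of_finiteBraids_eq_zero (h : ν (finiteBraids κ n) = 0) (x : Braid κ n) :
    ν.real (cylinder x) = ν.real (fullCylinder x) := by
  have : cylinder x = fullCylinder x \ finiteBraids κ n := rfl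
  rw [this, measureReal_def, measure_sdiff_null h, measureReal_def]

theorem isUniform_radius_iff (hn : 2 ≤ n) : IsUniform ν (radius κ n) ↔
    IsProbabilityMeasure ν ∧ ∀ x : Braid κ n, ν.real (cylinder x) = radius κ n ^ len x := by
  constructor
  · intro hu
    exact ⟨hu.isProbabilityMeasure, fun x => by
      rw [real_cylinder_of_finiteBraids_eq_zero (hu.finiteBraids_eq_zero hn),
        hu.real_fullCylinder]⟩
  · rintro ⟨h1, h2⟩
    -- The case `x = 1` says that the boundary has full mass.
    have h0 : ν (finiteBraids κ n) = 0 := by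
      have := h2 1
      rw [len_one, pow_zero, cylinder, fullCylinder_one, Set.univ_inter, measureReal_def,
        ENNReal.toReal_eq_one_iff] at this
      rw [← compl_compl (finiteBraids κ n)]
      exact (prob_compl_eq_zero_iff measurableSet_finiteBraids.compl).2 this
    exact ⟨h1, (radius_pos hn).le, fun x => by
      rw [← real_cylinder_of_finiteBraids_eq_zero h0, h2]⟩

end

section

/-! ### Positivity of the transition weights -/

variable {κ : Kind} {n : ℕ} {x y z : Braid κ n} {ξ η : GenBraid κ n}
  {ν ν' : Measure (GenBraid κ n)} {p t : ℝ}

/-- The generators other than `a`. -/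
def others (a : Gen κ n) : Finset (Gen κ n) :=
  have := Classical.decPred fun s : Gen κ n => s ≠ a
  Finset.univ.filter fun s => s ≠ a

theorem mem_others {a s : Gen κ n} : s ∈ others a ↔ s ≠ a := by simp [others]

theorem subset_others {a : Gen κ n} {K : Finset (Gen κ n)} (h : a ∉ K) : K ⊆ others a :=
  fun _ hs => mem_others.2 fun e => h (e ▸ hs)

theorem adjSwap_injective : Function.Injective (adjSwap : Fin (n - 1) → Equiv.Perm (Fin n)) := by
  intro i j h
  have h1 := adjSwap_apply_val i (lo i)
  have h2 := adjSwap_apply_val j (lo i)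
  rw [h, if_pos (show (lo i : ℕ) = i from rfl)] at h1
  rw [h1] at h2
  by_contra hij
  have hij' : (i : ℕ) ≠ j := fun e => hij (Fin.ext e)
  rw [if_neg (show (lo i : ℕ) ≠ j from hij')] at h2
  split_ifs at h2 <;> simp only [lo] at * <;> omega

theorem dualSwap_injective : Function.Injective (dualSwap : DualGen n → Equiv.Perm (Fin n)) := by
  rintro ⟨⟨i, j⟩, hij⟩ ⟨⟨k, l⟩, hkl⟩ h
  have h1 : Equiv.swap i j i = Equiv.swap k l i := congrArg (fun f : Equiv.Perm (Fin n) => f i) h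
  rw [Equiv.swap_apply_left, Equiv.swap_apply_def] at h1
  simp only at hij hkl
  split_ifs at h1 with h2 h3
  · subst h2; subst h1; rfl
  · subst h3; subst h1; exact absurd hij hkl.asymm
  · exact absurd h1 hij.ne'

theorem gen_injective : Function.Injective (gen : Gen κ n → Braid κ n) := by
  intro s t h
  have h1 : (germ κ n).atom s = (germ κ n).atom t := congrArg (germ κ n).toGroup h
  cases κ
  · exact adjSwap_injective h1
  · exact dualSwap_injective h1

/-- For `k ≠ a`, the least common multiple of `a` and `k` divides `Δ` and begins with some `a s`, so
`s` can follow `a`. Above `a`, avoiding all such `a s` hence avoids every other generator. -/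
theorem IsUniform.mob_others_ge_follow (h : IsUniform ν p) (a : Gen κ n) :
    p * mob (follow (gen a)) p ≤ mob (others a) p := by
  have := h.mob_ge (gen a) (K := others a) (K' := follow (gen a)) fun k hk => ?_
  · rwa [len_gen, pow_one] at this
  obtain ⟨l, hl⟩ := exists_isLcm (gen a) (gen k)
  obtain ⟨r, rfl⟩ := hl.1
  have hr : r ≠ 1 := by
    rintro rfl
    have h1 := hl.2.1
    rw [mul_one] at h1
    exact mem_others.1 hk (gen_injective (eq_of_dvd_of_len_le h1 (by rw [len_gen, len_gen])))
  obtain ⟨s, hs⟩ := exists_gen_dvd hr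
  exact ⟨s, mem_follow.2 ((mul_dvd_mul_left _ hs).trans
    (hl.2.2 _ (gen_dvd_delta a) (gen_dvd_delta k))),
    fun m h1 h2 => (mul_dvd_mul_left _ hs).trans (hl.2.2 m h1 h2)⟩

/-! ### Positivity for positive braids -/

section Artin

/-- The index of the generator `σ_i`. -/
def ag (i : Fin (n - 1)) : Gen .artin n := i

/-- The generator `σ_i` of the monoid of positive braids. -/
abbrev artinGen (i : Fin (n - 1)) : Braid .artin n := gen (ag i)

theorem artin_cases {P : Gen .artin n → Prop} (h : ∀ i : Fin (n - 1), P (ag i))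
    (a : Gen .artin n) : P a := h a

variable {i j : Fin (n - 1)} {m : Braid .artin n}

theorem artinGen_comm (h : (i : ℕ) + 2 ≤ j ∨ (j : ℕ) + 2 ≤ i) :
    artinGen i * artinGen j = artinGen j * artinGen i := artin_of_comm h

theorem artinGen_mul_dvd (h : (i : ℕ) + 2 ≤ j ∨ (j : ℕ) + 2 ≤ i) (hi : artinGen i ∣ m)
    (hj : artinGen j ∣ m) : artinGen i * artinGen j ∣ m := by
  have := Germ.word_dvd_of_dvd (Γ := artinGerm n) (L := [i, j])
    (fun w _ h1 h2 => spells_comm h h1 h2) hi hj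
  rwa [Germ.word_cons, Germ.word_cons, Germ.word_nil, mul_one] at this

theorem artinGen_braid_dvd (h : (i : ℕ) + 1 = j ∨ (j : ℕ) + 1 = i) (hi : artinGen i ∣ m)
    (hj : artinGen j ∣ m) : artinGen i * artinGen j * artinGen i ∣ m := by
  have := Germ.word_dvd_of_dvd (Γ := artinGerm n) (L := [i, j, i])
    (fun w _ h1 h2 => spells_braid h h1 h2) hi hj
  rwa [Germ.word_cons, Germ.word_cons, Germ.word_cons, Germ.word_nil, mul_one,
    ← mul_assoc] at this

theorem artinGen_sq_not_dvd (i : Fin (n - 1)) :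
    ¬ artinGen i * artinGen i ∣ delta .artin n := by
  intro h
  rw [delta_eq_lift] at h
  have h1 := adjSwap_pre_iff.1 (Germ.pre_of_mul_dvd (Γ := artinGerm n) h)
  have h2 := adjSwap_pre_iff.1 ((artinGerm n).atom_pre i)
  change ((adjSwap i)⁻¹ * (artinGerm n).top)⁻¹ (hi i) <
    ((adjSwap i)⁻¹ * (artinGerm n).top)⁻¹ (lo i) at h1
  rw [mul_inv_rev, inv_inv, Equiv.Perm.mul_apply, Equiv.Perm.mul_apply, adjSwap,
    Equiv.swap_apply_left, Equiv.swap_apply_right] at h1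
  exact lt_asymm h1 h2

/-- The generators of index less than `j`. -/
def lowerGens (n j : ℕ) : Finset (Gen .artin n) :=
  Finset.univ.filter (α := Fin (n - 1)) fun i => (i : ℕ) < j

theorem mem_lowerGens {i : Fin (n - 1)} {j : ℕ} : ag i ∈ lowerGens n j ↔ (i : ℕ) < j :=
  Finset.mem_filter_univ (α := Fin (n - 1)) i

variable {μ : Measure (GenBraid .artin n)}

/-- Compare above `b a`, where `a` and `b` have indices `j` and `j + 1`. There `a` forces `b a b`
and a lower generator `k` forces `b a k`, so it suffices to avoid `b` and the generators below `a`.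
The latter commute with `b`, and each step costs a factor `p ^ 2 * (1 - p)`. -/
theorem IsUniform.mob_lowerGens_pos (h : IsUniform μ p) (hp : 0 < p) (hp1 : p < 1) {j : ℕ}
    (hj : j + 2 ≤ n) : 0 < mob (lowerGens n j) p := by
  classical
  induction j with
  | zero =>
    have : lowerGens n 0 = ∅ :=
      Finset.eq_empty_of_forall_notMem (artin_cases fun i hi =>
        absurd (mem_lowerGens.1 hi) (Nat.not_lt_zero _))
    rw [this, mob_empty]; exact one_pos
  | succ j ih =>
    have ih := ih (by omega)
    let a : Fin (n - 1) := ⟨j, by omega⟩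
    let b : Fin (n - 1) := ⟨j + 1, by omega⟩
    have h1 := h.mob_insert_ge (ag b) (K := lowerGens n j) fun s => by
      induction s using artin_cases with
      | _ s =>
      intro hs
      have hs' := mem_lowerGens.1 hs
      have := artinGen_comm (i := b) (j := s) (.inr (by change _ ≤ j + 1; omega))
      exact ⟨_, this⟩
    have h2 := h.mob_ge (artinGen b * artinGen a) (K := lowerGens n (j + 1))
      (K' := insert (ag b) (lowerGens n j)) fun k => ?_
    · have h3 : 0 < (1 - p) * mob (lowerGens n j) p := mul_pos (by linarith) ih
      exact lt_of_lt_of_le (mul_pos (pow_pos hp _) (h3.trans_le h1)) h2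
    · induction k using artin_cases with
      | _ k =>
      intro hk
      have hk' := mem_lowerGens.1 hk
      by_cases hkj : (k : ℕ) = j
      · refine ⟨ag b, Finset.mem_insert_self _ _, fun m h1 h2 => ?_⟩
        obtain rfl : k = a := Fin.ext hkj
        exact artinGen_braid_dvd (.inr rfl) ((dvd_mul_right _ _).trans h1) h2
      · refine ⟨ag k, Finset.mem_insert_of_mem (mem_lowerGens.2 (by omega)), fun m h1 h2 => ?_⟩
        obtain ⟨m', rfl⟩ := (dvd_mul_right _ _).trans h1
        rw [braid_mul_dvd_mul_iff] at h1
        have h3 : artinGen k ∣ m' := braid_mul_dvd_mul_iff.1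
          (artinGen_mul_dvd (i := b) (j := k) (.inr (by change _ ≤ j + 1; omega))
            (dvd_mul_right _ _) h2)
        rw [mul_assoc, braid_mul_dvd_mul_iff]
        by_cases hk2 : (k : ℕ) + 1 = j
        · exact (dvd_mul_right _ _).trans (artinGen_braid_dvd (i := a) (j := k) (.inr hk2) h1 h3)
        · exact artinGen_mul_dvd (i := a) (j := k) (.inr (by change _ ≤ j; omega)) h1 h3

/-- Any `k ≠ a` does not divide `a b`, so its least common multiple with `a b` extends it by some
letter `s`. The result divides `Δ`, which excludes `s = b` because `b b` is not simple. -/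
theorem IsUniform.mob_others_ge_of_adj (h : IsUniform μ p) {a b : Fin (n - 1)}
    (hab : (a : ℕ) + 1 = b) : p ^ 2 * mob (others (ag b)) p ≤
      mob (others (ag a)) p := by
  have := h.mob_ge (artinGen a * artinGen b) (K := others (ag a))
    (K' := others (ag b)) fun k => ?_
  · rwa [len_mul, len_gen, len_gen] at this
  induction k using artin_cases with
  | _ k =>
  intro hk
  obtain ⟨l, hl⟩ := exists_isLcm (artinGen a * artinGen b) (artinGen k)
  have hd : artinGen a * artinGen b ∣ delta .artin n :=
    (dvd_mul_right _ _).trans (artinGen_braid_dvd (.inl hab) (gen_dvd_delta _) (gen_dvd_delta _))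
  have hld := hl.2.2 _ hd (gen_dvd_delta _)
  obtain ⟨r, rfl⟩ := hl.1
  have hka : ag k ≠ ag a := mem_others.1 hk
  have hr : r ≠ 1 := by
    rintro rfl
    have h1 := hl.2.1
    rw [mul_one] at h1
    have hka' : (k : ℕ) ≠ a := fun e => hka (Fin.ext e)
    by_cases hc : (a : ℕ) + 1 = (k : ℕ) ∨
        (k : ℕ) + 1 = a
    · have h2 := len_le_of_dvd (artinGen_braid_dvd (i := a) (j := k) hc (dvd_mul_right _ _) h1)
      simp only [len_mul, len_gen] at h2
      omega
    · have h2 := artinGen_mul_dvd (i := a) (j := k) (by omega) (dvd_mul_right _ _) h1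
      rw [braid_mul_dvd_mul_iff] at h2
      have h3 : ag k = ag b := gen_injective (eq_of_dvd_of_len_le h2 (by rw [len_gen, len_gen]))
      exact hc (.inl (hab.trans (congrArg Fin.val h3).symm))
  obtain ⟨s, hs⟩ := exists_gen_dvd hr
  refine ⟨s, mem_others.2 ?_, fun m h1 h2 => (mul_dvd_mul_left _ hs).trans (hl.2.2 m h1 h2)⟩
  intro e
  rw [e] at hs
  have h4 := (mul_dvd_mul_left _ hs).trans hld
  rw [mul_assoc] at h4
  exact artinGen_sq_not_dvd b (dvd_delta_of_mul_dvd h4)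

theorem IsUniform.mob_others_artin_pos (h : IsUniform μ p) (hp : 0 < p) (hp1 : p < 1)
    (a : Gen .artin n) : 0 < mob (others a) p := by
  induction a using artin_cases with
  | _ a =>
  -- Induction on the distance `d` to the last generator, for which the other generators are exactly
  -- the lower ones.
  obtain ⟨d, hd⟩ : ∃ d, (a : ℕ) + d + 2 = n := ⟨n - 2 - a, by omega⟩
  induction d generalizing a with
  | zero =>
    have : others (ag a) = lowerGens n a := by
      ext k
      induction k using artin_cases with
      | _ k =>
      have hk := k.2
      rw [mem_others, mem_lowerGens]
      constructor
      · intro hka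
        have hka' : (k : ℕ) ≠ a := fun e => hka (Fin.ext e)
        omega
      · intro hka e
        exact hka.ne (congrArg Fin.val e)
    rw [this]; exact h.mob_lowerGens_pos hp hp1 (by omega)
  | succ d ih =>
    exact lt_of_lt_of_le (mul_pos (pow_pos hp 2) (ih ⟨a + 1, by omega⟩ (by simp; omega)))
      (h.mob_others_ge_of_adj rfl)

end Artin

/-! ### Positivity for dual positive braids -/

section Dual

open Equiv Equiv.Perm

variable {i j k l : Fin n} {m : Braid .dual n}

/-- The index of the generator `σ_{i,j}`. -/
def dgen (h : i < j) : Gen .dual n := dg h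

/-- The generator `σ_{i,j}` of the dual braid monoid. -/
abbrev dualGen (h : i < j) : Braid .dual n := gen (dgen h)

theorem dualGen_triangle_dvd (hij : i < j) (hjk : j < k) (h1 : dualGen hij ∣ m)
    (h2 : dualGen hjk ∣ m) : dualGen hij * dualGen hjk ∣ m := by
  have := Germ.word_dvd_of_dvd (Γ := dualGerm n) (L := [dg hij, dg hjk])
    (fun w hw h1 h2 => (dualSpells_triangle hw hij hjk (dualSwap_pre_iff.1 h1)
      (dualSwap_pre_iff.1 h2)).1) h1 h2
  rwa [Germ.word_cons, Germ.word_cons, Germ.word_nil, mul_one] at this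

theorem dualGen_triangle_dvd' (hij : i < j) (hjk : j < k) (h1 : dualGen (hij.trans hjk) ∣ m)
    (h2 : dualGen hjk ∣ m) : dualGen (hij.trans hjk) * dualGen hij ∣ m := by
  have := Germ.word_dvd_of_dvd (Γ := dualGerm n) (L := [dg (hij.trans hjk), dg hij])
    (s := dg (hij.trans hjk)) (t := dg hjk) (fun w hw h1 h2 => (dualSpells_triangle hw hij hjk
      ((dualSwap_pre_iff.1 h1).trans (dualSwap_pre_iff.1 h2).symm)
      (dualSwap_pre_iff.1 h2)).2.2) h1 h2
  rwa [Germ.word_cons, Germ.word_cons, Germ.word_nil, mul_one] at this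

theorem dualGen_disjoint_dvd (hij : i < j) (hjk : j < k) (hkl : k < l) (h1 : dualGen hij ∣ m)
    (h2 : dualGen hkl ∣ m) : dualGen hij * dualGen hkl ∣ m := by
  have := Germ.word_dvd_of_dvd (Γ := dualGerm n) (L := [dg hij, dg hkl])
    (fun w hw h1 h2 => (dualSpells_disjoint hw hij hjk hkl (dualSwap_pre_iff.1 h1)
      (dualSwap_pre_iff.1 h2)).1) h1 h2
  rwa [Germ.word_cons, Germ.word_cons, Germ.word_nil, mul_one] at this

theorem dualGen_crossing_dvd (hik : i < k) (hkj : k < j) (hjl : j < l)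
    (h1 : dualGen (hik.trans hkj) ∣ m) (h2 : dualGen (hkj.trans hjl) ∣ m) :
    dualGen (hik.trans hkj) * dualGen hik ∣ m := by
  have := Germ.word_dvd_of_dvd (Γ := dualGerm n) (L := [dg (hik.trans hkj), dg hik, dg hjl])
    (fun w hw h1 h2 => (dualSpells_crossing hw hik hkj hjl (dualSwap_pre_iff.1 h1)
      (dualSwap_pre_iff.1 h2)).1) h1 h2
  rw [Germ.word_cons, Germ.word_cons, Germ.word_cons, Germ.word_nil, mul_one,
    ← mul_assoc] at this
  exact (dvd_mul_right _ _).trans this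

theorem mem_Ico_iff_of_mem_follow (hij : i < j) (hkl : k < l)
    (h : (dgen hkl) ∈ follow (dualGen hij)) :
    (i ≤ k ∧ k < j) ↔ (i ≤ l ∧ l < j) := by
  have h1 := mem_follow.1 h
  rw [delta_eq_lift] at h1
  have h2 := dualSwap_pre_iff.1 (Germ.pre_of_mul_dvd (Γ := dualGerm n) h1)
  change SameCycle ((swap i j)⁻¹ * finRotate n) k l at h2
  rw [swap_inv] at h2
  exact mem_Ico_iff_of_sameCycle hij h2

/-- The generators `σ_{k,l}` with `i ≤ k < l`. -/
def upperGens (n i : ℕ) : Finset (Gen .dual n) :=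
  (Finset.univ : Finset (DualGen n)).filter fun a => i ≤ (a.1.1 : ℕ)

theorem mem_upperGens {i : ℕ} {hkl : k < l} :
    (dgen hkl) ∈ upperGens n i ↔ i ≤ (k : ℕ) :=
  Finset.mem_filter_univ (α := DualGen n) (dg hkl)

theorem dual_cases {P : Gen .dual n → Prop} (h : ∀ (k l : Fin n) (hkl : k < l), P (dgen hkl))
    (a : Gen .dual n) : P a := h _ _ (show DualGen n from a).2

variable {μ : Measure (GenBraid .dual n)}

/-- Compare above `σ_{0,i+1}`. There, any chord starting at `i` forces the next letter `σ_{0,i}`, by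
a triangle or a crossing, and a chord starting later forces itself. Since `σ_{0,i}` commutes with
all the later chords, each step costs `p * (1 - p)`. -/
theorem IsUniform.mob_upperGens_pos (h : IsUniform μ p) (hp : 0 < p) (hp1 : p < 1) {i d : ℕ}
    (hi : 0 < i) (hd : i + d + 1 = n) : 0 < mob (upperGens n i) p := by
  classical
  induction d generalizing i with
  | zero =>
    have : upperGens n i = ∅ := by
      refine Finset.eq_empty_of_forall_notMem fun a => ?_
      induction a using dual_cases with
      | _ k l hkl =>
      rw [mem_upperGens]
      omega
    rw [this, mob_empty]; exact one_pos
  | succ d ih =>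
    have ih := ih (i := i + 1) (by omega) (by omega)
    obtain ⟨u, hu⟩ : ∃ u : Fin n, (u : ℕ) = 0 := ⟨⟨0, by omega⟩, rfl⟩
    obtain ⟨a, ha⟩ : ∃ a : Fin n, (a : ℕ) = i := ⟨⟨i, by omega⟩, rfl⟩
    obtain ⟨b, hb⟩ : ∃ b : Fin n, (b : ℕ) = i + 1 := ⟨⟨i + 1, by omega⟩, rfl⟩
    have o : u < a := by omega
    have o' : a < b := by omega
    have h1 := h.mob_insert_ge (dgen o) (K := upperGens n (i + 1)) fun s => by
      induction s using dual_cases with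
      | _ k l hkl =>
      intro hs
      rw [mem_upperGens] at hs
      exact ⟨_, dualOf_disjoint o (show a < k by omega) hkl⟩
    have h2 := h.mob_ge (dualGen (o.trans o')) (K := upperGens n i)
      (K' := insert (dgen o) (upperGens n (i + 1))) fun s => ?_
    · have h3 : 0 < (1 - p) * mob (upperGens n (i + 1)) p := mul_pos (by linarith) ih
      exact lt_of_lt_of_le (mul_pos (pow_pos hp _) (h3.trans_le h1)) h2
    · induction s using dual_cases with
      | _ k l hkl =>
      intro hs
      rw [mem_upperGens] at hs
      by_cases hk : k = a
      · subst hk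
        refine ⟨dgen o, Finset.mem_insert_self _ _, fun m h1 h2 => ?_⟩
        by_cases hl : l = b
        · subst hl
          exact dualGen_triangle_dvd' o o' h1 h2
        · exact dualGen_crossing_dvd o o' (by omega) h1 h2
      · refine ⟨dgen hkl, Finset.mem_insert_of_mem (mem_upperGens.2 (by omega)), fun m h1 h2 => ?_⟩
        by_cases hk1 : k = b
        · subst hk1
          exact dualGen_triangle_dvd (o.trans o') hkl h1 h2
        · exact dualGen_disjoint_dvd (o.trans o') (by omega) hkl h1 h2

/-- The endpoints `k` and `l` are separated by the cut at `i, j`, so `σ_{k,l}` cannot follow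
`σ_{i,j}`, and the generators that can follow avoid `σ_{k,l}`. -/
theorem IsUniform.mob_others_pos_of_mem (h : IsUniform μ p) (hp : 0 < p) (hij : i < j)
    (hkl : k < l) (hs : ¬ ((i ≤ k ∧ k < j) ↔ (i ≤ l ∧ l < j)))
    (hpos : 0 < mob (others (dgen hkl)) p) :
    0 < mob (others (dgen hij)) p := by
  refine lt_of_lt_of_le (mul_pos hp (hpos.trans_le (h.mob_antitone (subset_others ?_))))
    (h.mob_others_ge_follow (dgen hij))
  exact fun hm => hs (mem_Ico_iff_of_mem_follow hij hkl hm)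

/-- No chord from `0` can follow `σ_{0,1}`, which reduces this case to the upper generators.
Positivity then spreads through separated pairs: from `(0, 1)` to `(1, j)`, from `(1, j)` to `(0,
j)`, and from `(0, i)` to `(i, j)`. -/
theorem IsUniform.mob_others_dual_pos (h : IsUniform μ p) (hp : 0 < p) (hp1 : p < 1)
    (a : Gen .dual n) : 0 < mob (others a) p := by
  have base : ∀ (i j : Fin n) (hij : i < j), (i : ℕ) = 0 → (j : ℕ) = 1 →
      0 < mob (others (dgen hij)) p := by
    intro i j hij hi hj
    have h1 := h.mob_upperGens_pos hp hp1 (i := 1) (d := n - 2) one_pos (by omega)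
    refine lt_of_lt_of_le (mul_pos hp (h1.trans_le (h.mob_antitone ?_)))
      (h.mob_others_ge_follow (dgen hij))
    intro s
    induction s using dual_cases with
    | _ k l hkl =>
    intro hs
    have h2 := mem_Ico_iff_of_mem_follow hij hkl hs
    rw [mem_upperGens]
    simp only [Fin.le_def, Fin.lt_def] at h2 hkl
    omega
  have one : ∀ (i j : Fin n) (hij : i < j), (i : ℕ) = 1 →
      0 < mob (others (dgen hij)) p := by
    intro i j hij hi
    have o : (⟨0, by omega⟩ : Fin n) < ⟨1, by omega⟩ := Nat.one_pos
    refine h.mob_others_pos_of_mem hp hij o ?_ (base _ _ o rfl rfl)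
    simp only [Fin.le_def, Fin.lt_def] at hij ⊢
    omega
  have zero : ∀ (i j : Fin n) (hij : i < j), (i : ℕ) = 0 →
      0 < mob (others (dgen hij)) p := by
    intro i j hij hi
    by_cases hj : (j : ℕ) = 1
    · exact base i j hij hi hj
    rw [Fin.lt_def] at hij
    have o : (⟨1, by omega⟩ : Fin n) < j := by rw [Fin.lt_def]; change 1 < (j : ℕ); omega
    refine h.mob_others_pos_of_mem hp hij o ?_ (one _ _ o rfl)
    simp only [Fin.le_def, Fin.lt_def]
    omega
  induction a using dual_cases with
  | _ i j hij =>
  by_cases hi : (i : ℕ) = 0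
  · exact zero i j hij hi
  have o : (⟨0, by omega⟩ : Fin n) < i := by rw [Fin.lt_def]; exact Nat.pos_of_ne_zero hi
  refine h.mob_others_pos_of_mem hp hij o ?_ (zero _ _ o rfl)
  simp only [Fin.le_def, Fin.lt_def] at hij ⊢
  omega

end Dual

theorem IsUniform.mob_others_pos (h : IsUniform ν p) (hp : 0 < p) (hp1 : p < 1) (a : Gen κ n) :
    0 < mob (others a) p := by
  cases κ
  · exact h.mob_others_artin_pos hp hp1 a
  · exact h.mob_others_dual_pos hp hp1 a

theorem subsingleton_gen : Subsingleton (Gen κ 2) := by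
  refine ⟨fun a b => ?_⟩
  cases κ
  · exact Subsingleton.elim (α := Fin 1) a b
  · induction a using dual_cases with
    | _ i j hij =>
    induction b using dual_cases with
    | _ k l hkl =>
    obtain rfl : i = k := by omega
    obtain rfl : j = l := by omega
    rfl

theorem mob_others_two (a : Gen κ 2) : mob (others a) t = 1 := by
  have : others a = ∅ := Finset.eq_empty_of_forall_notMem fun s hs =>
    mem_others.1 hs (subsingleton_gen.elim s a)
  rw [this, mob_empty]

/-! ### The radius is less than one on at least three strands -/

/-- The union of the cylinders of two adjacent generators has mass at least `2 p - p ^ 3`. -/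
theorem IsUniform.two_mul_le {μ : Measure (GenBraid .artin n)} (h : IsUniform μ p)
    (hn : 3 ≤ n) : 2 * p ≤ 1 + p ^ 3 := by
  have := h.isProbabilityMeasure
  let a : Fin (n - 1) := ⟨0, by omega⟩
  let b : Fin (n - 1) := ⟨1, by omega⟩
  have h1 := measureReal_union_add_inter (μ := μ) (s := {ξ | Below (artinGen a) ξ})
    (measurableSet_below (artinGen b))
  have h2 : {ξ | Below (artinGen a) ξ} ∩ {ξ | Below (artinGen b) ξ} ⊆
      {ξ | Below (artinGen a * artinGen b * artinGen a) ξ} := by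
    rintro ξ ⟨⟨i, hi⟩, j, hj⟩
    exact ⟨max i j, artinGen_braid_dvd (.inl rfl) (hi.trans (ξ.take_dvd (le_max_left _ _)))
      (hj.trans (ξ.take_dvd (le_max_right _ _)))⟩
  have h3 := measureReal_mono (μ := μ) h2
  have h4 : μ.real ({ξ | Below (artinGen a) ξ} ∪ {ξ | Below (artinGen b) ξ}) ≤ 1 :=
    measureReal_le_one
  rw [h.real_below, h.real_below] at h1
  rw [h.real_below] at h3
  simp only [len_mul, len_gen, pow_one] at h1 h3
  norm_num at h3
  linarith

/-- The three generators of a triangle have the same pairwise join, of length two, so the union of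
their cylinders has mass at least `3 p - 2 p ^ 2`. -/
theorem IsUniform.three_mul_le {μ : Measure (GenBraid .dual n)} (h : IsUniform μ p)
    (hn : 3 ≤ n) : 3 * p ≤ 1 + 2 * p ^ 2 := by
  have := h.isProbabilityMeasure
  have o : (⟨0, by omega⟩ : Fin n) < ⟨1, by omega⟩ := Nat.one_pos
  have o' : (⟨1, by omega⟩ : Fin n) < ⟨2, by omega⟩ := Nat.one_lt_two
  set d := dualGen o * dualGen o' with hd
  have e1 : d = dualGen o' * dualGen (o.trans o') := dualOf_triangle₁ o o'
  have e2 : d = dualGen (o.trans o') * dualGen o := e1.trans (dualOf_triangle₂ o o')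
  have key : ∀ {a b : Braid .dual n}, (∀ m, a ∣ m → b ∣ m → d ∣ m) →
      {ξ | Below a ξ} ∩ {ξ | Below b ξ} ⊆ {ξ | Below d ξ} := by
    rintro a b hab ξ ⟨⟨i, hi⟩, j, hj⟩
    exact ⟨max i j, hab _ (hi.trans (ξ.take_dvd (le_max_left _ _)))
      (hj.trans (ξ.take_dvd (le_max_right _ _)))⟩
  have k1 := key (a := dualGen o) (b := dualGen o') fun m => dualGen_triangle_dvd o o'
  have k2 := key (a := dualGen o') (b := dualGen (o.trans o')) fun m h1 h2 => by
    rw [e2]; exact dualGen_triangle_dvd' o o' h2 h1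
  have k3 := key (a := dualGen o) (b := dualGen (o.trans o')) fun m h1 h2 => by
    have := Germ.word_dvd_of_dvd (Γ := dualGerm n) (L := [dg o, dg o'])
      (s := dg o) (t := dg (o.trans o')) (fun w hw h1 h2 => (dualSpells_triangle hw o o' (dualSwap_pre_iff.1 h1)
        ((dualSwap_pre_iff.1 h1).symm.trans (dualSwap_pre_iff.1 h2))).1) h1 h2
    rwa [Germ.word_cons, Germ.word_cons, Germ.word_nil, mul_one] at this
  have h1 := measureReal_union_add_inter (μ := μ) (s := {ξ | Below (dualGen o) ξ})
    (measurableSet_below (dualGen o'))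
  have h2 := measureReal_union_add_inter (μ := μ)
    (s := {ξ | Below (dualGen o) ξ} ∪ {ξ | Below (dualGen o') ξ})
    (measurableSet_below (dualGen (o.trans o')))
  have h3 := measureReal_mono (μ := μ) k1
  have h4 : ({ξ | Below (dualGen o) ξ} ∪ {ξ | Below (dualGen o') ξ}) ∩
      {ξ | Below (dualGen (o.trans o')) ξ} ⊆ {ξ | Below d ξ} := by
    rw [Set.union_inter_distrib_right]; exact Set.union_subset k3 k2
  have h5 := measureReal_mono (μ := μ) h4
  have h6 : μ.real (({ξ | Below (dualGen o) ξ} ∪ {ξ | Below (dualGen o') ξ}) ∪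
      {ξ | Below (dualGen (o.trans o')) ξ}) ≤ 1 := measureReal_le_one
  rw [h.real_below, h.real_below] at h1
  rw [h.real_below] at h2 h3 h5
  simp only [hd, len_mul, len_gen, pow_one] at h1 h2 h3 h5
  norm_num at h3 h5
  linarith

theorem radius_lt_one (hn : 3 ≤ n) : radius κ n < 1 := by
  by_contra hc
  -- The value `9 / 10` violates both inequalities: `1.8 > 1.729` and `2.7 > 2.62`.
  have hs := summable_of_lt_radius (κ := κ) (n := n) (t := 9 / 10) (by norm_num)
    (lt_of_lt_of_le (by norm_num) (not_lt.1 hc))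
  have hu := isUniform_gibbs (by norm_num) hs
  cases κ
  · have := hu.two_mul_le hn
    norm_num at this
  · have := hu.three_mul_le hn
    norm_num at this

end

section

/-! ### The range of the parameter and the support at the radius -/

variable {κ : Kind} {n : ℕ} {x : Braid κ n} {ν : Measure (GenBraid κ n)} {p t : ℝ}

/-- A lower bound for the measure of the generalized braids with a given beginning. -/
theorem IsUniform.le_real_take (h : IsUniform ν p) {c : ℝ}
    (hc : ∀ a : Gen κ n, c ≤ mob (others a) p) (η : GenBraid κ n) {k : ℕ} (hk : (η.1 k).1 ≠ 1) :
    c * p ^ len (η.take (k + 1)) ≤ ν.real {ξ | ξ.take (k + 1) = η.take (k + 1)} := by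
  obtain ⟨a, ha⟩ := exists_notMem_follow hk
  rw [h.real_take, mul_comm]
  exact mul_le_mul_of_nonneg_left ((hc a).trans (h.mob_antitone (subset_others ha)))
    (pow_nonneg h.nonneg _)

theorem exists_take_ofBraid (x : Braid κ n) : ∃ k, (ofBraid x).take k = x :=
  (isFin_ofBraid x).imp fun m hm => hm m le_rfl

open Classical in
/-- The number of factors of the Garside normal form of `x`. -/
def height (x : Braid κ n) : ℕ := Nat.find (exists_take_ofBraid x)

theorem take_height (x : Braid κ n) : (ofBraid x).take (height x) = x := by
  classical exact Nat.find_spec (exists_take_ofBraid x)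

theorem ofBraid_ne_one_of_lt_height {k : ℕ} (hk : k < height x) : ((ofBraid x).1 k).1 ≠ 1 := by
  classical
  intro h
  obtain ⟨m, hm⟩ : ∃ m, height x = m + 1 := ⟨height x - 1, by omega⟩
  have h1 := take_height x
  rw [hm, GenBraid.take_succ, GenBraid.eq_one_of_le h (by omega), mul_one] at h1
  exact Nat.find_min (exists_take_ofBraid x) (m := m) (show m < height x by omega) h1

theorem height_le_len (x : Braid κ n) : height x ≤ len x := by
  have key : ∀ k ≤ height x, k ≤ len ((ofBraid x).take k) := by
    intro k
    induction k with
    | zero => exact fun _ => Nat.zero_le _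
    | succ k ih =>
      intro hk
      have h1 := ih (by omega)
      have h2 := len_pos (ofBraid_ne_one_of_lt_height (x := x) (k := k) (by omega))
      rw [GenBraid.take_succ, len_mul]
      omega
  simpa [take_height] using key _ le_rfl

theorem measurableSet_take (k : ℕ) (y : Braid κ n) :
    MeasurableSet {ξ : GenBraid κ n | ξ.take k = y} := (isClopen_take k {y}).2.measurableSet

theorem IsUniform.le_real_take_height (h : IsUniform ν p) {c : ℝ} (hc1 : c ≤ 1)
    (hc : ∀ a : Gen κ n, c ≤ mob (others a) p) (x : Braid κ n) :
    c * p ^ len x ≤ ν.real {ξ | ξ.take (height x) = x} := by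
  have := h.isProbabilityMeasure
  cases hx : height x with
  | zero =>
    have h1 := take_height x
    rw [hx] at h1
    have h2 : x = 1 := h1.symm
    have h3 : {ξ : GenBraid κ n | ξ.take 0 = x} = Set.univ :=
      Set.eq_univ_of_forall fun ξ => h2.symm
    rw [h3, h2, len_one]
    simpa using hc1
  | succ k =>
    have h1 := take_height x
    rw [hx] at h1
    have h2 := h.le_real_take hc (ofBraid x)
      (ofBraid_ne_one_of_lt_height (x := x) (k := k) (by omega))
    rwa [h1] at h2

/-- A uniform measure with positive transition weights bounds the growth series. -/
theorem IsUniform.summable (h : IsUniform ν p) (hp : 0 < p) {c : ℝ} (hc0 : 0 < c) (hc1 : c ≤ 1)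
    (hc : ∀ a : Gen κ n, c ≤ mob (others a) p) (ht : 0 ≤ t) (htp : t < p) :
    Summable fun x : Braid κ n => t ^ len x := by
  classical
  have := h.isProbabilityMeasure
  -- At a given height, distinct braids define disjoint prefix events, each of mass at least `c p ^
  -- |x|`.
  have hlevel : ∀ (F : Finset (Braid κ n)) (k : ℕ),
      ∑ x ∈ F.filter (fun x => height x = k), p ^ len x ≤ c⁻¹ := by
    intro F k
    rw [← one_div, le_div_iff₀' hc0, Finset.mul_sum]
    calc ∑ x ∈ F.filter (fun x => height x = k), c * p ^ len x
        ≤ ∑ x ∈ F.filter (fun x => height x = k), ν.real {ξ | ξ.take k = x} := by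
          refine Finset.sum_le_sum fun x hx => ?_
          have := h.le_real_take_height hc1 hc x
          rwa [(Finset.mem_filter.1 hx).2] at this
      _ = ν.real (⋃ x ∈ F.filter (fun x => height x = k), {ξ | ξ.take k = x}) := by
          rw [measureReal_biUnion_finset]
          · intro x _ y _ hxy
            refine Set.disjoint_left.2 fun ξ h1 h2 => hxy ?_
            exact Eq.trans (Eq.symm h1) h2
          · exact fun x _ => measurableSet_take k x
      _ ≤ 1 := measureReal_le_one
  -- As `|x|` is at least the height, `t ^ |x| ≤ r ^ height x * p ^ |x|`, and summing over the
  -- levels gives a geometric series.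
  set r := t / p with hr
  have hr0 : 0 ≤ r := by positivity
  have hr1 : r < 1 := (div_lt_one hp).2 htp
  refine summable_of_sum_le (fun x => by positivity) (c := (1 - r)⁻¹ * c⁻¹) fun F => ?_
  set N := F.sup height + 1 with hN
  have hmaps : ∀ x ∈ F, height x ∈ Finset.range N := fun x hx =>
    Finset.mem_range.2 (Nat.lt_succ_of_le (Finset.le_sup hx))
  rw [← Finset.sum_fiberwise_of_maps_to hmaps]
  calc ∑ k ∈ Finset.range N, ∑ x ∈ F.filter (fun x => height x = k), t ^ len x
      ≤ ∑ k ∈ Finset.range N, r ^ k * c⁻¹ := by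
        refine Finset.sum_le_sum fun k _ => ?_
        refine le_trans ?_ (mul_le_mul_of_nonneg_left (hlevel F k) (pow_nonneg hr0 k))
        rw [Finset.mul_sum]
        refine Finset.sum_le_sum fun x hx => ?_
        have h1 : t ^ len x = r ^ len x * p ^ len x := by
          rw [← mul_pow, hr, div_mul_cancel₀ _ hp.ne']
        rw [h1]
        refine mul_le_mul_of_nonneg_right ?_ (by positivity)
        refine pow_le_pow_of_le_one hr0 hr1.le ?_
        rw [← (Finset.mem_filter.1 hx).2]
        exact height_le_len x
    _ = (∑ k ∈ Finset.range N, r ^ k) * c⁻¹ := by rw [Finset.sum_mul]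
    _ ≤ (1 - r)⁻¹ * c⁻¹ := by
        refine mul_le_mul_of_nonneg_right ?_ (by positivity)
        rw [← tsum_geometric_of_lt_one hr0 hr1]
        exact (summable_geometric_of_lt_one hr0 hr1).sum_le_tsum _ fun k _ => pow_nonneg hr0 k

theorem IsUniform.mem_Icc_or_eq_one (hn : 2 ≤ n) (h : IsUniform ν p) :
    p ∈ Set.Icc 0 (radius κ n) ∪ {1} := by
  have hne := exists_gen (κ := κ) hn
  rcases (h.le_one hne.some).lt_or_eq with hp1 | hp1
  · left
    refine ⟨h.nonneg, ?_⟩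
    by_contra hc
    rw [not_le] at hc
    have hp : 0 < p := (radius_pos hn).trans hc
    obtain ⟨a, ha⟩ := Finite.exists_min fun a : Gen κ n => mob (others a) p
    -- The midpoint between the radius and `p` would be a point of convergence beyond the radius.
    have hs := h.summable hp (h.mob_others_pos hp hp1 a) (h.mob_le_one _) ha
      (t := (radius κ n + p) / 2) (by have := radius_pos (κ := κ) hn; linarith) (by linarith)
    have := le_radius hn (by have := radius_pos (κ := κ) hn; linarith) hs
    linarith
  · exact .inr hp1

/-- Two strands are treated apart because `radius_lt_one` requires three; there the single generator
leaves no other one, and the polynomial is the constant one. -/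
theorem IsUniform.mob_others_radius_pos (hn : 2 ≤ n) (h : IsUniform ν (radius κ n))
    (a : Gen κ n) : 0 < mob (others a) (radius κ n) := by
  rcases hn.eq_or_lt with rfl | hn'
  · rw [mob_others_two]; exact one_pos
  · exact h.mob_others_pos (radius_pos hn) (radius_lt_one hn') a

theorem IsUniform.hasSupport_boundary (hn : 2 ≤ n) (h : IsUniform ν (radius κ n)) :
    HasSupport ν (boundary κ n) := by
  have := h.isProbabilityMeasure
  have := exists_gen (κ := κ) hn
  constructor
  · rw [boundary, compl_compl]; exact h.finiteBraids_eq_zero hn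
  · intro ξ hξ
    rw [Measure.mem_support_iff_forall]
    intro U hU
    obtain ⟨k, hk⟩ := exists_take_subset hU
    obtain ⟨a, ha⟩ := Finite.exists_min fun a : Gen κ n => mob (others a) (radius κ n)
    have h1 := h.le_real_take ha ξ (mem_boundary_iff.1 hξ k)
    have h2 := h1.trans_lt' (mul_pos (h.mob_others_radius_pos hn a) (pow_pos (radius_pos hn) _))
    exact (ENNReal.toReal_pos_iff.1 h2).1.trans_le (measure_mono fun η hη => hk η hη)

end

end Braids

end

open Braids MeasureTheory in
theorem theorem4p7 (κ : Kind) (n : ℕ) (hn : 2 ≤ n) :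
    -- the range of the parameter
    (∀ p : ℝ, (∃ ν : Measure (GenBraid κ n), IsUniform ν p) ↔
      p ∈ Set.Icc 0 (radius κ n) ∪ {1}) ∧
    -- uniqueness
    (∀ (p : ℝ) (ν ν' : Measure (GenBraid κ n)), IsUniform ν p → IsUniform ν' p → ν = ν') ∧
    -- `p = 0` and `p = 1`
    IsUniform (Measure.dirac (ofBraid (1 : Braid κ n))) 0 ∧
    IsUniform (Measure.dirac (deltaInf κ n)) 1 ∧
    -- `0 < p < q_n`
    (∀ p ∈ Set.Ioo 0 (radius κ n), ∀ ν : Measure (GenBraid κ n),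
      (IsUniform ν p → HasSupport ν (finiteBraids κ n)) ∧
      (IsUniform ν p ↔ IsProbabilityMeasure ν ∧
        ∀ x : Braid κ n, ν.real {ofBraid x} = moebius κ n p * p ^ len x)) ∧
    -- `p = q_n`
    (∀ ν : Measure (GenBraid κ n),
      (IsUniform ν (radius κ n) → HasSupport ν (boundary κ n)) ∧
      (IsUniform ν (radius κ n) ↔ IsProbabilityMeasure ν ∧
        ∀ x : Braid κ n, ν.real (cylinder x) = radius κ n ^ len x)) := by
  refine ⟨fun p => ⟨fun ⟨ν, h⟩ => h.mem_Icc_or_eq_one hn, ?_⟩, fun p ν ν' h h' => h.unique h',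
    isUniform_dirac_one, isUniform_dirac_deltaInf, fun p hp ν => ⟨fun h =>
      h.hasSupport_finiteBraids hp.1 hp.2, isUniform_iff_real_singleton hp.1.le hp.2⟩,
    fun ν => ⟨fun h => h.hasSupport_boundary hn, isUniform_radius_iff hn⟩⟩
  rintro (hp | rfl)
  · exact exists_isUniform_of_le_radius hn hp.1 hp.2
  · exact ⟨_, isUniform_dirac_deltaInf⟩
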